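/- **The $\mathcal S\ell\lambda$-calculus.** Types are $\sigma,\tau ::= \iota \mid \sigma\multimap\tau$. For each type $\sigma$ there are pairwise disjoint countably infinite sets $\mathrm{Var}^\sigma$ and $\mathrm{SVar}^\sigma$ of variables; the elements of $\mathrm{Var}^\iota$ are called ground, those of $\mathrm{Var}^{\sigma\multimap\tau}$ higher-order, and those of $\mathrm{SVar}^\sigma$ stable. Terms, taken up to $\alpha$-equivalence, are $$M ::= \varkappa \mid \underline 0 \mid \mathtt{succ} \mid \mathtt{pred} \mid MN \mid \ell\mathtt{if}\,M\,L\,R \mid \lambda x^\sigma.M \mid \mu F^\sigma.M \qquad (\varkappa \text{ any variable},\ x\in\mathrm{Var}^\sigma,\ F\in \mathrm{SVar}^\sigma),$$ and $\underline{n+1}=\mathtt{succ}\,\underline n$. A basis is a finite list of distinct variables. The judgements $\Gamma\vdash M:\sigma$ are generated by the following rules, in which $x,x_1,x_2\in\mathrm{Var}^\iota$, $F,F_1,F_2\in\mathrm{SVar}^\sigma$, and all lists are bases: * $\vdash\underline 0:\iota$; $\vdash\mathtt{succ}:\iota\multimap\iota$; $\vdash\mathtt{pred}:\iota\multimap\iota$;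 $x\vdash x:\iota$; $f\vdash f:\sigma\multimap\tau$ for $f\in\mathrm{Var}^{\sigma\multimap\tau}$; $F\vdash F:\sigma$; * exchange of two adjacent variables of the basis; * weakening: from $\Gamma\vdash M:\tau$ infer $\Gamma,x\vdash M:\tau$ and $\Gamma,F\vdash M:\tau$; * contraction: from $\Gamma,x_1,x_2\vdash M:\tau$ infer $\Gamma,x\vdash M[x/x_1,x_2]:\tau$, and from $\Gamma,F_1,F_2\vdash M:\tau$ infer $\Gamma,F\vdash M[F/F_1,F_2]:\tau$; * if $\Gamma\cap\Delta=\emptyset$: from $\Gamma\vdash M:\sigma\multimap\tau$ and $\Delta\vdash N:\sigma$ infer $\Gamma,\Delta\vdash MN:\tau$; from $\Gamma\vdash M:\iota$, $\Delta\vdash L:\iota$ and $\Delta\vdash R:\iota$ infer $\Gamma,\Delta\vdash\ell\mathtt{if}\,M\,L\,R:\iota$; * from $\Gamma,y\vdash M:\tau$ with $y\in\mathrm{Var}^\sigma$ infer $\Gamma\vdash\lambda y^\sigma.M:\sigma\multimap\tau$; * if $\Gamma$ consists of ground and $\Delta$ of stable variables: from $\Gamma,\Delta,F\vdash M:\sigma$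 infer $\Gamma,\Delta\vdash\mu F^\sigma.M:\sigma$. The relation $=_{\mathcal S\ell}$ is the least equivalence relation on terms that contains the contextual closure of $$(\lambda f^{\sigma\multimap\tau}.M)N\leadsto M[N/f],\quad (\lambda z^\iota.M)\underline n\leadsto M[\underline n/z],\quad \mu F.M\leadsto M[\mu F.M/F],$$ $$\mathtt{pred}(\mathtt{succ}\,\underline n)\leadsto\underline n,\quad \ell\mathtt{if}\,\underline 0\,L\,R\leadsto L,\quad \ell\mathtt{if}\,\underline{n+1}\,L\,R\leadsto R .$$ **Models.** A *linear category* is a symmetric monoidal closed category $(\mathbf L,\otimes,\multimap,\mathbf 1)$ with a symmetric monoidal comonad $(!,\delta,\varepsilon,q)$, where $q_{A,B}:{!A}\otimes{!B}\to{!(A\otimes B)}$ and $q_{\mathbf 1}:\mathbf 1\to{!\mathbf 1}$, and monoidal natural transformations $d_A:{!A}\to{!A}\otimes{!A}$, $e_A:{!A}\to\mathbf 1$ which make each $!A$ a commutative comonoid and are coalgebra morphisms, such that every coalgebra morphism $({!A},\delta_A)\to({!B},\delta_B)$ is a comonoid morphism. An *exponential object of numerals* in it is a $!$-coalgebra $(N,p)$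 with a commutative comonoid structure $c_N:N\to N\otimes N$, $w_N:N\to\mathbf 1$ and morphisms $0:\mathbf 1\to N$, $succ,pred:N\to N$ such that $0$ and $succ$ are both coalgebra and comonoid morphisms, $p$ is a comonoid morphism, and $pred\circ(n+1)=n$ for all $n$, where $n+1=succ\circ n:\mathbf 1\to N$. An *$\mathcal S\ell\lambda$-category* is a linear category with finite products, an exponential object of numerals, a morphism $\ell if:N\otimes(N\times N)\to N$ with $$\ell if\circ(0\otimes\langle f,g\rangle)\circ\lambda_A^{-1}=f,\qquad \ell if\circ((n+1)\otimes\langle f,g\rangle)\circ\lambda_A^{-1}=g$$ for all objects $A$, all $f,g:A\to N$ and all $n$ (here $\lambda_A:\mathbf 1\otimes A\cong A$), and, for every object $B$, a morphism $fix_B:{!({!B}\multimap B)}\to B$ with $$fix_B=\mathrm{eval}\circ(\varepsilon_{!B\multimap B}\otimes({!fix_B}\circ\delta_{!B\multimap B}))\circ d_{!B\multimap B}.$$ **Interpretation.** Put $[\![\iota]\!]=N$, $[\![\sigma\multimap\tau]\!]=[\![\sigma]\!]\multimap[\![\tau]\!]$; a basis is interpreted as the tensor product of the interpretations of its variables (and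 $\mathbf 1$ if it is empty), where $x\in\mathrm{Var}^\sigma$ contributes $[\![\sigma]\!]$ and $F\in\mathrm{SVar}^\sigma$ contributes $![\![\sigma]\!]$. Up to the canonical isomorphisms of the monoidal structure, a derivation of $\Gamma\vdash M:\sigma$ is interpreted as a morphism $[\![\Gamma]\!]\to[\![\sigma]\!]$ by recursion: the axioms for $\underline 0,\mathtt{succ},\mathtt{pred},x,f,F$ are interpreted as $0$, the curryings of $succ$ and $pred$, identities for $x$ and $f$, and $\varepsilon_{[\![\sigma]\!]}$ for $F$; exchange, weakening and contraction are precomposition with the symmetry, with $w_N$ or $e_{[\![\sigma]\!]}$, and with $c_N$ or $d_{[\![\sigma]\!]}$; abstraction is currying; application is $\mathrm{eval}\circ([\![M]\!]\otimes[\![N]\!])$; the conditional is $\ell if\circ([\![M]\!]\otimes\langle[\![L]\!],[\![R]\!]\rangle)$; and, for $\Gamma$ ground and $\Delta$ stable, $\Gamma,\Delta\vdash\mu F^\sigma.M:\sigma$ is interpreted as $fix_{[\![\sigma]\!]}\circ{!(\mathrm{curry}[\![M]\!])}\circ q\circ(p\otimes\cdots\otimes p\otimes\delta\otimes\cdots\otimes\delta)$,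 with one $p$ for each variable of $\Gamma$ and one $\delta$ for each variable of $\Delta$. **Theorem (Soundness).** In every $\mathcal S\ell\lambda$-category, if $\Gamma\vdash M:\sigma$, $\Gamma\vdash N:\sigma$ and $M=_{\mathcal S\ell}N$, then $[\![\Gamma\vdash M:\sigma]\!]=[\![\Gamma\vdash N:\sigma]\!]$ as morphisms $[\![\Gamma]\!]\to[\![\sigma]\!]$, whichever derivations of the two judgements are used to compute the interpretations. (For $M=N$ this says that the interpretation does not depend on the derivation.) -/

import Mathlib

open CategoryTheory MonoidalCategory CategoryTheory.Limits

universe v u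

namespace Sll

/-! ### Types, variables, terms -/

/-- Types: the ground type of natural numbers and linear arrows. -/
inductive Ty : Type
  | nat : Ty
  | lolli : Ty → Ty → Ty
  deriving DecidableEq

/-- Variables. `ord σ n` is the `n`-th element of `Var^σ` (a ground variable if `σ` is the ground
type, a higher-order variable otherwise) and `stb σ n` is the `n`-th element of `SVar^σ`. -/
inductive Var : Type
  | ord : Ty → ℕ → Var
  | stb : Ty → ℕ → Var
  deriving DecidableEq

/-- Ground variables, i.e. the elements of `Var^ι`. -/
def Var.IsGround : Var → Prop
  | .ord .nat _ => True
  | .ord (.lolli _ _) _ => False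
  | .stb _ _ => False

/-- Stable variables. -/
def Var.IsStable : Var → Prop
  | .ord _ _ => False
  | .stb _ _ => True

/-- Terms modulo `α`-equivalence, in locally nameless form: free variables are named, and a bound
variable is an index pointing to its binder (`0` is the innermost one). `Tm n` consists of the terms
with at most `n` dangling indices. -/
inductive Tm : ℕ → Type
  | fvar {n : ℕ} (x : Var) : Tm n
  | bvar {n : ℕ} (i : Fin n) : Tm n
  | zero {n : ℕ} : Tm n
  | succ {n : ℕ} : Tm n
  | pred {n : ℕ} : Tm n
  | app {n : ℕ} (M N : Tm n) : Tm n
  | lif {n : ℕ} (M L R : Tm n) : Tm n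
  | lam {n : ℕ} (σ : Ty) (M : Tm (n + 1)) : Tm n
  | mu {n : ℕ} (σ : Ty) (M : Tm (n + 1)) : Tm n

/-- A term has no dangling index; it may have named free variables. -/
abbrev Term : Type := Tm 0

namespace Tm

/-- The inclusion of `Tm n` into `Tm m` for `n ≤ m`. -/
def castLE : {n m : ℕ} → n ≤ m → Tm n → Tm m
  | _, _, _, fvar x => fvar x
  | _, _, h, bvar i => bvar (i.castLE h)
  | _, _, _, zero => zero
  | _, _, _, succ => succ
  | _, _, _, pred => pred
  | _, _, h, app M N => app (M.castLE h) (N.castLE h)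
  | _, _, h, lif M L R => lif (M.castLE h) (L.castLE h) (R.castLE h)
  | _, _, h, lam σ M => lam σ (M.castLE (Nat.succ_le_succ h))
  | _, _, h, mu σ M => mu σ (M.castLE (Nat.succ_le_succ h))

/-- `M.subst x P` is the capture-free substitution `M[P/x]` of the term `P` for the free
variable `x`. -/
def subst (x : Var) (P : Term) : {n : ℕ} → Tm n → Tm n
  | n, fvar y => if y = x then P.castLE n.zero_le else fvar y
  | _, bvar i => bvar i
  | _, zero => zero
  | _, succ => succ
  | _, pred => pred
  | _, app M N => app (subst x P M) (subst x P N)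
  | _, lif M L R => lif (subst x P M) (subst x P L) (subst x P R)
  | _, lam σ M => lam σ (subst x P M)
  | _, mu σ M => mu σ (subst x P M)

/-- Turn the free variable `x` into a new, outermost, dangling index. -/
def close (x : Var) : {n : ℕ} → Tm n → Tm (n + 1)
  | n, fvar y => if y = x then bvar (Fin.last n) else fvar y
  | _, bvar i => bvar i.castSucc
  | _, zero => zero
  | _, succ => succ
  | _, pred => pred
  | _, app M N => app (close x M) (close x N)
  | _, lif M L R => lif (close x M) (close x L) (close x R)
  | _, lam σ M => lam σ (close x M)
  | _, mu σ M => mu σ (close x M)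

end Tm

/-- The term `λ x^σ. M`, where `x` is the `n`-th variable of `Var^σ`. -/
def lamv (σ : Ty) (n : ℕ) (M : Term) : Term := .lam σ (Tm.close (.ord σ n) M)

/-- The term `μ F^σ. M`, where `F` is the `n`-th variable of `SVar^σ`. -/
def muv (σ : Ty) (n : ℕ) (M : Term) : Term := .mu σ (Tm.close (.stb σ n) M)

/-- `M[x/x₁,x₂]`. -/
def merge (x x₁ x₂ : Var) (M : Term) : Term :=
  Tm.subst x₂ (.fvar x) (Tm.subst x₁ (.fvar x) M)

/-- Numerals. -/
def num : ℕ → Term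
  | 0 => .zero
  | n + 1 => .app .succ (num n)

/-! ### Reduction -/

/-- The firing of one rule, without context closure. -/
inductive Fire : Term → Term → Prop
  | beta (σ τ : Ty) (n : ℕ) (M N : Term) :
      Fire (.app (lamv (.lolli σ τ) n M) N) (Tm.subst (.ord (.lolli σ τ) n) N M)
  | iota (n k : ℕ) (M : Term) :
      Fire (.app (lamv .nat n M) (num k)) (Tm.subst (.ord .nat n) (num k) M)
  | unfold (σ : Ty) (n : ℕ) (M : Term) :
      Fire (muv σ n M) (Tm.subst (.stb σ n) (muv σ n M) M)
  | pred_succ (k : ℕ) : Fire (.app .pred (.app .succ (num k))) (num k)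
  | lif_zero (L R : Term) : Fire (.lif (num 0) L R) L
  | lif_succ (k : ℕ) (L R : Term) : Fire (.lif (num (k + 1)) L R) R

/-- One-step reduction: the contextual closure of `Fire`. -/
inductive Step : Term → Term → Prop
  | fire {M M' : Term} : Fire M M' → Step M M'
  | app_left {M M' : Term} (N : Term) : Step M M' → Step (.app M N) (.app M' N)
  | app_right (M : Term) {N N' : Term} : Step N N' → Step (.app M N) (.app M N')
  | lif_cond {M M' : Term} (L R : Term) : Step M M' → Step (.lif M L R) (.lif M' L R)
  | lif_left (M : Term) {L L' : Term} (R : Term) : Step L L' → Step (.lif M L R) (.lif M L' R)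
  | lif_right (M L : Term) {R R' : Term} : Step R R' → Step (.lif M L R) (.lif M L R')
  | lamv (σ : Ty) (n : ℕ) {M M' : Term} : Step M M' → Step (lamv σ n M) (lamv σ n M')
  | muv (σ : Ty) (n : ℕ) {M M' : Term} : Step M M' → Step (muv σ n M) (muv σ n M')

/-- The reflexive, symmetric and transitive closure of one-step reduction. -/
def Eqv : Term → Term → Prop := Relation.EqvGen Step

/-! ### Typing -/

/-- A basis is a list of variables; derivable judgements only involve bases without repetitions. -/
abbrev Basis : Type := List Var

/-- `Deriv Γ M σ` is the type of derivations of the judgement `Γ ⊢ M : σ`. -/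
inductive Deriv : Basis → Term → Ty → Type
  | z : Deriv [] .zero .nat
  | s : Deriv [] .succ (.lolli .nat .nat)
  | p : Deriv [] .pred (.lolli .nat .nat)
  | lif {Γ Δ : Basis} {M L R : Term} : Γ.Disjoint Δ →
      Deriv Γ M .nat → Deriv Δ L .nat → Deriv Δ R .nat → Deriv (Γ ++ Δ) (.lif M L R) .nat
  | ex (Γ : Basis) (x y : Var) (Δ : Basis) {M : Term} {τ : Ty} :
      Deriv (Γ ++ y :: x :: Δ) M τ → Deriv (Γ ++ x :: y :: Δ) M τ
  | gv (n : ℕ) : Deriv [.ord .nat n] (.fvar (.ord .nat n)) .nat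
  | gw {Γ : Basis} (n : ℕ) {M : Term} {τ : Ty} : .ord .nat n ∉ Γ →
      Deriv Γ M τ → Deriv (Γ ++ [.ord .nat n]) M τ
  | gc {Γ : Basis} (n n₁ n₂ : ℕ) {M : Term} {τ : Ty} : .ord .nat n ∉ Γ →
      Deriv (Γ ++ [.ord .nat n₁, .ord .nat n₂]) M τ →
      Deriv (Γ ++ [.ord .nat n]) (merge (.ord .nat n) (.ord .nat n₁) (.ord .nat n₂) M) τ
  | hv (σ τ : Ty) (n : ℕ) :
      Deriv [.ord (.lolli σ τ) n] (.fvar (.ord (.lolli σ τ) n)) (.lolli σ τ)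
  | ap {Γ Δ : Basis} {M N : Term} {σ τ : Ty} : Γ.Disjoint Δ →
      Deriv Γ M (.lolli σ τ) → Deriv Δ N σ → Deriv (Γ ++ Δ) (.app M N) τ
  | lam {Γ : Basis} (σ : Ty) (n : ℕ) {M : Term} {τ : Ty} :
      Deriv (Γ ++ [.ord σ n]) M τ → Deriv Γ (lamv σ n M) (.lolli σ τ)
  | sv (σ : Ty) (n : ℕ) : Deriv [.stb σ n] (.fvar (.stb σ n)) σ
  | sc {Γ : Basis} (σ : Ty) (n n₁ n₂ : ℕ) {M : Term} {τ : Ty} : .stb σ n ∉ Γ →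
      Deriv (Γ ++ [.stb σ n₁, .stb σ n₂]) M τ →
      Deriv (Γ ++ [.stb σ n]) (merge (.stb σ n) (.stb σ n₁) (.stb σ n₂) M) τ
  | sw {Γ : Basis} (σ : Ty) (n : ℕ) {M : Term} {τ : Ty} : .stb σ n ∉ Γ →
      Deriv Γ M τ → Deriv (Γ ++ [.stb σ n]) M τ
  | mu {Γ Δ : Basis} (σ : Ty) (n : ℕ) {M : Term} :
      (∀ x ∈ Γ, x.IsGround) → (∀ x ∈ Δ, x.IsStable) →
      Deriv ((Γ ++ Δ) ++ [.stb σ n]) M σ → Deriv (Γ ++ Δ) (muv σ n M) σ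

/-! ### Linear categories and `Sℓλ`-categories -/

noncomputable section Categories

variable (C : Type u) [Category.{v} C] [MonoidalCategory C] [SymmetricCategory C]

/-- A linear category structure (Benton, Bierman, Hyland, de Paiva) on a symmetric monoidal
category; closedness is the separate assumption `MonoidalClosed C`. The maps `q` are the lax
monoidal structure `LaxMonoidal.μ`, `LaxMonoidal.ε` of the functor `bang`, and `d`, `e` are the
comultiplications and counits of the comonoids `bang A`. -/
structure LinearCategory where
  /-- the exponential comonad -/
  bang : Comonad C
  [lax : bang.toFunctor.LaxBraided]
  [delta_monoidal : NatTrans.IsMonoidal bang.δ]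
  [counit_monoidal : NatTrans.IsMonoidal bang.ε]
  /-- the comonoid structure on free coalgebras -/
  [comon : ∀ A : C, ComonObj (bang.obj A)]
  [comm : ∀ A : C, IsCommComonObj (bang.obj A)]
  e_natural {A B : C} (f : A ⟶ B) :
    bang.map f ≫ ComonObj.counit (X := bang.obj B) = ComonObj.counit (X := bang.obj A)
  d_natural {A B : C} (f : A ⟶ B) :
    bang.map f ≫ ComonObj.comul (X := bang.obj B) =
      ComonObj.comul (X := bang.obj A) ≫ (bang.map f ⊗ₘ bang.map f)
  e_tensor (A B : C) :
    Functor.LaxMonoidal.μ bang.toFunctor A B ≫ ComonObj.counit (X := bang.obj (A ⊗ B)) =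
      (ComonObj.counit (X := bang.obj A) ⊗ₘ ComonObj.counit (X := bang.obj B)) ≫
        (λ_ (𝟙_ C)).hom
  e_unit :
    Functor.LaxMonoidal.ε bang.toFunctor ≫ ComonObj.counit (X := bang.obj (𝟙_ C)) = 𝟙 (𝟙_ C)
  d_tensor (A B : C) :
    Functor.LaxMonoidal.μ bang.toFunctor A B ≫ ComonObj.comul (X := bang.obj (A ⊗ B)) =
      (ComonObj.comul (X := bang.obj A) ⊗ₘ ComonObj.comul (X := bang.obj B)) ≫
        tensorμ (bang.obj A) (bang.obj A) (bang.obj B) (bang.obj B) ≫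
          (Functor.LaxMonoidal.μ bang.toFunctor A B ⊗ₘ Functor.LaxMonoidal.μ bang.toFunctor A B)
  d_unit :
    Functor.LaxMonoidal.ε bang.toFunctor ≫ ComonObj.comul (X := bang.obj (𝟙_ C)) =
      (λ_ (𝟙_ C)).inv ≫
        (Functor.LaxMonoidal.ε bang.toFunctor ⊗ₘ Functor.LaxMonoidal.ε bang.toFunctor)
  /-- `e` is a coalgebra morphism -/
  e_coalgebra (A : C) :
    bang.δ.app A ≫ bang.map (ComonObj.counit (X := bang.obj A)) =
      ComonObj.counit (X := bang.obj A) ≫ Functor.LaxMonoidal.ε bang.toFunctor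
  /-- `d` is a coalgebra morphism -/
  d_coalgebra (A : C) :
    bang.δ.app A ≫ bang.map (ComonObj.comul (X := bang.obj A)) =
      ComonObj.comul (X := bang.obj A) ≫ (bang.δ.app A ⊗ₘ bang.δ.app A) ≫
        Functor.LaxMonoidal.μ bang.toFunctor (bang.obj A) (bang.obj A)
  /-- coalgebra morphisms between free coalgebras are comonoid morphisms -/
  free_hom {A B : C} (f : bang.obj A ⟶ bang.obj B) :
    bang.δ.app A ≫ bang.map f = f ≫ bang.δ.app B → IsComonHom f

attribute [instance] LinearCategory.lax LinearCategory.delta_monoidal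
  LinearCategory.counit_monoidal LinearCategory.comon LinearCategory.comm

variable {C}

/-- The numeral `n : 𝟙_ C ⟶ N` determined by zero and successor morphisms. -/
def numeral {N : C} (zero : 𝟙_ C ⟶ N) (succ : N ⟶ N) : ℕ → (𝟙_ C ⟶ N)
  | 0 => zero
  | n + 1 => numeral zero succ n ≫ succ

/-- An exponential object of numerals in a linear category. -/
structure ExpNumerals (𝓛 : LinearCategory C) where
  /-- the coalgebra `(N, p)` -/
  N : C
  p : N ⟶ 𝓛.bang.obj N
  p_counit : p ≫ 𝓛.bang.ε.app N = 𝟙 N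
  p_coassoc : p ≫ 𝓛.bang.δ.app N = p ≫ 𝓛.bang.map p
  zero : 𝟙_ C ⟶ N
  succ : N ⟶ N
  pred : N ⟶ N
  pred_numeral (n : ℕ) : numeral zero succ (n + 1) ≫ pred = numeral zero succ n
  [comon : ComonObj N]
  [comm : IsCommComonObj N]
  zero_coalgebra : Functor.LaxMonoidal.ε 𝓛.bang.toFunctor ≫ 𝓛.bang.map zero = zero ≫ p
  succ_coalgebra : p ≫ 𝓛.bang.map succ = succ ≫ p
  zero_counit : zero ≫ ComonObj.counit (X := N) = 𝟙 (𝟙_ C)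
  zero_comul : zero ≫ ComonObj.comul (X := N) = (λ_ (𝟙_ C)).inv ≫ (zero ⊗ₘ zero)
  succ_comon : IsComonHom succ
  p_comon : IsComonHom p

attribute [instance] ExpNumerals.comon ExpNumerals.comm

section Closed

variable [MonoidalClosed C]

/-- The internal hom `A ⊸ B`. -/
abbrev hom (A B : C) : C := (ihom A).obj B

/-- Currying `Hom(X ⊗ A, B) → Hom(X, A ⊸ B)`. -/
def curr {X A B : C} (f : X ⊗ A ⟶ B) : X ⟶ hom A B :=
  MonoidalClosed.curry ((β_ A X).hom ≫ f)

/-- Evaluation `(A ⊸ B) ⊗ A ⟶ B`. -/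
def eval (A B : C) : hom A B ⊗ A ⟶ B :=
  (β_ (hom A B) A).hom ≫ (ihom.ev A).app B

/-- Evaluation is the morphism whose currying is the identity. -/
lemma curr_eval (A B : C) : curr (eval A B) = 𝟙 (hom A B) := by
  apply MonoidalClosed.uncurry_injective
  simp [curr, eval, MonoidalClosed.uncurry_id_eq_ev]

end Closed

variable (C) in
/-- An `Sℓλ`-category: a linear category with an exponential object of numerals, a conditional and
a fixed point operator. The laws of the conditional quantify over branches `f, g : A ⟶ N` with an
arbitrary domain `A`, as needed for branches with free variables. -/
structure SllCategory [MonoidalClosed C] [HasFiniteProducts C] extends LinearCategory C where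
  /-- the exponential object of numerals -/
  num : ExpNumerals toLinearCategory
  /-- the conditional morphism -/
  cond : num.N ⊗ (num.N ⨯ num.N) ⟶ num.N
  cond_zero {A : C} (f g : A ⟶ num.N) :
    (λ_ A).inv ≫ (num.zero ⊗ₘ prod.lift f g) ≫ cond = f
  cond_succ {A : C} (n : ℕ) (f g : A ⟶ num.N) :
    (λ_ A).inv ≫ (numeral num.zero num.succ (n + 1) ⊗ₘ prod.lift f g) ≫ cond = g
  /-- the fixed point operator -/
  fix (B : C) : bang.obj (hom (bang.obj B) B) ⟶ B
  fix_eq (B : C) :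
    ComonObj.comul (X := bang.obj (hom (bang.obj B) B)) ≫
      (bang.ε.app (hom (bang.obj B) B) ⊗ₘ
        (bang.δ.app (hom (bang.obj B) B) ≫ bang.map (fix B))) ≫ eval (bang.obj B) B = fix B

/-! ### Interpretation -/

namespace SllCategory

variable [MonoidalClosed C] [HasFiniteProducts C] (𝓢 : SllCategory C)

/-- The interpretation of types. -/
@[reducible] def ty : Ty → C
  | .nat => 𝓢.num.N
  | .lolli σ τ => hom (ty σ) (ty τ)

/-- The interpretation of a single variable of a basis. -/
@[reducible] def var : Var → C
  | .ord σ _ => 𝓢.ty σ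
  | .stb σ _ => 𝓢.bang.obj (𝓢.ty σ)

/-- The interpretation of bases. -/
@[reducible] def basis : Basis → C
  | [] => 𝟙_ C
  | x :: Γ => 𝓢.var x ⊗ basis Γ

/-- The canonical isomorphism `⟦Γ, Δ⟧ ≅ ⟦Γ⟧ ⊗ ⟦Δ⟧`. -/
def appendIso : (Γ Δ : Basis) → (𝓢.basis (Γ ++ Δ) ≅ 𝓢.basis Γ ⊗ 𝓢.basis Δ)
  | [], Δ => (λ_ (𝓢.basis Δ)).symm
  | x :: Γ, Δ => whiskerLeftIso (𝓢.var x) (appendIso Γ Δ) ≪≫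
      (α_ (𝓢.var x) (𝓢.basis Γ) (𝓢.basis Δ)).symm

/-- The canonical isomorphism `⟦Γ, x⟧ ≅ ⟦Γ⟧ ⊗ ⟦x⟧`. -/
def snocIso (Γ : Basis) (x : Var) : 𝓢.basis (Γ ++ [x]) ≅ 𝓢.basis Γ ⊗ 𝓢.var x :=
  𝓢.appendIso Γ [x] ≪≫ whiskerLeftIso (𝓢.basis Γ) (ρ_ (𝓢.var x))

/-- The coalgebra structure of a ground (`p`) or stable (`δ`) variable. -/
def coalg : (x : Var) → x.IsGround ∨ x.IsStable → (𝓢.var x ⟶ 𝓢.bang.obj (𝓢.var x))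
  | .ord .nat _, _ => 𝓢.num.p
  | .ord (.lolli _ _) _, h => (h.elim id id : False).elim
  | .stb σ _, _ => 𝓢.bang.δ.app (𝓢.ty σ)

/-- The morphism `q ∘ (p ⊗ ⋯ ⊗ p ⊗ δ ⊗ ⋯ ⊗ δ) : ⟦Γ⟧ ⟶ !⟦Γ⟧` for a basis `Γ` of ground and stable
variables, where `q` is built from the `q_{A,B}` and, for the empty basis, `q_𝟙`. -/
def promote : (Γ : Basis) → (∀ x ∈ Γ, x.IsGround ∨ x.IsStable) →
    (𝓢.basis Γ ⟶ 𝓢.bang.obj (𝓢.basis Γ))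
  | [], _ => Functor.LaxMonoidal.ε 𝓢.bang.toFunctor
  | x :: Γ, h =>
      (𝓢.coalg x (h x List.mem_cons_self) ⊗ₘ
        promote Γ (fun y hy => h y (List.mem_cons_of_mem x hy))) ≫
      Functor.LaxMonoidal.μ 𝓢.bang.toFunctor (𝓢.var x) (𝓢.basis Γ)

/-- The morphism interpreting the replacement of `x` by `x₁, x₂` at the end of a basis, induced by
`c : ⟦x⟧ ⟶ ⟦x₁⟧ ⊗ ⟦x₂⟧`. -/
def contract (Γ : Basis) (x x₁ x₂ : Var) (c : 𝓢.var x ⟶ 𝓢.var x₁ ⊗ 𝓢.var x₂) :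
    𝓢.basis (Γ ++ [x]) ⟶ 𝓢.basis (Γ ++ [x₁, x₂]) :=
  (𝓢.snocIso Γ x).hom ≫
    𝓢.basis Γ ◁ (c ≫ 𝓢.var x₁ ◁ (ρ_ (𝓢.var x₂)).inv) ≫ (𝓢.appendIso Γ [x₁, x₂]).inv

/-- The morphism interpreting the removal of `x` from the end of a basis, induced by
`w : ⟦x⟧ ⟶ 𝟙_ C`. -/
def discard (Γ : Basis) (x : Var) (w : 𝓢.var x ⟶ 𝟙_ C) :
    𝓢.basis (Γ ++ [x]) ⟶ 𝓢.basis Γ :=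
  (𝓢.snocIso Γ x).hom ≫ 𝓢.basis Γ ◁ w ≫ (ρ_ (𝓢.basis Γ)).hom

/-- The symmetry `⟦Γ, x, y, Δ⟧ ⟶ ⟦Γ, y, x, Δ⟧`. -/
def exchange (Γ : Basis) (x y : Var) (Δ : Basis) :
    𝓢.basis (Γ ++ x :: y :: Δ) ⟶ 𝓢.basis (Γ ++ y :: x :: Δ) :=
  (𝓢.appendIso Γ (x :: y :: Δ)).hom ≫
    𝓢.basis Γ ◁ ((α_ (𝓢.var x) (𝓢.var y) (𝓢.basis Δ)).inv ≫
      (β_ (𝓢.var x) (𝓢.var y)).hom ▷ 𝓢.basis Δ ≫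
      (α_ (𝓢.var y) (𝓢.var x) (𝓢.basis Δ)).hom) ≫
    (𝓢.appendIso Γ (y :: x :: Δ)).inv

/-- The interpretation of (derivations of) typing judgements. -/
def interp : {Γ : Basis} → {M : Term} → {σ : Ty} → Deriv Γ M σ → (𝓢.basis Γ ⟶ 𝓢.ty σ)
  | _, _, _, .z => 𝓢.num.zero
  | _, _, _, .s => curr ((λ_ 𝓢.num.N).hom ≫ 𝓢.num.succ)
  | _, _, _, .p => curr ((λ_ 𝓢.num.N).hom ≫ 𝓢.num.pred)
  | _, _, _, .lif (Γ := Γ) (Δ := Δ) _ dM dL dR =>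
      (𝓢.appendIso Γ Δ).hom ≫ (interp dM ⊗ₘ prod.lift (interp dL) (interp dR)) ≫ 𝓢.cond
  | _, _, _, .ex Γ x y Δ d => 𝓢.exchange Γ x y Δ ≫ interp d
  | _, _, _, .gv _ => (ρ_ 𝓢.num.N).hom
  | _, _, _, .gw (Γ := Γ) n _ d =>
      𝓢.discard Γ (.ord .nat n) (ComonObj.counit (X := 𝓢.num.N)) ≫ interp d
  | _, _, _, .gc (Γ := Γ) n n₁ n₂ _ d =>
      𝓢.contract Γ (.ord .nat n) (.ord .nat n₁) (.ord .nat n₂)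
        (ComonObj.comul (X := 𝓢.num.N)) ≫ interp d
  | _, _, _, .hv σ τ _ => (ρ_ (𝓢.ty (.lolli σ τ))).hom
  | _, _, _, .ap (Γ := Γ) (Δ := Δ) (σ := σ) (τ := τ) _ dM dN =>
      (𝓢.appendIso Γ Δ).hom ≫ (interp dM ⊗ₘ interp dN) ≫ eval (𝓢.ty σ) (𝓢.ty τ)
  | _, _, _, .lam (Γ := Γ) σ n d => curr ((𝓢.snocIso Γ (.ord σ n)).inv ≫ interp d)
  | _, _, _, .sv σ _ => (ρ_ (𝓢.bang.obj (𝓢.ty σ))).hom ≫ 𝓢.bang.ε.app (𝓢.ty σ)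
  | _, _, _, .sc (Γ := Γ) σ n n₁ n₂ _ d =>
      𝓢.contract Γ (.stb σ n) (.stb σ n₁) (.stb σ n₂)
        (ComonObj.comul (X := 𝓢.bang.obj (𝓢.ty σ))) ≫ interp d
  | _, _, _, .sw (Γ := Γ) σ n _ d =>
      𝓢.discard Γ (.stb σ n) (ComonObj.counit (X := 𝓢.bang.obj (𝓢.ty σ))) ≫ interp d
  | _, _, _, .mu (Γ := Γ) (Δ := Δ) σ n hΓ hΔ d =>
      𝓢.promote (Γ ++ Δ) (fun x hx => (List.mem_append.1 hx).imp (hΓ x) (hΔ x)) ≫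
        𝓢.bang.map (curr ((𝓢.snocIso (Γ ++ Δ) (.stb σ n)).inv ≫ interp d)) ≫
        𝓢.fix (𝓢.ty σ)

end SllCategory

end Categories

end Sll

/-! A conversion between two typed terms may pass through terms that have no derivation, and a
judgement has many derivations, so induction along the conversion on interpretations of derivations
is not available. The proof uses instead a semantics that never looks at derivations. `Sem` assigns
to each term, typable or not, a predicate on values. A value is a type `σ` with a morphism `X ⊗ ⟦Δ⟧
⟶ ⟦σ⟧`: the `!`-coalgebra `X` carries the data that may be copied and discarded (ground and stable
variables), and the basis `Δ` lists the higher-order variables, which are used linearly. Values are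
compared up to permutations of `Δ`. Abstractions and fixed points are described in Kripke style, by
their behaviour over all coalgebra morphisms `Y ⟶ X`.

Four facts carry the argument. The interpretation of any derivation, composed with an environment,
is a value of its term (`sem_interp`). Parallel reduction keeps values (`sem_par`). Any two values
of a term over repetition-free bases agree up to a permutation, types included (`sem_det`). There is
a generic environment which is a split epimorphism onto `⟦Γ⟧` (`exists_env`). By Church–Rosser
(`Eqv.join`) the two terms have a common reduct, and both interpretations, evaluated in the generic
environment, are values of it. They have the same linear basis, whose only structural permutation is
the identity (`PermMor.eq_id`), so they are equal, and the section cancels the environment. Because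
of confluence, values only have to be transported along reduction, never against it.

On the categorical side, each coalgebra is a commutative comonoid and the tensor product of
coalgebras has projections that behave like those of a product (`dup_fst_snd`). Determinism then
holds because a morphism into `A ⊸ B` is recovered from one generic argument: the second projection
out of `X ⊗ N` or `X ⊗ !A`, or a fresh linear variable at higher type. -/

namespace Sll

/-! ### Renaming and substitution -/

namespace Tm

/-- Extension of a renaming under a binder. -/
def liftRen {n m : ℕ} (r : Fin n → Fin m) : Fin (n + 1) → Fin (m + 1) :=
  Fin.cases 0 fun i => (r i).succ

/-- Renaming of dangling indices. -/
def ren : {n m : ℕ} → (Fin n → Fin m) → Tm n → Tm m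
  | _, _, _, fvar x => fvar x
  | _, _, r, bvar i => bvar (r i)
  | _, _, _, zero => zero
  | _, _, _, succ => succ
  | _, _, _, pred => pred
  | _, _, r, app M N => app (ren r M) (ren r N)
  | _, _, r, lif M L R => lif (ren r M) (ren r L) (ren r R)
  | _, _, r, lam σ M => lam σ (ren (liftRen r) M)
  | _, _, r, mu σ M => mu σ (ren (liftRen r) M)

/-- Extension of a substitution under a binder. -/
def up {n m : ℕ} (s : Fin n → Tm m) : Fin (n + 1) → Tm (m + 1) :=
  Fin.cases (bvar 0) fun i => (s i).ren Fin.succ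

/-- Simultaneous substitution for the free variables and the dangling indices. -/
def bind : {n m : ℕ} → (Var → Tm m) → (Fin n → Tm m) → Tm n → Tm m
  | _, _, φ, _, fvar x => φ x
  | _, _, _, s, bvar i => s i
  | _, _, _, _, zero => zero
  | _, _, _, _, succ => succ
  | _, _, _, _, pred => pred
  | _, _, φ, s, app M N => app (bind φ s M) (bind φ s N)
  | _, _, φ, s, lif M L R => lif (bind φ s M) (bind φ s L) (bind φ s R)
  | _, _, φ, s, lam σ M => lam σ (bind (fun x => (φ x).ren Fin.succ) (up s) M)
  | _, _, φ, s, mu σ M => mu σ (bind (fun x => (φ x).ren Fin.succ) (up s) M)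

/-- Instantiation of the innermost dangling index. -/
def inst {n : ℕ} (M : Tm (n + 1)) (N : Tm n) : Tm n :=
  bind fvar (Fin.cases N bvar) M

theorem liftRen_comp {n m k : ℕ} (r : Fin n → Fin m) (r' : Fin m → Fin k) :
    liftRen r' ∘ liftRen r = liftRen (r' ∘ r) := by
  funext i
  cases i using Fin.cases <;> rfl

theorem ren_ren {n m k : ℕ} (r : Fin n → Fin m) (r' : Fin m → Fin k) (M : Tm n) :
    (M.ren r).ren r' = M.ren (r' ∘ r) := by
  induction M generalizing m k <;> simp_all [ren, liftRen_comp]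

theorem up_liftRen {n m k : ℕ} (r : Fin n → Fin m) (s : Fin m → Tm k) :
    up s ∘ liftRen r = up (s ∘ r) := by
  funext i
  cases i using Fin.cases <;> rfl

theorem bind_ren {n m k : ℕ} (r : Fin n → Fin m) (φ : Var → Tm k) (s : Fin m → Tm k) (M : Tm n) :
    (M.ren r).bind φ s = M.bind φ (s ∘ r) := by
  induction M generalizing m k <;> simp_all [ren, bind, up_liftRen]

theorem ren_up {n m k : ℕ} (s : Fin n → Tm m) (r : Fin m → Fin k) :
    (fun i => (up s i).ren (liftRen r)) = up fun i => (s i).ren r := by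
  funext i
  cases i using Fin.cases
  · rfl
  · simp only [up, Fin.cases_succ, ren_ren]
    rfl

theorem ren_bind {n m k : ℕ} (φ : Var → Tm m) (s : Fin n → Tm m) (r : Fin m → Fin k) (M : Tm n) :
    (M.bind φ s).ren r = M.bind (fun x => (φ x).ren r) (fun i => (s i).ren r) := by
  induction M generalizing m k with
  | lam σ M ih | mu σ M ih =>
    simp only [ren, bind, ih, ren_up, ren_ren]
    rfl
  | _ => simp_all [ren, bind]

theorem bind_up {n m k : ℕ} (s : Fin n → Tm m) (φ : Var → Tm k) (t : Fin m → Tm k) :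
    (fun i => (up s i).bind (fun x => (φ x).ren Fin.succ) (up t)) =
      up fun i => (s i).bind φ t := by
  funext i
  cases i using Fin.cases
  · rfl
  · simp only [up, Fin.cases_succ, ren_bind, bind_ren]
    rfl

theorem bind_bind {n m k : ℕ} (φ : Var → Tm m) (s : Fin n → Tm m) (ψ : Var → Tm k)
    (t : Fin m → Tm k) (M : Tm n) :
    (M.bind φ s).bind ψ t = M.bind (fun x => (φ x).bind ψ t) (fun i => (s i).bind ψ t) := by
  induction M generalizing m k with
  | lam σ M ih | mu σ M ih =>
    simp only [bind, ih, bind_up, bind_ren, ren_bind]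
    rfl
  | _ => simp_all [bind]

theorem up_bvar {n m : ℕ} (r : Fin n → Fin m) :
    (up fun i => bvar (r i)) = fun i => bvar (liftRen r i) := by
  funext i
  cases i using Fin.cases <;> rfl

theorem ren_eq_bind {n m : ℕ} (r : Fin n → Fin m) (M : Tm n) :
    M.ren r = M.bind fvar fun i => bvar (r i) := by
  induction M generalizing m <;> simp_all [ren, bind, up_bvar]

theorem liftRen_id {n : ℕ} : liftRen (id : Fin n → Fin n) = id := by
  funext i
  cases i using Fin.cases <;> rfl

theorem ren_id {n : ℕ} (M : Tm n) : M.ren id = M := by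
  induction M <;> simp_all [ren, liftRen_id]

theorem bind_id {n : ℕ} (M : Tm n) : M.bind fvar bvar = M :=
  (ren_eq_bind id M).symm.trans (ren_id M)

theorem inst_bind {n m : ℕ} (M : Tm (n + 1)) (N : Tm n) (φ : Var → Tm m) (s : Fin n → Tm m) :
    (M.inst N).bind φ s =
      (M.bind (fun x => (φ x).ren Fin.succ) (up s)).inst (N.bind φ s) := by
  simp only [inst, bind_bind, bind_ren]
  congr 1
  · funext x
    exact (bind_id _).symm
  · funext i
    cases i using Fin.cases
    · rfl
    · simp only [Fin.cases_succ, up, bind_ren]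
      exact (bind_id _).symm

theorem inst_ren {n m : ℕ} (M : Tm (n + 1)) (N : Tm n) (r : Fin n → Fin m) :
    (M.inst N).ren r = (M.ren (liftRen r)).inst (N.ren r) := by
  rw [ren_eq_bind, inst_bind, up_bvar, ren_eq_bind, ren_eq_bind]
  rfl

theorem liftRen_castLE {n m : ℕ} (h : n ≤ m) :
    liftRen (Fin.castLE h) = Fin.castLE (Nat.succ_le_succ h) := by
  funext i
  cases i using Fin.cases <;> rfl

theorem castLE_eq_ren {n m : ℕ} (h : n ≤ m) (M : Tm n) : M.castLE h = M.ren (Fin.castLE h) := by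
  induction M generalizing m <;> simp_all [castLE, ren, liftRen_castLE]

/-- Named substitution and closing become instances of `bind`, so one substitution calculus covers
free variables and indices alike. -/
theorem subst_eq_bind (x : Var) (P : Term) {n : ℕ} (M : Tm n) :
    subst x P M = M.bind (fun y => if y = x then P.castLE n.zero_le else fvar y) bvar := by
  induction M with
  | lam σ M ih | mu σ M ih =>
    simp only [subst, bind, ih]
    congr 2
    · funext y
      split_ifs
      -- `P` has no dangling indices, so all its renamings into a given scope agree.
      · simp only [castLE_eq_ren, ren_ren]
        congr 1
        funext i
        exact i.elim0
      · rfl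
    · funext i
      cases i using Fin.cases <;> rfl
  | _ => simp_all [subst, bind]

theorem close_eq_bind (x : Var) {n : ℕ} (M : Tm n) :
    M.close x = M.bind (fun y => if y = x then bvar (Fin.last n) else fvar y)
      fun i => bvar i.castSucc := by
  induction M with
  | lam σ M ih | mu σ M ih =>
    simp only [close, bind, ih]
    congr 2
    · funext y
      split_ifs <;> rfl
    · funext i
      cases i using Fin.cases <;> rfl
  | _ => simp_all [close, bind]

/-- The bridge between the rules of `Fire`, which substitute for a named variable, and those of
`Par`, which instantiate an index. -/
theorem inst_close (x : Var) (M P : Term) : (M.close x).inst P = subst x P M := by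
  rw [close_eq_bind, inst, bind_bind, subst_eq_bind]
  congr 1
  · funext y
    split_ifs with h
    · rw [castLE_eq_ren]
      exact (ren_id P).symm
    · rfl
  · funext i
    exact i.elim0

/-- Numerals in any scope. -/
def numeral {n : ℕ} : ℕ → Tm n
  | 0 => zero
  | k + 1 => app succ (numeral k)

theorem bind_numeral {n m : ℕ} (φ : Var → Tm m) (s : Fin n → Tm m) (k : ℕ) :
    (numeral k).bind φ s = numeral k := by
  induction k <;> simp_all [numeral, bind]

theorem numeral_injective {n : ℕ} : Function.Injective (numeral : ℕ → Tm n) := by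
  intro k l h
  induction k generalizing l with
  | zero => cases l <;> simp_all [numeral]
  | succ k ih =>
    cases l with
    | zero => simp [numeral] at h
    | succ l =>
      simp only [numeral, app.injEq, true_and] at h
      rw [ih h]

end Tm

theorem num_eq_numeral (k : ℕ) : num k = Tm.numeral k := by
  induction k <;> simp_all [num, Tm.numeral]

/-! ### Parallel reduction -/

/-- Parallel reduction of terms with dangling indices. -/
inductive Par : {n : ℕ} → Tm n → Tm n → Prop
  | fvar {n : ℕ} (x : Var) : Par (.fvar x : Tm n) (.fvar x)
  | bvar {n : ℕ} (i : Fin n) : Par (.bvar i) (.bvar i)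
  | zero {n : ℕ} : Par (.zero : Tm n) .zero
  | succ {n : ℕ} : Par (.succ : Tm n) .succ
  | pred {n : ℕ} : Par (.pred : Tm n) .pred
  | app {n : ℕ} {M M' N N' : Tm n} : Par M M' → Par N N' → Par (.app M N) (.app M' N')
  | lif {n : ℕ} {M M' L L' R R' : Tm n} : Par M M' → Par L L' → Par R R' →
      Par (.lif M L R) (.lif M' L' R')
  | lam {n : ℕ} (σ : Ty) {M M' : Tm (n + 1)} : Par M M' → Par (.lam σ M) (.lam σ M')
  | mu {n : ℕ} (σ : Ty) {M M' : Tm (n + 1)} : Par M M' → Par (.mu σ M) (.mu σ M')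
  | beta {n : ℕ} (σ τ : Ty) {M M' : Tm (n + 1)} {N N' : Tm n} : Par M M' → Par N N' →
      Par (.app (.lam (.lolli σ τ) M) N) (M'.inst N')
  | iota {n : ℕ} (k : ℕ) {M M' : Tm (n + 1)} {N : Tm n} : N = .numeral k → Par M M' →
      Par (.app (.lam .nat M) N) (M'.inst N)
  | unfold {n : ℕ} (σ : Ty) {M M' : Tm (n + 1)} : Par M M' →
      Par (.mu σ M) (M'.inst (.mu σ M'))
  | pred_succ {n : ℕ} (k : ℕ) {N : Tm n} : N = .numeral k →
      Par (.app .pred (.app .succ N)) N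
  | lif_zero {n : ℕ} {M L L' R : Tm n} : M = .numeral 0 → Par L L' → Par (.lif M L R) L'
  | lif_succ {n : ℕ} (k : ℕ) {M L R R' : Tm n} : M = .numeral (k + 1) → Par R R' →
      Par (.lif M L R) R'

namespace Par

theorem refl {n : ℕ} (M : Tm n) : Par M M := by
  induction M <;> constructor <;> assumption

theorem ren {n m : ℕ} {M M' : Tm n} (h : Par M M') (r : Fin n → Fin m) :
    Par (M.ren r) (M'.ren r) := by
  induction h generalizing m with
  | beta σ τ _ _ ih₁ ih₂ =>
    have := Par.beta σ τ (ih₁ (Tm.liftRen r)) (ih₂ r)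
    rw [Tm.inst_ren]
    exact this
  | iota k hN _ ih =>
    subst hN
    have := Par.iota (N := (Tm.numeral k).ren r) k
      (by rw [Tm.ren_eq_bind, Tm.bind_numeral]) (ih (Tm.liftRen r))
    rw [Tm.inst_ren]
    exact this
  | unfold σ _ ih =>
    have := Par.unfold σ (ih (Tm.liftRen r))
    rw [Tm.inst_ren]
    exact this
  | pred_succ k hN =>
    subst hN
    exact Par.pred_succ k (by rw [Tm.ren_eq_bind, Tm.bind_numeral])
  | lif_zero hM _ ih =>
    subst hM
    exact Par.lif_zero (by rw [Tm.ren_eq_bind, Tm.bind_numeral]) (ih r)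
  | lif_succ k hM _ ih =>
    subst hM
    exact Par.lif_succ k (by rw [Tm.ren_eq_bind, Tm.bind_numeral]) (ih r)
  | _ => constructor <;> simp_all

theorem up {n m : ℕ} {s s' : Fin n → Tm m} (h : ∀ i, Par (s i) (s' i)) (i : Fin (n + 1)) :
    Par (Tm.up s i) (Tm.up s' i) := by
  cases i using Fin.cases
  · exact refl _
  · exact (h _).ren _

/-- Term and substituted terms are reduced simultaneously, because instantiation may copy its
argument. The rules restricted to numerals survive since numerals are fixed by every substitution.
-/
theorem bind {n m : ℕ} {M M' : Tm n} (h : Par M M') {φ φ' : Var → Tm m} {s s' : Fin n → Tm m}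
    (hφ : ∀ x, Par (φ x) (φ' x)) (hs : ∀ i, Par (s i) (s' i)) :
    Par (M.bind φ s) (M'.bind φ' s') := by
  induction h generalizing m with
  | fvar x => exact hφ x
  | bvar i => exact hs i
  | app _ _ ih₁ ih₂ => exact .app (ih₁ hφ hs) (ih₂ hφ hs)
  | lif _ _ _ ih₁ ih₂ ih₃ => exact .lif (ih₁ hφ hs) (ih₂ hφ hs) (ih₃ hφ hs)
  | lam σ _ ih => exact .lam σ (ih (fun x => (hφ x).ren _) (up hs))
  | mu σ _ ih => exact .mu σ (ih (fun x => (hφ x).ren _) (up hs))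
  | beta σ τ _ _ ih₁ ih₂ =>
    rw [Tm.inst_bind]
    exact .beta σ τ (ih₁ (fun x => (hφ x).ren _) (up hs)) (ih₂ hφ hs)
  | iota k hN _ ih =>
    subst hN
    rw [Tm.inst_bind, Tm.bind_numeral, Tm.bind, Tm.bind, Tm.bind_numeral]
    exact .iota k rfl (ih (fun x => (hφ x).ren _) (up hs))
  | unfold σ _ ih =>
    rw [Tm.inst_bind]
    exact .unfold σ (ih (fun x => (hφ x).ren _) (up hs))
  | pred_succ k hN =>
    subst hN
    simp only [Tm.bind, Tm.bind_numeral]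
    exact .pred_succ k rfl
  | lif_zero hM _ ih =>
    subst hM
    exact .lif_zero (Tm.bind_numeral _ _ _) (ih hφ hs)
  | lif_succ k hM _ ih =>
    subst hM
    exact .lif_succ k (Tm.bind_numeral _ _ _) (ih hφ hs)
  | _ => exact refl _

theorem inst {n : ℕ} {M M' : Tm (n + 1)} {N N' : Tm n} (hM : Par M M') (hN : Par N N') :
    Par (M.inst N) (M'.inst N') := by
  refine hM.bind (fun x => refl _) fun i => ?_
  cases i using Fin.cases
  · exact hN
  · exact refl _

theorem close {n : ℕ} {M M' : Tm n} (h : Par M M') (x : Var) : Par (M.close x) (M'.close x) := by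
  rw [Tm.close_eq_bind, Tm.close_eq_bind]
  exact h.bind (fun _ => refl _) fun _ => refl _

/-- Numerals are normal. Hence a redex whose side condition asks for a numeral remains a redex when
its parts are reduced. -/
theorem numeral_eq {n k : ℕ} {M N : Tm n} (h : Par M N) (hM : M = .numeral k) :
    N = .numeral k := by
  induction k generalizing M N with
  | zero => subst hM; cases h; rfl
  | succ k ih =>
    subst hM
    cases h with
    | app h₁ h₂ => cases h₁; rw [ih h₂ rfl]; rfl

/-- Every term has a reduct to which all of its parallel reducts reduce. -/
theorem exists_development {n : ℕ} (M : Tm n) : ∃ D, ∀ N, Par M N → Par N D := by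
  induction M with
  | fvar x => exact ⟨_, fun N h => by cases h; exact refl _⟩
  | bvar i => exact ⟨_, fun N h => by cases h; exact refl _⟩
  | zero => exact ⟨_, fun N h => by cases h; exact refl _⟩
  | succ => exact ⟨_, fun N h => by cases h; exact refl _⟩
  | pred => exact ⟨_, fun N h => by cases h; exact refl _⟩
  | lam σ M ih =>
    obtain ⟨D, hD⟩ := ih
    exact ⟨.lam σ D, fun N h => by cases h with | lam _ h => exact .lam σ (hD _ h)⟩
  | mu σ M ih =>
    obtain ⟨D, hD⟩ := ih
    refine ⟨D.inst (.mu σ D), fun N h => ?_⟩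
    cases h with
    | mu _ h => exact .unfold σ (hD _ h)
    | unfold _ h => exact (hD _ h).inst (.mu σ (hD _ h))
  | lif M L R ihM ihL ihR =>
    obtain ⟨DM, hM⟩ := ihM
    obtain ⟨DL, hL⟩ := ihL
    obtain ⟨DR, hR⟩ := ihR
    by_cases h : ∃ k, M = .numeral k
    · obtain ⟨k, rfl⟩ := h
      cases k with
      | zero =>
        refine ⟨DL, fun N h => ?_⟩
        cases h with
        | lif h₁ h₂ h₃ => exact .lif_zero (h₁.numeral_eq rfl) (hL _ h₂)
        | lif_zero _ h => exact hL _ h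
        | lif_succ k h _ => exact absurd (Tm.numeral_injective h) (by simp)
      | succ k =>
        refine ⟨DR, fun N h => ?_⟩
        cases h with
        | lif h₁ h₂ h₃ => exact .lif_succ k (h₁.numeral_eq rfl) (hR _ h₃)
        | lif_zero h _ => exact absurd (Tm.numeral_injective h) (by simp)
        | lif_succ _ _ h => exact hR _ h
    · refine ⟨.lif DM DL DR, fun N hN => ?_⟩
      cases hN with
      | lif h₁ h₂ h₃ => exact .lif (hM _ h₁) (hL _ h₂) (hR _ h₃)
      | lif_zero e _ => exact absurd ⟨_, e⟩ h
      | lif_succ k e _ => exact absurd ⟨_, e⟩ h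
  | app M N ihM ihN =>
    obtain ⟨DM, hM⟩ := ihM
    obtain ⟨DN, hN⟩ := ihN
    -- The development contracts whichever redex occurs at the root; the case distinction lists the
    -- possible shapes of a root redex.
    by_cases hps : M = .pred ∧ ∃ k, N = .app .succ (.numeral k)
    · obtain ⟨rfl, k, rfl⟩ := hps
      refine ⟨.numeral k, fun P h => ?_⟩
      cases h with
      | app h₁ h₂ =>
        cases h₁
        rw [h₂.numeral_eq (k := k + 1) rfl]
        exact .pred_succ k rfl
      | pred_succ _ _ => exact refl _
    by_cases hlam : ∃ σ B, M = .lam σ B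
    · obtain ⟨σ, B, rfl⟩ := hlam
      -- No rule contracts an abstraction at its root, so its development is again an abstraction,
      -- and `DB` is a development of the body.
      obtain ⟨DB, rfl⟩ : ∃ DB, DM = .lam σ DB := by
        cases hM _ (refl _) with
        | lam _ _ => exact ⟨_, rfl⟩
      have hB (B') (h : Par B B') : Par B' DB := by
        cases hM _ (.lam σ h) with
        | lam _ h => exact h
      cases σ with
      | nat =>
        -- At ground type only numeral arguments fire. An argument that reduces to a numeral without
        -- being one is left in place in this development.
        by_cases hk : ∃ k, N = .numeral k
        · obtain ⟨k, rfl⟩ := hk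
          refine ⟨DB.inst (.numeral k), fun P h => ?_⟩
          cases h with
          | app h₁ h₂ =>
            rw [h₂.numeral_eq rfl]
            cases h₁ with
            | lam _ h => exact .iota k rfl (hB _ h)
          | iota _ _ h => exact (hB _ h).inst (refl _)
        · refine ⟨.app (.lam .nat DB) DN, fun P h => ?_⟩
          cases h with
          | app h₁ h₂ => exact .app (hM _ h₁) (hN _ h₂)
          | iota k e _ => exact absurd ⟨k, e⟩ hk
      | lolli σ τ =>
        refine ⟨DB.inst DN, fun P h => ?_⟩
        cases h with
        | app h₁ h₂ =>
          cases h₁ with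
          | lam _ h => exact .beta σ τ (hB _ h) (hN _ h₂)
        | beta _ _ h₁ h₂ => exact (hB _ h₁).inst (hN _ h₂)
    · refine ⟨.app DM DN, fun P h => ?_⟩
      cases h with
      | app h₁ h₂ => exact .app (hM _ h₁) (hN _ h₂)
      | beta _ _ _ _ => exact absurd ⟨_, _, rfl⟩ hlam
      | iota _ _ _ => exact absurd ⟨_, _, rfl⟩ hlam
      | pred_succ k e => exact absurd ⟨rfl, k, by rw [e]⟩ hps

end Par

theorem Fire.par {M N : Term} (h : Fire M N) : Par M N := by
  cases h with
  | beta σ τ n M N =>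
    rw [← Tm.inst_close]
    exact .beta σ τ (.refl _) (.refl _)
  | iota n k M =>
    rw [← Tm.inst_close]
    exact .iota k (num_eq_numeral k) (.refl _)
  | unfold σ n M =>
    rw [← Tm.inst_close]
    exact .unfold σ (.refl _)
  | pred_succ k => exact .pred_succ k (num_eq_numeral k)
  | lif_zero L R => exact .lif_zero (num_eq_numeral 0) (.refl _)
  | lif_succ k L R => exact .lif_succ k (num_eq_numeral _) (.refl _)

theorem Step.par {M N : Term} (h : Step M N) : Par M N := by
  induction h with
  | fire h => exact h.par
  | app_left N _ ih => exact .app ih (.refl _)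
  | app_right M _ ih => exact .app (.refl _) ih
  | lif_cond L R _ ih => exact .lif ih (.refl _) (.refl _)
  | lif_left M R _ ih => exact .lif (.refl _) ih (.refl _)
  | lif_right M L _ ih => exact .lif (.refl _) (.refl _) ih
  | lamv σ n _ ih => exact .lam σ (ih.close _)
  | muv σ n _ ih => exact .mu σ (ih.close _)

/-- Church–Rosser: convertible terms have a common parallel reduct. -/
theorem Eqv.join {M N : Term} (h : Eqv M N) :
    Relation.Join (Relation.ReflTransGen Par) M N := by
  have hcr : ∀ a b c : Term, Par a b → Par a c →
      ∃ d, Relation.ReflGen Par b d ∧ Relation.ReflTransGen Par c d := by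
    intro a b c hb hc
    obtain ⟨D, hD⟩ := Par.exists_development a
    exact ⟨D, .single (hD _ hb), .single (hD _ hc)⟩
  have he := Relation.equivalence_join_reflTransGen hcr
  induction h with
  | rel _ _ h => exact ⟨_, .single h.par, .refl⟩
  | refl => exact he.refl _
  | symm _ _ _ ih => exact he.symm ih
  | trans _ _ _ _ _ ih₁ ih₂ => exact he.trans ih₁ ih₂

end Sll

namespace Sll

noncomputable section

/-! ### Permutations of bases -/

section Swap

variable {C : Type u} [Category.{v} C] [MonoidalCategory C] [SymmetricCategory C]

/-- The symmetry exchanging the first two factors of `A ⊗ B ⊗ Z`. -/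
def swapL (A B Z : C) : A ⊗ B ⊗ Z ⟶ B ⊗ A ⊗ Z :=
  (α_ A B Z).inv ≫ (β_ A B).hom ▷ Z ≫ (α_ B A Z).hom

theorem swapL_naturality {A A' B B' Z Z' : C} (f : A ⟶ A') (g : B ⟶ B') (h : Z ⟶ Z') :
    (f ⊗ₘ g ⊗ₘ h) ≫ swapL A' B' Z' = swapL A B Z ≫ (g ⊗ₘ f ⊗ₘ h) := by
  simp only [swapL, Category.assoc, associator_inv_naturality_assoc]
  rw [← associator_naturality, ← tensorHom_id, ← tensorHom_id, tensorHom_comp_tensorHom_assoc,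
    tensorHom_comp_tensorHom_assoc, BraidedCategory.braiding_naturality]
  simp

theorem swapL_naturality_right (A B : C) {Z Z' : C} (h : Z ⟶ Z') :
    A ◁ B ◁ h ≫ swapL A B Z' = swapL A B Z ≫ B ◁ A ◁ h := by
  simpa using swapL_naturality (𝟙 A) (𝟙 B) h

@[simp]
theorem swapL_swapL (A B Z : C) : swapL A B Z ≫ swapL B A Z = 𝟙 _ := by
  simp [swapL, ← comp_whiskerRight_assoc]

/-- The case of `PermMor.exists_pull` where the variable moved to the front differs from both
exchanged variables rests on this identity. -/
theorem swapL_yang_baxter (A B D Z : C) :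
    swapL A B (D ⊗ Z) ≫ B ◁ swapL A D Z ≫ swapL B D (A ⊗ Z) =
      A ◁ swapL B D Z ≫ swapL A D (B ⊗ Z) ≫ D ◁ swapL A B Z := by
  calc
    _ = 𝟙 _ ⊗≫ ((β_ A B).hom ▷ D ⊗≫ B ◁ (β_ A D).hom ⊗≫ (β_ B D).hom ▷ A) ▷ Z ⊗≫ 𝟙 _ := by
      simp only [swapL]
      monoidal
    _ = _ := by
      rw [BraidedCategory.yang_baxter', swapL, swapL, swapL]
      monoidal


/-- Exchanging `A` with the unit. -/
theorem swapL_unit (A Z : C) :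
    swapL A (𝟙_ C) Z = A ◁ (λ_ Z).hom ≫ (λ_ (A ⊗ Z)).inv := by
  simp only [swapL, braiding_tensorUnit_right]
  monoidal

theorem swapL_tensor (A B D Z : C) :
    swapL A (B ⊗ D) Z ≫ (α_ B D (A ⊗ Z)).hom =
      A ◁ (α_ B D Z).hom ≫ swapL A B (D ⊗ Z) ≫ B ◁ swapL A D Z := by
  simp only [swapL, BraidedCategory.braiding_tensor_right_hom]
  monoidal

end Swap

namespace SllCategory

variable {C : Type u} [Category.{v} C] [MonoidalCategory C] [SymmetricCategory C]
  [MonoidalClosed C] [HasFiniteProducts C] (𝓢 : SllCategory C)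

/-- `𝓢.PermMor Γ Δ p` says that `p` is the structural isomorphism given by a permutation from `Γ`
to `Δ` which never exchanges equal variables. -/
inductive PermMor : (Γ Δ : Basis) → (𝓢.basis Γ ⟶ 𝓢.basis Δ) → Prop
  | nil : PermMor [] [] (𝟙 _)
  | cons (x : Var) {Γ Δ : Basis} {p : 𝓢.basis Γ ⟶ 𝓢.basis Δ} : PermMor Γ Δ p →
      PermMor (x :: Γ) (x :: Δ) (𝓢.var x ◁ p)
  | swap {x y : Var} (Γ : Basis) : x ≠ y →
      PermMor (x :: y :: Γ) (y :: x :: Γ) (swapL (𝓢.var x) (𝓢.var y) (𝓢.basis Γ))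
  | trans {Γ Δ Θ : Basis} {p : 𝓢.basis Γ ⟶ 𝓢.basis Δ} {q : 𝓢.basis Δ ⟶ 𝓢.basis Θ} :
      PermMor Γ Δ p → PermMor Δ Θ q → PermMor Γ Θ (p ≫ q)

/-- `𝓢.Pull x Γ Δ f` says that `f` moves the first occurrence of `x` in `Γ` to the front. -/
inductive Pull (x : Var) : (Γ Δ : Basis) → (𝓢.basis Γ ⟶ 𝓢.var x ⊗ 𝓢.basis Δ) → Prop
  | head (Γ : Basis) : Pull x (x :: Γ) Γ (𝟙 _)
  | tail {y : Var} {Γ Δ : Basis} {f : 𝓢.basis Γ ⟶ 𝓢.var x ⊗ 𝓢.basis Δ} : y ≠ x →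
      Pull x Γ Δ f →
      Pull x (y :: Γ) (y :: Δ) (𝓢.var y ◁ f ≫ swapL (𝓢.var y) (𝓢.var x) (𝓢.basis Δ))

variable {𝓢}

namespace PermMor

theorem refl (Γ : Basis) : 𝓢.PermMor Γ Γ (𝟙 _) := by
  induction Γ with
  | nil => exact .nil
  | cons x Γ ih => simpa using PermMor.cons x ih

theorem exists_inv {Γ Δ : Basis} {p : 𝓢.basis Γ ⟶ 𝓢.basis Δ} (h : 𝓢.PermMor Γ Δ p) :
    ∃ q, 𝓢.PermMor Δ Γ q ∧ p ≫ q = 𝟙 _ ∧ q ≫ p = 𝟙 _ := by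
  induction h with
  | nil => exact ⟨𝟙 _, .nil, by simp, by simp⟩
  | cons x _ ih =>
    obtain ⟨q, hq, h₁, h₂⟩ := ih
    exact ⟨_, hq.cons x, by rw [← whiskerLeft_comp, h₁, whiskerLeft_id],
      by rw [← whiskerLeft_comp, h₂, whiskerLeft_id]⟩
  | swap Γ hxy => exact ⟨_, .swap Γ hxy.symm, swapL_swapL _ _ _, swapL_swapL _ _ _⟩
  | trans _ _ ih₁ ih₂ =>
    obtain ⟨q₁, h₁, e₁, e₁'⟩ := ih₁
    obtain ⟨q₂, h₂, e₂, e₂'⟩ := ih₂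
    exact ⟨_, h₂.trans h₁, by simp [reassoc_of% e₂, e₁], by simp [reassoc_of% e₁', e₂']⟩

theorem perm {Γ Δ : Basis} {p : 𝓢.basis Γ ⟶ 𝓢.basis Δ} (h : 𝓢.PermMor Γ Δ p) : Γ.Perm Δ := by
  induction h with
  | nil => exact .nil
  | cons x _ ih => exact ih.cons x
  | swap Γ hxy => exact .swap _ _ _
  | trans _ _ ih₁ ih₂ => exact ih₁.trans ih₂

theorem exists_of_perm {Γ Δ : Basis} (h : Γ.Perm Δ) (hΓ : Γ.Nodup) : ∃ p, 𝓢.PermMor Γ Δ p := by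
  induction h with
  | nil => exact ⟨_, .nil⟩
  | cons x _ ih => exact (ih (List.nodup_cons.1 hΓ).2).imp' _ fun _ hp => hp.cons x
  | swap x y Γ =>
    exact ⟨_, .swap Γ fun h => by simp [h] at hΓ⟩
  | trans h₁ _ ih₁ ih₂ =>
    obtain ⟨p, hp⟩ := ih₁ hΓ
    obtain ⟨q, hq⟩ := ih₂ (h₁.nodup_iff.1 hΓ)
    exact ⟨_, hp.trans hq⟩

/-- Structural isomorphisms commute with moving a variable to the front. -/
theorem exists_pull {x : Var} {Γ Δ : Basis} {p : 𝓢.basis Γ ⟶ 𝓢.basis Δ} (h : 𝓢.PermMor Γ Δ p)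
    {Γ' : Basis} {f : 𝓢.basis Γ ⟶ 𝓢.var x ⊗ 𝓢.basis Γ'} (hf : 𝓢.Pull x Γ Γ' f) :
    ∃ Δ' g p', 𝓢.Pull x Δ Δ' g ∧ 𝓢.PermMor Γ' Δ' p' ∧ p ≫ g = f ≫ 𝓢.var x ◁ p' := by
  induction h generalizing Γ' with
  | nil => cases hf
  | cons y h ih =>
    cases hf with
    | head => exact ⟨_, _, _, .head _, h, by simp⟩
    | tail hy hf =>
      obtain ⟨Δ', g, p', hg, hp', e⟩ := ih hf
      refine ⟨_, _, _, .tail hy hg, hp'.cons y, ?_⟩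
      rw [← whiskerLeft_comp_assoc, e, Category.assoc, ← swapL_naturality_right,
        whiskerLeft_comp_assoc]
  | swap Γ hab =>
    rename_i a b
    cases hf with
    | head =>
      refine ⟨_, _, _, .tail hab.symm (.head _), refl _, ?_⟩
      simp
    | tail ha hf =>
      cases hf with
      | head => exact ⟨_, _, _, .head _, refl _, by simp⟩
      | tail hb hf =>
        -- The pulled variable crosses both exchanged ones, and the two orders of crossing are
        -- compared by Yang–Baxter.
        refine ⟨_, _, _, .tail hb (.tail ha hf), .swap _ hab, ?_⟩
        simp only [whiskerLeft_comp, Category.assoc]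
        rw [← reassoc_of% swapL_naturality_right, swapL_yang_baxter]
  | trans _ _ ih₁ ih₂ =>
    obtain ⟨Δ', g, p', hg, hp', e⟩ := ih₁ hf
    obtain ⟨Θ', k, q', hk, hq', e'⟩ := ih₂ hg
    exact ⟨_, _, _, hk, hp'.trans hq', by simp [e', reassoc_of% e]⟩

/-- Coherence: there is at most one structural isomorphism between two bases. -/
theorem unique {Γ Δ : Basis} {p q : 𝓢.basis Γ ⟶ 𝓢.basis Δ} (hp : 𝓢.PermMor Γ Δ p)
    (hq : 𝓢.PermMor Γ Δ q) : p = q := by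
  induction Γ generalizing Δ with
  | nil =>
    -- A composite may pass through an intermediate basis, so emptiness is carried as an equation
    -- through the induction.
    have key {Γ Δ : Basis} {p : 𝓢.basis Γ ⟶ 𝓢.basis Δ} (h : 𝓢.PermMor Γ Δ p) :
        ∀ (e : Γ = []) (e' : Δ = []), p = eqToHom (by rw [e, e']) := by
      induction h with
      | nil => simp
      | cons => simp
      | swap => simp
      | trans h₁ _ ih₁ ih₂ =>
        rintro rfl rfl
        obtain rfl := h₁.perm.nil_eq
        rw [ih₁ rfl rfl, ih₂ rfl rfl]
        simp
    obtain rfl := hp.perm.nil_eq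
    rw [key hp rfl rfl, key hq rfl rfl]
  | cons x Γ ih =>
    obtain ⟨Δ', g, p', hg, hp', e⟩ := hp.exists_pull (.head Γ)
    obtain ⟨Δ'', g', q', hg', hq', e'⟩ := hq.exists_pull (.head Γ)
    -- The first occurrence of `x` is unique, so both permutations are followed by the same morphism
    -- moving it to the front.
    have key {Δ Δ' Δ'' : Basis} {g : 𝓢.basis Δ ⟶ 𝓢.var x ⊗ 𝓢.basis Δ'}
        {g' : 𝓢.basis Δ ⟶ 𝓢.var x ⊗ 𝓢.basis Δ''} (hg : 𝓢.Pull x Δ Δ' g)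
        (hg' : 𝓢.Pull x Δ Δ'' g') : ∃ e : Δ' = Δ'', g' = g ≫ eqToHom (by rw [e]) := by
      induction hg generalizing Δ'' with
      | head =>
        cases hg' with
        | head => exact ⟨rfl, by simp⟩
        | tail h => exact absurd rfl h
      | tail h _ ih =>
        cases hg' with
        | head => exact absurd rfl h
        | tail h hg' =>
          obtain ⟨rfl, rfl⟩ := ih hg'
          exact ⟨rfl, by simp⟩
    obtain ⟨rfl, rfl⟩ := key hg hg'
    obtain rfl := ih hp' hq'
    -- Moving `x` to the front has a retraction, so it can be cancelled and only the permutations of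
    -- the tails remain.
    have hmono {Δ Δ' : Basis} {g : 𝓢.basis Δ ⟶ 𝓢.var x ⊗ 𝓢.basis Δ'} (hg : 𝓢.Pull x Δ Δ' g) :
        ∃ k, g ≫ k = 𝟙 _ := by
      induction hg with
      | head => exact ⟨𝟙 _, by simp⟩
      | tail _ _ ih =>
        obtain ⟨k, hk⟩ := ih
        refine ⟨swapL _ _ _ ≫ _ ◁ k, ?_⟩
        rw [Category.assoc, reassoc_of% swapL_swapL, ← whiskerLeft_comp, hk, whiskerLeft_id]
    obtain ⟨k, hk⟩ := hmono hg
    rw [eqToHom_refl, Category.comp_id] at e'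
    have := e.trans e'.symm
    have h2 := congrArg (· ≫ k) this
    simpa [hk] using h2

theorem eq_id {Γ : Basis} {p : 𝓢.basis Γ ⟶ 𝓢.basis Γ} (hp : 𝓢.PermMor Γ Γ p) : p = 𝟙 _ :=
  hp.unique (refl Γ)

end PermMor

/-! ### Structural isomorphisms and concatenation of bases. -/

variable (𝓢) in
theorem appendIso_cons_hom (x : Var) (Γ Δ : Basis) :
    (𝓢.appendIso (x :: Γ) Δ).hom =
      𝓢.var x ◁ (𝓢.appendIso Γ Δ).hom ≫ (α_ (𝓢.var x) (𝓢.basis Γ) (𝓢.basis Δ)).inv :=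
  rfl

variable (𝓢) in
theorem appendIso_nil_hom (Δ : Basis) : (𝓢.appendIso [] Δ).hom = (λ_ (𝓢.basis Δ)).inv :=
  rfl

namespace PermMor

theorem append_left (Γ : Basis) {Δ Δ' : Basis} {p : 𝓢.basis Δ ⟶ 𝓢.basis Δ'}
    (hp : 𝓢.PermMor Δ Δ' p) :
    ∃ r, 𝓢.PermMor (Γ ++ Δ) (Γ ++ Δ') r ∧
      r ≫ (𝓢.appendIso Γ Δ').hom = (𝓢.appendIso Γ Δ).hom ≫ 𝓢.basis Γ ◁ p := by
  induction Γ with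
  | nil => exact ⟨p, hp, by simp [appendIso_nil_hom]⟩
  | cons x Γ ih =>
    obtain ⟨r, hr, e⟩ := ih
    refine ⟨_, hr.cons x, ?_⟩
    simp only [appendIso_cons_hom]
    rw [← whiskerLeft_comp_assoc, e]
    simp

theorem append_right {Γ Γ' : Basis} {p : 𝓢.basis Γ ⟶ 𝓢.basis Γ'} (hp : 𝓢.PermMor Γ Γ' p)
    (Δ : Basis) :
    ∃ r, 𝓢.PermMor (Γ ++ Δ) (Γ' ++ Δ) r ∧
      r ≫ (𝓢.appendIso Γ' Δ).hom = (𝓢.appendIso Γ Δ).hom ≫ p ▷ 𝓢.basis Δ := by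
  induction hp with
  | nil => exact ⟨_, refl _, by simp⟩
  | cons x _ ih =>
    obtain ⟨r, hr, e⟩ := ih
    refine ⟨_, hr.cons x, ?_⟩
    simp only [appendIso_cons_hom]
    rw [← whiskerLeft_comp_assoc, e]
    simp
  | swap Γ hxy =>
    refine ⟨_, .swap _ hxy, ?_⟩
    simp only [appendIso_cons_hom, whiskerLeft_comp, Category.assoc]
    rw [← reassoc_of% swapL_naturality_right]
    simp only [swapL]
    monoidal
  | trans _ _ ih₁ ih₂ =>
    obtain ⟨r, hr, e⟩ := ih₁
    obtain ⟨r', hr', e'⟩ := ih₂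
    exact ⟨_, hr.trans hr', by simp [e', reassoc_of% e]⟩

theorem append {Γ Γ' Δ Δ' : Basis} {p : 𝓢.basis Γ ⟶ 𝓢.basis Γ'} {q : 𝓢.basis Δ ⟶ 𝓢.basis Δ'}
    (hp : 𝓢.PermMor Γ Γ' p) (hq : 𝓢.PermMor Δ Δ' q) :
    ∃ r, 𝓢.PermMor (Γ ++ Δ) (Γ' ++ Δ') r ∧
      r ≫ (𝓢.appendIso Γ' Δ').hom = (𝓢.appendIso Γ Δ).hom ≫ (p ⊗ₘ q) := by
  obtain ⟨r, hr, e⟩ := append_right hp Δ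
  obtain ⟨r', hr', e'⟩ := append_left Γ' hq
  exact ⟨_, hr.trans hr', by simp [e', reassoc_of% e, MonoidalCategory.tensorHom_def]⟩

theorem append_assoc (Γ Δ Θ : Basis) :
    ∃ r, 𝓢.PermMor ((Γ ++ Δ) ++ Θ) (Γ ++ (Δ ++ Θ)) r ∧
      r ≫ (𝓢.appendIso Γ (Δ ++ Θ)).hom ≫ 𝓢.basis Γ ◁ (𝓢.appendIso Δ Θ).hom =
        (𝓢.appendIso (Γ ++ Δ) Θ).hom ≫ (𝓢.appendIso Γ Δ).hom ▷ 𝓢.basis Θ ≫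
          (α_ (𝓢.basis Γ) (𝓢.basis Δ) (𝓢.basis Θ)).hom := by
  induction Γ with
  | nil =>
    refine ⟨_, refl _, ?_⟩
    simp [appendIso_nil_hom]
  | cons x Γ ih =>
    obtain ⟨r, hr, e⟩ := ih
    refine ⟨_, hr.cons x, ?_⟩
    have := congrArg (fun t => 𝓢.var x ◁ t) e
    simp only [whiskerLeft_comp] at this
    change _ = (𝓢.appendIso (x :: (Γ ++ Δ)) Θ).hom ≫ _
    simp only [appendIso_cons_hom, Category.assoc, comp_whiskerRight]
    rw [← associator_inv_naturality_right, reassoc_of% this]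
    monoidal

theorem append_nil (Γ : Basis) :
    𝓢.PermMor (Γ ++ []) Γ ((𝓢.appendIso Γ []).hom ≫ (ρ_ (𝓢.basis Γ)).hom) := by
  induction Γ with
  | nil =>
    have : (𝓢.appendIso [] []).hom ≫ (ρ_ (𝓢.basis [])).hom = 𝟙 (𝓢.basis []) := by
      change (λ_ (𝟙_ C)).inv ≫ (ρ_ (𝟙_ C)).hom = 𝟙 _
      rw [← unitors_equal, Iso.inv_hom_id]
    rw [this]
    exact refl _
  | cons x Γ ih =>
    have : (𝓢.appendIso (x :: Γ) []).hom ≫ (ρ_ (𝓢.basis (x :: Γ))).hom =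
        𝓢.var x ◁ ((𝓢.appendIso Γ []).hom ≫ (ρ_ (𝓢.basis Γ)).hom) := by
      simp [appendIso_cons_hom]
    rw [this]
    exact ih.cons x

/-- Freshness of `x` is essential: `PermMor` admits exchanges of distinct variables only, which is
what makes it rigid. -/
theorem shift {x : Var} {Δ : Basis} (hx : x ∉ Δ) (Γ : Basis) :
    ∃ r, 𝓢.PermMor (x :: (Δ ++ Γ)) (Δ ++ x :: Γ) r ∧
      r ≫ (𝓢.appendIso Δ (x :: Γ)).hom =
        𝓢.var x ◁ (𝓢.appendIso Δ Γ).hom ≫ swapL (𝓢.var x) (𝓢.basis Δ) (𝓢.basis Γ) := by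
  induction Δ with
  | nil =>
    refine ⟨_, refl _, ?_⟩
    simp [appendIso_nil_hom, swapL_unit, ← whiskerLeft_comp_assoc]
  | cons y Δ ih =>
    rw [List.mem_cons, not_or] at hx
    obtain ⟨r, hr, e⟩ := ih hx.2
    refine ⟨_, .trans (.swap (Δ ++ Γ) hx.1) (hr.cons y), ?_⟩
    simp only [appendIso_cons_hom, Category.assoc]
    rw [← whiskerLeft_comp_assoc, e, ← cancel_mono (α_ _ _ _).hom]
    simp only [Category.assoc, Iso.inv_hom_id, Category.comp_id, whiskerLeft_comp, swapL_tensor]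
    rw [← reassoc_of% swapL_naturality_right]
    simp [← whiskerLeft_comp_assoc]

theorem comm {Γ Δ : Basis} (h : Γ.Disjoint Δ) :
    ∃ r, 𝓢.PermMor (Γ ++ Δ) (Δ ++ Γ) r ∧
      r ≫ (𝓢.appendIso Δ Γ).hom = (𝓢.appendIso Γ Δ).hom ≫ (β_ _ _).hom := by
  induction Γ with
  | nil =>
    obtain ⟨q, hq, h₁, h₂⟩ := (append_nil (𝓢 := 𝓢) Δ).exists_inv
    refine ⟨q, hq, ?_⟩
    rw [← cancel_mono (ρ_ _).hom, Category.assoc, h₂]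
    simp [appendIso_nil_hom]
  | cons x Γ ih =>
    rw [List.disjoint_cons_left] at h
    obtain ⟨r, hr, e⟩ := ih h.2
    obtain ⟨r', hr', e'⟩ := shift (𝓢 := 𝓢) h.1 Γ
    refine ⟨_, (hr.cons x).trans hr', ?_⟩
    rw [Category.assoc, e', ← whiskerLeft_comp_assoc, e]
    simp [appendIso_cons_hom, swapL]

end PermMor

end SllCategory
end
end Sll

namespace Sll

noncomputable section

/-! ### Coalgebras as commutative comonoids -/

namespace LinearCategory

open Functor.LaxMonoidal

variable {C : Type u} [Category.{v} C] [MonoidalCategory C] [SymmetricCategory C]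
  (𝓛 : LinearCategory C)

variable {𝓛}

/-- Discarding a coalgebra. -/
def wk (X : 𝓛.bang.Coalgebra) : X.A ⟶ 𝟙_ C :=
  X.a ≫ ComonObj.counit (X := 𝓛.bang.obj X.A)

/-- Duplicating a coalgebra. -/
def dup (X : 𝓛.bang.Coalgebra) : X.A ⟶ X.A ⊗ X.A :=
  X.a ≫ ComonObj.comul (X := 𝓛.bang.obj X.A) ≫ (𝓛.bang.ε.app X.A ⊗ₘ 𝓛.bang.ε.app X.A)

theorem hom_wk {X Y : 𝓛.bang.Coalgebra} (f : X ⟶ Y) : f.f ≫ wk Y = wk X := by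
  rw [wk, wk, ← f.h_assoc, 𝓛.e_natural]

theorem hom_dup {X Y : 𝓛.bang.Coalgebra} (f : X ⟶ Y) :
    f.f ≫ dup Y = dup X ≫ (f.f ⊗ₘ f.f) := by
  have := 𝓛.bang.ε.naturality f.f
  rw [dup, dup, ← f.h_assoc, reassoc_of% 𝓛.d_natural f.f]
  simp only [Category.assoc, tensorHom_comp_tensorHom, Functor.id_map] at this ⊢
  rw [this]

/-- `δ` is a coalgebra morphism between free coalgebras, hence a comonoid morphism by `free_hom`. -/
theorem delta_comul (A : C) :
    𝓛.bang.δ.app A ≫ ComonObj.comul (X := 𝓛.bang.obj (𝓛.bang.obj A)) =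
      ComonObj.comul (X := 𝓛.bang.obj A) ≫ (𝓛.bang.δ.app A ⊗ₘ 𝓛.bang.δ.app A) :=
  (𝓛.free_hom (𝓛.bang.δ.app A) (𝓛.bang.coassoc A)).hom_comul

theorem delta_counit (A : C) :
    𝓛.bang.δ.app A ≫ ComonObj.counit (X := 𝓛.bang.obj (𝓛.bang.obj A)) =
      ComonObj.counit (X := 𝓛.bang.obj A) :=
  (𝓛.free_hom (𝓛.bang.δ.app A) (𝓛.bang.coassoc A)).hom_counit

/-- The structure map exhibits `X` as a retract of `!X`, and the comonoid structure of `!X`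
restricts along it. Naturality of `ε` and `d` with coassociativity turn the right side into `d`
followed by `δ` and then `ε` on each factor, which is `d`. -/
theorem coalgebra_comul (X : 𝓛.bang.Coalgebra) :
    X.a ≫ ComonObj.comul (X := 𝓛.bang.obj X.A) = dup X ≫ (X.a ⊗ₘ X.a) := by
  have h := 𝓛.bang.ε.naturality X.a
  simp only [Functor.id_map] at h
  rw [dup, Category.assoc, Category.assoc, tensorHom_comp_tensorHom, ← h,
    ← tensorHom_comp_tensorHom, ← reassoc_of% 𝓛.d_natural X.a, ← reassoc_of% X.coassoc,
    reassoc_of% delta_comul X.A, tensorHom_comp_tensorHom, 𝓛.bang.left_counit]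
  simp

/-- The cancellation principle for coalgebra structures. -/
theorem cancel_coalgebra {X : 𝓛.bang.Coalgebra} {A B : C} {f g : B ⟶ A ⊗ X.A}
    (h : f ≫ A ◁ X.a = g ≫ A ◁ X.a) : f = g := by
  have := congrArg (· ≫ A ◁ 𝓛.bang.ε.app X.A) h
  simpa only [Category.assoc, ← whiskerLeft_comp, X.counit, whiskerLeft_id,
    Category.comp_id] using this

theorem cancel_coalgebra_tensor {X Y : 𝓛.bang.Coalgebra} {B : C} {f g : B ⟶ X.A ⊗ Y.A}
    (h : f ≫ (X.a ⊗ₘ Y.a) = g ≫ (X.a ⊗ₘ Y.a)) : f = g := by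
  have := congrArg (· ≫ (𝓛.bang.ε.app X.A ⊗ₘ 𝓛.bang.ε.app Y.A)) h
  simpa only [Category.assoc, tensorHom_comp_tensorHom, X.counit, Y.counit, id_tensorHom_id,
    Category.comp_id] using this

/-- The comonoid laws of `dup` are inherited from `!X`: the structure map is a split monomorphism,
and after composing with it counitality and commutativity become those of `d` and `e`. The same
reason gives `dup_comm` and `dup_assoc`. -/
theorem dup_wk_left (X : 𝓛.bang.Coalgebra) : dup X ≫ wk X ▷ X.A = (λ_ X.A).inv := by
  apply cancel_coalgebra
  have := coalgebra_comul X =≫ (ComonObj.counit (X := 𝓛.bang.obj X.A) ▷ _)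
  rw [Category.assoc, ComonObj.counit_comul, Category.assoc, tensorHom_def', Category.assoc,
    ← comp_whiskerRight] at this
  rw [Category.assoc, ← whisker_exchange]
  exact this.symm.trans (leftUnitor_inv_naturality _)

theorem dup_comm (X : 𝓛.bang.Coalgebra) : dup X ≫ (β_ X.A X.A).hom = dup X := by
  apply cancel_coalgebra_tensor
  rw [Category.assoc, ← BraidedCategory.braiding_naturality, ← reassoc_of% coalgebra_comul,
    IsCommComonObj.comul_comm, coalgebra_comul]

theorem dup_wk_right (X : 𝓛.bang.Coalgebra) : dup X ≫ X.A ◁ wk X = (ρ_ X.A).inv := by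
  rw [← dup_comm, Category.assoc, ← BraidedCategory.braiding_naturality_left,
    reassoc_of% dup_wk_left]
  simp

theorem dup_assoc (X : 𝓛.bang.Coalgebra) :
    dup X ≫ dup X ▷ X.A ≫ (α_ X.A X.A X.A).hom = dup X ≫ X.A ◁ dup X := by
  have key : (dup X ≫ dup X ▷ X.A ≫ (α_ X.A X.A X.A).hom) ≫ (X.a ⊗ₘ X.a ⊗ₘ X.a) =
      (dup X ≫ X.A ◁ dup X) ≫ (X.a ⊗ₘ X.a ⊗ₘ X.a) := by
    have := ComonObj.comul_assoc (X := 𝓛.bang.obj X.A)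
    have := X.a ≫= this
    rw [reassoc_of% coalgebra_comul, reassoc_of% coalgebra_comul, ← tensorHom_id, ← id_tensorHom,
      tensorHom_comp_tensorHom_assoc, tensorHom_comp_tensorHom, coalgebra_comul] at this
    simp only [Category.assoc, ← associator_naturality]
    simp only [← tensorHom_id, ← id_tensorHom, tensorHom_comp_tensorHom,
      tensorHom_comp_tensorHom_assoc, Category.id_comp]
    simpa using this.symm
  have := congrArg (· ≫ (𝓛.bang.ε.app X.A ⊗ₘ 𝓛.bang.ε.app X.A ⊗ₘ 𝓛.bang.ε.app X.A)) key
  simpa only [Category.assoc, tensorHom_comp_tensorHom, X.counit, id_tensorHom_id,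
    Category.comp_id] using this

/-! ### Tensor products of coalgebras and their projections. -/

variable (𝓛) in
/-- The unit coalgebra. -/
abbrev unitCoalg : 𝓛.bang.Coalgebra where
  A := 𝟙_ C
  a := ε 𝓛.bang.toFunctor
  counit := NatTrans.IsMonoidal.unit (τ := 𝓛.bang.ε)
  coassoc := NatTrans.IsMonoidal.unit (τ := 𝓛.bang.δ)

theorem mu_counit (A B : C) :
    μ 𝓛.bang.toFunctor A B ≫ 𝓛.bang.ε.app (A ⊗ B) = 𝓛.bang.ε.app A ⊗ₘ 𝓛.bang.ε.app B :=
  (NatTrans.IsMonoidal.tensor (τ := 𝓛.bang.ε) A B).trans (Category.comp_id _)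

theorem mu_delta (A B : C) :
    μ 𝓛.bang.toFunctor A B ≫ 𝓛.bang.δ.app (A ⊗ B) =
      (𝓛.bang.δ.app A ⊗ₘ 𝓛.bang.δ.app B) ≫ μ 𝓛.bang.toFunctor (𝓛.bang.obj A) (𝓛.bang.obj B) ≫
        𝓛.bang.map (μ 𝓛.bang.toFunctor A B) :=
  NatTrans.IsMonoidal.tensor (τ := 𝓛.bang.δ) A B

/-- The tensor product of two coalgebras. -/
abbrev tensorCoalg (X Y : 𝓛.bang.Coalgebra) : 𝓛.bang.Coalgebra where
  A := X.A ⊗ Y.A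
  a := (X.a ⊗ₘ Y.a) ≫ μ 𝓛.bang.toFunctor X.A Y.A
  counit := by
    rw [Category.assoc, mu_counit, tensorHom_comp_tensorHom, X.counit, Y.counit, id_tensorHom_id]
  coassoc := by
    rw [Category.assoc, mu_delta, tensorHom_comp_tensorHom_assoc, X.coassoc, Y.coassoc,
      Category.assoc, Functor.map_comp, ← Functor.LaxMonoidal.μ_natural_assoc,
      tensorHom_comp_tensorHom_assoc]

/-- Discarding as a coalgebra morphism. -/
abbrev wkHom (X : 𝓛.bang.Coalgebra) : X ⟶ 𝓛.unitCoalg where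
  f := wk X
  h := by
    rw [wk, Functor.map_comp, ← reassoc_of% X.coassoc, 𝓛.e_coalgebra, Category.assoc]

/-- Duplication as a coalgebra morphism. -/
abbrev dupHom (X : 𝓛.bang.Coalgebra) : X ⟶ tensorCoalg X X where
  f := dup X
  h := by
    rw [← reassoc_of% coalgebra_comul, dup, Functor.map_comp, Functor.map_comp,
      ← reassoc_of% X.coassoc,
      reassoc_of% 𝓛.d_coalgebra X.A, ← Functor.LaxMonoidal.μ_natural,
      tensorHom_comp_tensorHom_assoc, 𝓛.bang.right_counit, id_tensorHom_id, Category.id_comp]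

/-- The first projection. -/
def fstHom (X Y : 𝓛.bang.Coalgebra) : tensorCoalg X Y ⟶ X where
  f := X.A ◁ wk Y ≫ (ρ_ X.A).hom
  h := by
    have := (wkHom Y).h
    have e : (X.a ⊗ₘ Y.a) ≫ 𝓛.bang.obj X.A ◁ 𝓛.bang.map (wk Y) =
        X.A ◁ wk Y ≫ X.a ▷ 𝟙_ C ≫ 𝓛.bang.obj X.A ◁ ε 𝓛.bang.toFunctor := by
      rw [MonoidalCategory.tensorHom_def, Category.assoc, ← whiskerLeft_comp, this,
        whiskerLeft_comp,
        whisker_exchange_assoc]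
    rw [Category.assoc, Functor.map_comp, ← Functor.LaxMonoidal.μ_natural_right_assoc,
      reassoc_of% e, ← Functor.LaxMonoidal.right_unitality, rightUnitor_naturality,
      Category.assoc]

/-- The second projection. -/
def sndHom (X Y : 𝓛.bang.Coalgebra) : tensorCoalg X Y ⟶ Y where
  f := wk X ▷ Y.A ≫ (λ_ Y.A).hom
  h := by
    have := (wkHom X).h
    have e : (X.a ⊗ₘ Y.a) ≫ 𝓛.bang.map (wk X) ▷ 𝓛.bang.obj Y.A =
        wk X ▷ Y.A ≫ 𝟙_ C ◁ Y.a ≫ ε 𝓛.bang.toFunctor ▷ 𝓛.bang.obj Y.A := by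
      rw [tensorHom_def', Category.assoc, ← comp_whiskerRight, this, comp_whiskerRight,
        whisker_exchange_assoc]
    rw [Category.assoc, Functor.map_comp, ← Functor.LaxMonoidal.μ_natural_left_assoc,
      reassoc_of% e, ← Functor.LaxMonoidal.left_unitality, leftUnitor_naturality,
      Category.assoc]

theorem dup_tensorCoalg (X Y : 𝓛.bang.Coalgebra) :
    dup (tensorCoalg X Y) = (dup X ⊗ₘ dup Y) ≫ tensorμ X.A X.A Y.A Y.A := by
  rw [dup, Category.assoc, reassoc_of% 𝓛.d_tensor X.A Y.A, tensorHom_comp_tensorHom, mu_counit,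
    ← tensorμ_natural, tensorHom_comp_tensorHom_assoc, tensorHom_comp_tensorHom_assoc]
  simp only [dup, Category.assoc]
  rfl

/-- The part of the cartesian structure on coalgebras that the proof needs: pairing the two
projections loses nothing, so the projections can serve as generic arguments. -/
theorem dup_fst_snd (X Y : 𝓛.bang.Coalgebra) :
    dup (tensorCoalg X Y) ≫ ((fstHom X Y).f ⊗ₘ (sndHom X Y).f) = 𝟙 _ := by
  simp only [fstHom, sndHom]
  rw [dup_tensorCoalg, ← tensorHom_comp_tensorHom, ← tensorHom_id, ← id_tensorHom,
    Category.assoc, ← tensorμ_natural_assoc, id_tensorHom, tensorHom_id,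
    tensorHom_comp_tensorHom_assoc, dup_wk_right, dup_wk_left]
  simp only [tensorμ, braiding_tensorUnit_left]
  monoidal

/-- The cofree coalgebra on an object. -/
abbrev cofree (𝓛 : LinearCategory C) (A : C) : 𝓛.bang.Coalgebra where
  A := 𝓛.bang.obj A
  a := 𝓛.bang.δ.app A
  counit := 𝓛.bang.left_counit A
  coassoc := (𝓛.bang.coassoc A).symm

theorem wk_cofree (A : C) : wk (𝓛.cofree A) = ComonObj.counit (X := 𝓛.bang.obj A) :=
  delta_counit A

theorem dup_cofree (A : C) : dup (𝓛.cofree A) = ComonObj.comul (X := 𝓛.bang.obj A) := by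
  rw [dup, ← Category.assoc, delta_comul A, Category.assoc, tensorHom_comp_tensorHom,
    𝓛.bang.left_counit, id_tensorHom_id, Category.comp_id]

/-- The coalgebra morphism into a cofree coalgebra induced by a morphism. -/
abbrev lift {X : 𝓛.bang.Coalgebra} {A : C} (f : X.A ⟶ A) : X ⟶ 𝓛.cofree A where
  f := X.a ≫ 𝓛.bang.map f
  h := by
    have := 𝓛.bang.δ.naturality f
    rw [Functor.map_comp, ← reassoc_of% X.coassoc, Category.assoc, this]
    rfl

theorem lift_counit {X : 𝓛.bang.Coalgebra} {A : C} (f : X.A ⟶ A) :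
    (lift f).f ≫ 𝓛.bang.ε.app A = f := by
  have := 𝓛.bang.ε.naturality f
  rw [Category.assoc, this, reassoc_of% X.counit]
  rfl

end LinearCategory

namespace ExpNumerals

open LinearCategory

variable {C : Type u} [Category.{v} C] [MonoidalCategory C] [SymmetricCategory C]
  {𝓛 : LinearCategory C} (E : ExpNumerals 𝓛)

/-- The coalgebra of numerals. -/
abbrev coalg : 𝓛.bang.Coalgebra where
  A := E.N
  a := E.p
  counit := E.p_counit
  coassoc := E.p_coassoc

theorem wk_coalg : wk E.coalg = ComonObj.counit (X := E.N) :=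
  E.p_comon.hom_counit

/-- The given comonoid structure of `N` is the one induced by `p`, because `p` is a comonoid
morphism. Contraction and weakening of ground variables therefore follow the same pattern as for
stable ones. -/
theorem dup_coalg : dup E.coalg = ComonObj.comul (X := E.N) := by
  have := E.p_comon.hom_comul
  rw [dup, reassoc_of% this, tensorHom_comp_tensorHom, E.p_counit,
    id_tensorHom_id, Category.comp_id]

/-- A numeral as a coalgebra morphism. -/
def numeralHom : ℕ → (𝓛.unitCoalg ⟶ E.coalg)
  | 0 => { f := E.zero, h := E.zero_coalgebra }
  | n + 1 => numeralHom n ≫ { f := E.succ, h := E.succ_coalgebra }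

theorem numeralHom_f (n : ℕ) : (E.numeralHom n).f = numeral E.zero E.succ n := by
  induction n with
  | zero => rfl
  | succ n ih =>
    rw [numeralHom, numeral, ← ih]
    rfl

end ExpNumerals

end
end Sll

namespace Sll

noncomputable section

/-! ### Morphisms depending on a coalgebra and a basis -/

section Tensor

variable {C : Type u} [Category.{v} C] [MonoidalCategory C] [SymmetricCategory C]

theorem tensorμ_braiding (X₁ X₂ Y₁ Y₂ : C) :
    tensorμ X₁ X₂ Y₁ Y₂ ≫ (β_ (X₁ ⊗ Y₁) (X₂ ⊗ Y₂)).hom =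
      ((β_ X₁ X₂).hom ⊗ₘ (β_ Y₁ Y₂).hom) ≫ tensorμ X₂ X₁ Y₂ Y₁ := by
  simp [tensorμ, SymmetricCategory.braiding_swap_eq_inv_braiding Y₁ X₂,
    MonoidalCategory.tensorHom_def]

theorem tensorμ_associator (X₁ X₂ X₃ Y₁ Y₂ Y₃ : C) :
    tensorμ (X₁ ⊗ X₂) X₃ (Y₁ ⊗ Y₂) Y₃ ≫ tensorμ X₁ X₂ Y₁ Y₂ ▷ (X₃ ⊗ Y₃) ≫ (α_ _ _ _).hom =
      ((α_ X₁ X₂ X₃).hom ⊗ₘ (α_ Y₁ Y₂ Y₃).hom) ≫ tensorμ X₁ (X₂ ⊗ X₃) Y₁ (Y₂ ⊗ Y₃) ≫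
        (X₁ ⊗ Y₁) ◁ tensorμ X₂ X₃ Y₂ Y₃ := by
  simp only [tensorμ, BraidedCategory.braiding_tensor_left_hom,
    BraidedCategory.braiding_tensor_right_hom]
  calc
    _ = 𝟙 _ ⊗≫ X₁ ◁ X₂ ◁ (β_ X₃ Y₁).hom ▷ Y₂ ▷ Y₃ ⊗≫
      X₁ ◁ ((X₂ ⊗ Y₁) ◁ (β_ X₃ Y₂).hom ≫ (β_ X₂ Y₁).hom ▷ (Y₂ ⊗ X₃)) ▷ Y₃ ⊗≫ 𝟙 _ := by monoidal
    _ = _ := by rw [whisker_exchange]; monoidal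

theorem tensorμ_unit_left (X Y Z : C) :
    tensorμ X Y (𝟙_ C) Z = (X ⊗ Y) ◁ (λ_ Z).hom ≫ (α_ X Y Z).hom ≫
      (ρ_ X).inv ▷ (Y ⊗ Z) := by
  simp only [tensorμ, braiding_tensorUnit_right]
  monoidal

end Tensor

namespace SllCategory

open LinearCategory

variable {C : Type u} [Category.{v} C] [MonoidalCategory C] [SymmetricCategory C]
  [MonoidalClosed C] [HasFiniteProducts C] {𝓢 : SllCategory C}

variable (𝓢) in
/-- Two morphisms depending on bases differ by a structural isomorphism. -/
def PermEq {A B : C} (Γ : Basis) (f : A ⊗ 𝓢.basis Γ ⟶ B) (Δ : Basis)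
    (g : A ⊗ 𝓢.basis Δ ⟶ B) : Prop :=
  ∃ p, 𝓢.PermMor Γ Δ p ∧ f = A ◁ p ≫ g

namespace PermEq

variable {A B : C} {Γ Δ Θ : Basis} {f : A ⊗ 𝓢.basis Γ ⟶ B} {g : A ⊗ 𝓢.basis Δ ⟶ B}
  {k : A ⊗ 𝓢.basis Θ ⟶ B}

theorem refl (f : A ⊗ 𝓢.basis Γ ⟶ B) : 𝓢.PermEq Γ f Γ f :=
  ⟨_, .refl Γ, by simp⟩

theorem of_eq {f f' : A ⊗ 𝓢.basis Γ ⟶ B} (h : f = f') : 𝓢.PermEq Γ f Γ f' :=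
  h ▸ refl f

theorem symm (h : 𝓢.PermEq Γ f Δ g) : 𝓢.PermEq Δ g Γ f := by
  obtain ⟨p, hp, rfl⟩ := h
  obtain ⟨q, hq, -, e⟩ := hp.exists_inv
  exact ⟨q, hq, by simp [← whiskerLeft_comp_assoc, e]⟩

theorem trans (h : 𝓢.PermEq Γ f Δ g) (h' : 𝓢.PermEq Δ g Θ k) : 𝓢.PermEq Γ f Θ k := by
  obtain ⟨p, hp, rfl⟩ := h
  obtain ⟨q, hq, rfl⟩ := h'
  exact ⟨_, hp.trans hq, by simp⟩

theorem perm (h : 𝓢.PermEq Γ f Δ g) : Γ.Perm Δ := by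
  obtain ⟨p, hp, -⟩ := h
  exact hp.perm

theorem comp (h : 𝓢.PermEq Γ f Δ g) {D : C} (l : B ⟶ D) : 𝓢.PermEq Γ (f ≫ l) Δ (g ≫ l) := by
  obtain ⟨p, hp, rfl⟩ := h
  exact ⟨p, hp, by simp⟩

theorem pull (h : 𝓢.PermEq Γ f Δ g) {D : C} (l : D ⟶ A) :
    𝓢.PermEq Γ (l ▷ _ ≫ f) Δ (l ▷ _ ≫ g) := by
  obtain ⟨p, hp, rfl⟩ := h
  exact ⟨p, hp, by simp [whisker_exchange_assoc]⟩

/-- Coherence pays off here: over one fixed basis, equality up to permutation is equality. -/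
theorem eq {g : A ⊗ 𝓢.basis Γ ⟶ B} (h : 𝓢.PermEq Γ f Γ g) : f = g := by
  obtain ⟨p, hp, rfl⟩ := h
  simp [hp.eq_id]

end PermEq

/-- Distribute a coalgebra, which is duplicated, and a basis, which is split. -/
def split (X : 𝓢.bang.Coalgebra) (Γ Δ : Basis) :
    X.A ⊗ 𝓢.basis (Γ ++ Δ) ⟶ (X.A ⊗ 𝓢.basis Γ) ⊗ (X.A ⊗ 𝓢.basis Δ) :=
  (dup X ⊗ₘ (𝓢.appendIso Γ Δ).hom) ≫ tensorμ X.A X.A (𝓢.basis Γ) (𝓢.basis Δ)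

/-- The tensor product of two morphisms which use a coalgebra and disjoint bases. -/
def both (X : 𝓢.bang.Coalgebra) {A B : C} (Γ Δ : Basis) (f : X.A ⊗ 𝓢.basis Γ ⟶ A)
    (g : X.A ⊗ 𝓢.basis Δ ⟶ B) : X.A ⊗ 𝓢.basis (Γ ++ Δ) ⟶ A ⊗ B :=
  split X Γ Δ ≫ (f ⊗ₘ g)

section Both

variable {X Y : 𝓢.bang.Coalgebra} {A B D : C} {Γ Γ' Δ Δ' Θ : Basis}

theorem both_comp (f : X.A ⊗ 𝓢.basis Γ ⟶ A) (g : X.A ⊗ 𝓢.basis Δ ⟶ B) {A' B' : C} (k : A ⟶ A')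
    (l : B ⟶ B') : both X Γ Δ (f ≫ k) (g ≫ l) = both X Γ Δ f g ≫ (k ⊗ₘ l) := by
  simp [both]

theorem both_comp_left (f : X.A ⊗ 𝓢.basis Γ ⟶ A) (g : X.A ⊗ 𝓢.basis Δ ⟶ B) {A' : C}
    (k : A ⟶ A') : both X Γ Δ (f ≫ k) g = both X Γ Δ f g ≫ k ▷ B := by
  simpa using both_comp f g k (𝟙 B)

theorem both_comp_right (f : X.A ⊗ 𝓢.basis Γ ⟶ A) (g : X.A ⊗ 𝓢.basis Δ ⟶ B) {B' : C}
    (k : B ⟶ B') : both X Γ Δ f (g ≫ k) = both X Γ Δ f g ≫ A ◁ k := by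
  simpa using both_comp f g (𝟙 A) k

theorem whiskerRight_split (h : Y ⟶ X) :
    h.f ▷ _ ≫ split X Γ Δ = split Y Γ Δ ≫ (h.f ▷ _ ⊗ₘ h.f ▷ _) := by
  rw [split, split, Category.assoc, ← tensorμ_natural_left, whiskerRight_comp_tensorHom_assoc,
    tensorHom_comp_whiskerRight_assoc, hom_dup]

theorem pull_both (h : Y ⟶ X) (f : X.A ⊗ 𝓢.basis Γ ⟶ A) (g : X.A ⊗ 𝓢.basis Δ ⟶ B) :
    h.f ▷ _ ≫ both X Γ Δ f g = both Y Γ Δ (h.f ▷ _ ≫ f) (h.f ▷ _ ≫ g) := by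
  rw [both, reassoc_of% whiskerRight_split, tensorHom_comp_tensorHom, both]

theorem both_permMor {p : 𝓢.basis Γ ⟶ 𝓢.basis Γ'} {q : 𝓢.basis Δ ⟶ 𝓢.basis Δ'}
    {r : 𝓢.basis (Γ ++ Δ) ⟶ 𝓢.basis (Γ' ++ Δ')}
    (e : r ≫ (𝓢.appendIso Γ' Δ').hom = (𝓢.appendIso Γ Δ).hom ≫ (p ⊗ₘ q))
    (f : X.A ⊗ 𝓢.basis Γ' ⟶ A) (g : X.A ⊗ 𝓢.basis Δ' ⟶ B) :
    both X Γ Δ (X.A ◁ p ≫ f) (X.A ◁ q ≫ g) = X.A ◁ r ≫ both X Γ' Δ' f g := by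
  rw [both, both, ← tensorHom_comp_tensorHom, split, split, Category.assoc,
    ← tensorμ_natural_right_assoc, Category.assoc, whiskerLeft_comp_tensorHom_assoc, e,
    tensorHom_comp_whiskerLeft_assoc]

theorem both_permEq {f : X.A ⊗ 𝓢.basis Γ ⟶ A} {f' : X.A ⊗ 𝓢.basis Γ' ⟶ A}
    {g : X.A ⊗ 𝓢.basis Δ ⟶ B} {g' : X.A ⊗ 𝓢.basis Δ' ⟶ B} (hf : 𝓢.PermEq Γ f Γ' f')
    (hg : 𝓢.PermEq Δ g Δ' g') :
    𝓢.PermEq (Γ ++ Δ) (both X Γ Δ f g) (Γ' ++ Δ') (both X Γ' Δ' f' g') := by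
  obtain ⟨p, hp, rfl⟩ := hf
  obtain ⟨q, hq, rfl⟩ := hg
  obtain ⟨r, hr, e⟩ := hp.append hq
  exact ⟨r, hr, both_permMor e f' g'⟩

/-- Coassociativity of `dup` handles the shared coalgebra and `PermMor.append_assoc` the linear
bases; `tensorμ_associator` interleaves the two. -/
theorem both_assoc (f : X.A ⊗ 𝓢.basis Γ ⟶ A) (g : X.A ⊗ 𝓢.basis Δ ⟶ B)
    (k : X.A ⊗ 𝓢.basis Θ ⟶ D) :
    𝓢.PermEq ((Γ ++ Δ) ++ Θ) (both X (Γ ++ Δ) Θ (both X Γ Δ f g) k ≫ (α_ A B D).hom)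
      (Γ ++ (Δ ++ Θ)) (both X Γ (Δ ++ Θ) f (both X Δ Θ g k)) := by
  obtain ⟨r, hr, e⟩ := PermMor.append_assoc (𝓢 := 𝓢) Γ Δ Θ
  refine ⟨r, hr, ?_⟩
  have h₁ : split X (Γ ++ Δ) Θ ≫ split X Γ Δ ▷ (X.A ⊗ 𝓢.basis Θ) ≫ (α_ _ _ _).hom =
      X.A ◁ r ≫ split X Γ (Δ ++ Θ) ≫ (X.A ⊗ 𝓢.basis Γ) ◁ split X Δ Θ := by
    have n₁ : (dup X ▷ X.A ⊗ₘ (𝓢.appendIso Γ Δ).hom ▷ 𝓢.basis Θ) ≫ tensorμ _ _ _ _ =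
        tensorμ _ _ _ _ ≫ (dup X ⊗ₘ (𝓢.appendIso Γ Δ).hom) ▷ (X.A ⊗ 𝓢.basis Θ) := by
      simpa using tensorμ_natural (dup X) (𝟙 X.A) (𝓢.appendIso Γ Δ).hom (𝟙 (𝓢.basis Θ))
    have n₂ : (X.A ◁ dup X ⊗ₘ 𝓢.basis Γ ◁ (𝓢.appendIso Δ Θ).hom) ≫ tensorμ _ _ _ _ =
        tensorμ _ _ _ _ ≫ (X.A ⊗ 𝓢.basis Γ) ◁ (dup X ⊗ₘ (𝓢.appendIso Δ Θ).hom) := by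
      simpa using tensorμ_natural (𝟙 X.A) (dup X) (𝟙 (𝓢.basis Γ)) (𝓢.appendIso Δ Θ).hom
    simp only [split, comp_whiskerRight, whiskerLeft_comp, Category.assoc]
    rw [← reassoc_of% n₁, ← reassoc_of% n₂, tensorμ_associator, tensorHom_comp_tensorHom_assoc,
      tensorHom_comp_tensorHom_assoc, tensorHom_comp_tensorHom_assoc,
      whiskerLeft_comp_tensorHom_assoc, Category.assoc, Category.assoc, dup_assoc, ← e]
  have h₂ := h₁ =≫ (f ⊗ₘ g ⊗ₘ k)
  simp only [Category.assoc, ← associator_naturality, whiskerLeft_comp_tensorHom,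
    whiskerRight_comp_tensorHom_assoc] at h₂
  simpa only [both, Category.assoc] using h₂

/-- Commutativity of `dup` absorbs the symmetry on the coalgebra side. Disjointness is needed to
exchange the bases without crossing equal variables. -/
theorem both_comm (h : Γ.Disjoint Δ) (f : X.A ⊗ 𝓢.basis Γ ⟶ A) (g : X.A ⊗ 𝓢.basis Δ ⟶ B) :
    𝓢.PermEq (Γ ++ Δ) (both X Γ Δ f g ≫ (β_ A B).hom) (Δ ++ Γ) (both X Δ Γ g f) := by
  obtain ⟨r, hr, e⟩ := PermMor.comm (𝓢 := 𝓢) h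
  refine ⟨r, hr, ?_⟩
  simp only [both, split, Category.assoc]
  rw [BraidedCategory.braiding_naturality, reassoc_of% tensorμ_braiding,
    tensorHom_comp_tensorHom_assoc, dup_comm, ← e, ← id_tensorHom X.A,
    tensorHom_comp_tensorHom_assoc, Category.id_comp]

/-- A morphism which uses the coalgebra but no basis. -/
def closed {X : 𝓢.bang.Coalgebra} (k : X.A ⟶ A) : X.A ⊗ 𝓢.basis [] ⟶ A :=
  (ρ_ X.A).hom ≫ k

theorem closed_comp (k : X.A ⟶ A) (l : A ⟶ B) : closed (𝓢 := 𝓢) k ≫ l = closed (k ≫ l) := by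
  simp [closed]

theorem pull_closed (h : Y ⟶ X) (k : X.A ⟶ A) :
    h.f ▷ _ ≫ closed (𝓢 := 𝓢) k = closed (h.f ≫ k) := by
  simp [closed]

theorem both_closed_left (k : X.A ⟶ A) (g : X.A ⊗ 𝓢.basis Δ ⟶ B) :
    both X [] Δ (closed k) g = dup X ▷ _ ≫ (α_ _ _ _).hom ≫ (k ⊗ₘ g) := by
  change ((dup X ⊗ₘ (λ_ (𝓢.basis Δ)).inv) ≫ tensorμ X.A X.A (𝟙_ C) (𝓢.basis Δ)) ≫
    ((ρ_ X.A).hom ≫ k ⊗ₘ g) = _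
  rw [tensorμ_unit_left, MonoidalCategory.tensorHom_def]
  simp only [Category.assoc, ← whiskerLeft_comp_assoc, Iso.inv_hom_id, whiskerLeft_id,
    Category.id_comp]
  rw [whiskerRight_comp_tensorHom, Iso.inv_hom_id_assoc]

theorem both_closed (k : X.A ⟶ A) (l : X.A ⟶ B) :
    both X [] [] (closed (𝓢 := 𝓢) k) (closed l) = closed (dup X ≫ (k ⊗ₘ l)) := by
  change _ = (ρ_ X.A).hom ≫ dup X ≫ (k ⊗ₘ l)
  rw [both_closed_left, ← rightUnitor_naturality_assoc]
  change dup X ▷ 𝟙_ C ≫ (α_ X.A X.A (𝟙_ C)).hom ≫ (k ⊗ₘ (ρ_ X.A).hom ≫ l) = _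
  rw [← whiskerLeft_comp_tensorHom, ← rightUnitor_tensor_hom_assoc]

theorem both_unit_left (g : X.A ⊗ 𝓢.basis Δ ⟶ B) :
    both X [] Δ (closed (wk X)) g ≫ (λ_ B).hom = g := by
  rw [both_closed_left, MonoidalCategory.tensorHom_def, Category.assoc, Category.assoc,
    Category.assoc,
    leftUnitor_naturality, ← associator_naturality_left_assoc, ← comp_whiskerRight_assoc,
    dup_wk_left]
  simp

theorem both_closed_right (f : X.A ⊗ 𝓢.basis Γ ⟶ A) (k : X.A ⟶ B) :
    𝓢.PermEq (Γ ++ []) (both X Γ [] f (closed k)) Γ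
      (dup X ▷ _ ≫ (α_ _ _ _).hom ≫ (k ⊗ₘ f) ≫ (β_ B A).hom) := by
  have := (both_comm (X := X) (List.disjoint_nil_right Γ) f (closed k)).comp (β_ B A).hom
  simp only [Category.assoc, SymmetricCategory.symmetry, Category.comp_id,
    both_closed_left] at this
  exact this

/-- Only up to permutation, unlike `both_unit_left`: `[] ++ Γ` is `Γ` by definition, while `Γ ++ []`
is not. -/
theorem both_unit_right (f : X.A ⊗ 𝓢.basis Γ ⟶ A) :
    𝓢.PermEq (Γ ++ []) (both X Γ [] f (closed (wk X)) ≫ (ρ_ A).hom) Γ f := by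
  have := (both_comm (X := X) (List.disjoint_nil_right Γ) f (closed (wk X))).comp (λ_ A).hom
  rw [both_unit_left, Category.assoc, braiding_leftUnitor] at this
  exact this

end Both

end SllCategory

end
end Sll

namespace Sll

noncomputable section

/-! ### Semantics of untyped terms as predicates on values -/

section Closed

variable {C : Type u} [Category.{v} C] [MonoidalCategory C] [SymmetricCategory C]
  [MonoidalClosed C]

theorem curr_whiskerRight_eval {X A B : C} (f : X ⊗ A ⟶ B) : curr f ▷ A ≫ eval A B = f := by
  rw [eval, BraidedCategory.braiding_naturality_left_assoc, curr, ← MonoidalClosed.uncurry_eq,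
    MonoidalClosed.uncurry_curry, SymmetricCategory.symmetry_assoc]

theorem eq_curr {X A B : C} (f : X ⟶ hom A B) : f = curr (f ▷ A ≫ eval A B) := by
  rw [eval, BraidedCategory.braiding_naturality_left_assoc, curr,
    SymmetricCategory.symmetry_assoc, ← MonoidalClosed.uncurry_eq, MonoidalClosed.curry_uncurry]

theorem eval_cancel {X A B : C} {f g : X ⟶ hom A B}
    (h : f ▷ A ≫ eval A B = g ▷ A ≫ eval A B) : f = g := by
  rw [eq_curr f, h, ← eq_curr]

end Closed

namespace SllCategory

open LinearCategory

variable {C : Type u} [Category.{v} C] [MonoidalCategory C] [SymmetricCategory C]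
  [MonoidalClosed C] [HasFiniteProducts C] {𝓢 : SllCategory C}

/-- A value of some type which uses the coalgebra `X` and the linear variables of a basis. -/
structure Val (X : 𝓢.bang.Coalgebra) where
  /-- the type -/
  ty : Ty
  /-- the linear variables -/
  ctx : Basis
  /-- the morphism -/
  map : X.A ⊗ 𝓢.basis ctx ⟶ 𝓢.ty ty

variable {X Y Z : 𝓢.bang.Coalgebra}

/-- Equality of values up to a permutation of the linear variables. -/
def Val.Equiv (u w : Val X) : Prop :=
  ∃ e : w.ty = u.ty, 𝓢.PermEq u.ctx u.map w.ctx (w.map ≫ eqToHom (by rw [e]))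

/-- Restriction of a value along a coalgebra morphism. -/
def Val.pull (h : Y ⟶ X) (w : Val X) : Val Y :=
  ⟨w.ty, w.ctx, h.f ▷ _ ≫ w.map⟩

namespace Val.Equiv

theorem of_permEq {σ : Ty} {Γ Δ : Basis} {f : X.A ⊗ 𝓢.basis Γ ⟶ 𝓢.ty σ}
    {g : X.A ⊗ 𝓢.basis Δ ⟶ 𝓢.ty σ} (h : 𝓢.PermEq Γ f Δ g) :
    Val.Equiv ⟨σ, Γ, f⟩ ⟨σ, Δ, g⟩ :=
  ⟨rfl, by simpa using h⟩

theorem permEq {σ : Ty} {Γ Δ : Basis} {f : X.A ⊗ 𝓢.basis Γ ⟶ 𝓢.ty σ}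
    {g : X.A ⊗ 𝓢.basis Δ ⟶ 𝓢.ty σ} (h : Val.Equiv ⟨σ, Γ, f⟩ ⟨σ, Δ, g⟩) :
    𝓢.PermEq Γ f Δ g := by
  obtain ⟨_, h⟩ := h
  simpa using h

theorem refl (u : Val X) : u.Equiv u :=
  of_permEq (.refl _)

theorem symm {u w : Val X} (h : u.Equiv w) : w.Equiv u := by
  obtain ⟨σ, Γ, f⟩ := u
  obtain ⟨τ, Δ, g⟩ := w
  obtain ⟨e, -⟩ := id h
  obtain rfl : τ = σ := e
  exact of_permEq h.permEq.symm

theorem trans {u w z : Val X} (h : u.Equiv w) (h' : w.Equiv z) : u.Equiv z := by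
  obtain ⟨σ, Γ, f⟩ := u
  obtain ⟨τ, Δ, g⟩ := w
  obtain ⟨υ, Θ, k⟩ := z
  obtain ⟨e, -⟩ := id h
  obtain rfl : τ = σ := e
  obtain ⟨e, -⟩ := id h'
  obtain rfl : υ = τ := e
  exact of_permEq (h.permEq.trans h'.permEq)

theorem pull {u w : Val X} (h : u.Equiv w) (k : Y ⟶ X) : (u.pull k).Equiv (w.pull k) := by
  obtain ⟨σ, Γ, f⟩ := u
  obtain ⟨τ, Δ, g⟩ := w
  obtain ⟨e, -⟩ := id h
  obtain rfl : τ = σ := e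
  exact of_permEq (h.permEq.pull k.f)

theorem perm {u w : Val X} (h : u.Equiv w) : u.ctx.Perm w.ctx :=
  h.2.perm

theorem nodup {u w : Val X} (h : u.Equiv w) (hu : u.ctx.Nodup) : w.ctx.Nodup :=
  h.perm.nodup_iff.1 hu

end Val.Equiv

theorem Val.pull_pull (h : Y ⟶ X) (k : Z ⟶ Y) (w : Val X) :
    (w.pull h).pull k = w.pull (k ≫ h) := by
  simp [Val.pull]

theorem Val.pull_id (w : Val X) : w.pull (𝟙 X) = w := by
  simp [Val.pull]

/-- Predicates on values which are invariant under permutations of the linear variables. -/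
@[ext]
structure Pred (X : 𝓢.bang.Coalgebra) where
  /-- the predicate -/
  rel : Val X → Prop
  closed {u w : Val X} : u.Equiv w → rel w → rel u

/-! ### Predicates on values and the operations interpreting the term constructors. -/

namespace Pred

instance : LE (Pred X) := ⟨fun P Q => ∀ u, P.rel u → Q.rel u⟩

theorem le_refl (P : Pred X) : P ≤ P := fun _ h => h

theorem le_trans {P Q R : Pred X} (h : P ≤ Q) (h' : Q ≤ R) : P ≤ R := fun u hu => h' u (h u hu)

/-- The predicate of being equivalent to a given value. -/
def single (w : Val X) : Pred X where
  rel u := u.Equiv w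
  closed h h' := h.trans h'

theorem single_le {w : Val X} {P : Pred X} (h : P.rel w) : single w ≤ P :=
  fun _ hu => P.closed hu h

/-- Restriction of a predicate along a coalgebra morphism. -/
def pull (h : Y ⟶ X) (P : Pred X) : Pred Y where
  rel u := ∃ w, P.rel w ∧ u.Equiv (w.pull h)
  closed := fun e ⟨w, hw, e'⟩ => ⟨w, hw, e.trans e'⟩

theorem pull_pull (h : Y ⟶ X) (k : Z ⟶ Y) (P : Pred X) :
    (P.pull h).pull k = P.pull (k ≫ h) := by
  ext u
  constructor
  · rintro ⟨w, ⟨z, hz, e⟩, e'⟩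
    exact ⟨z, hz, Val.pull_pull h k z ▸ e'.trans (e.pull k)⟩
  · rintro ⟨z, hz, e⟩
    exact ⟨z.pull h, ⟨z, hz, .refl _⟩, (Val.pull_pull h k z).symm ▸ e⟩

theorem pull_id (P : Pred X) : P.pull (𝟙 X) = P := by
  ext u
  constructor
  · rintro ⟨w, hw, e⟩
    exact P.closed (w.pull_id ▸ e) hw
  · exact fun hu => ⟨u, hu, u.pull_id.symm ▸ .refl u⟩

theorem pull_mono (h : Y ⟶ X) {P Q : Pred X} (hPQ : P ≤ Q) : P.pull h ≤ Q.pull h :=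
  fun _ ⟨w, hw, e⟩ => ⟨w, hPQ w hw, e⟩

theorem rel_pull (h : Y ⟶ X) {P : Pred X} {w : Val X} (hw : P.rel w) :
    (P.pull h).rel (w.pull h) :=
  ⟨w, hw, .refl _⟩

/-- Application. -/
def app (P Q : Pred X) : Pred X where
  rel u := ∃ σ τ Γ Δ f g, P.rel ⟨.lolli σ τ, Γ, f⟩ ∧ Q.rel ⟨σ, Δ, g⟩ ∧
    u.Equiv ⟨τ, Γ ++ Δ, both X Γ Δ f g ≫ eval (𝓢.ty σ) (𝓢.ty τ)⟩
  closed := fun e ⟨σ, τ, Γ, Δ, f, g, hf, hg, e'⟩ =>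
    ⟨σ, τ, Γ, Δ, f, g, hf, hg, e.trans e'⟩

/-- Conditional. -/
def lif (P Q R : Pred X) : Pred X where
  rel u := ∃ Γ Δ f g k, P.rel ⟨.nat, Γ, f⟩ ∧ Q.rel ⟨.nat, Δ, g⟩ ∧ R.rel ⟨.nat, Δ, k⟩ ∧
    u.Equiv ⟨.nat, Γ ++ Δ, both X Γ Δ f (prod.lift g k) ≫ 𝓢.cond⟩
  closed := fun e ⟨Γ, Δ, f, g, k, hf, hg, hk, e'⟩ =>
    ⟨Γ, Δ, f, g, k, hf, hg, hk, e.trans e'⟩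

/-- The values which may replace an ordinary variable: ground ones are coalgebra morphisms. -/
def _root_.Sll.SllCategory.IsArg (X : 𝓢.bang.Coalgebra) :
    (σ : Ty) → (Δ : Basis) → (X.A ⊗ 𝓢.basis Δ ⟶ 𝓢.ty σ) → Prop
  | .nat, Δ, g => ∃ k : X ⟶ 𝓢.num.coalg, 𝓢.PermEq Δ g [] (SllCategory.closed k.f)
  | .lolli _ _, _, _ => True

/-- Abstraction. -/
def lam (σ : Ty) (P : ∀ Y : 𝓢.bang.Coalgebra, (Y ⟶ X) → Val Y → Pred Y) : Pred X where
  rel u := ∃ τ Γ f, (∀ (Y) (h : Y ⟶ X) (Δ g), IsArg Y σ Δ g → (Γ ++ Δ).Nodup →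
      (P Y h ⟨σ, Δ, g⟩).rel
        ⟨τ, Γ ++ Δ, both Y Γ Δ (h.f ▷ _ ≫ f) g ≫ eval (𝓢.ty σ) (𝓢.ty τ)⟩) ∧
    u.Equiv ⟨.lolli σ τ, Γ, f⟩
  closed := fun e ⟨τ, Γ, f, H, e'⟩ => ⟨τ, Γ, f, H, e.trans e'⟩

/-- Fixed point. -/
def mu (σ : Ty) (P : ∀ Y : 𝓢.bang.Coalgebra, (Y ⟶ X) → Val Y → Pred Y) : Pred X where
  rel u := ∃ g : X.A ⟶ hom (𝓢.bang.obj (𝓢.ty σ)) (𝓢.ty σ),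
    (∀ (Y) (h : Y ⟶ X) (w : Y ⟶ 𝓢.cofree (𝓢.ty σ)),
      (P Y h ⟨σ, [], SllCategory.closed (w.f ≫ 𝓢.bang.ε.app (𝓢.ty σ))⟩).rel
        ⟨σ, [], SllCategory.closed (dup Y ≫ (h.f ≫ g ⊗ₘ w.f) ≫ eval _ _)⟩) ∧
    u.Equiv ⟨σ, [], SllCategory.closed (X.a ≫ 𝓢.bang.map g ≫ 𝓢.fix (𝓢.ty σ))⟩
  closed := fun e ⟨g, H, e'⟩ => ⟨g, H, e.trans e'⟩

/-- Zero. -/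
def zero (X : 𝓢.bang.Coalgebra) : Pred X :=
  single ⟨.nat, [], SllCategory.closed (wk X ≫ 𝓢.num.zero)⟩

/-- A morphism `N ⟶ N` as a constant. -/
def const (X : 𝓢.bang.Coalgebra) (k : 𝓢.num.N ⟶ 𝓢.num.N) : Pred X :=
  single ⟨.lolli .nat .nat, [], SllCategory.closed (wk X ≫ curr ((λ_ 𝓢.num.N).hom ≫ k))⟩

theorem app_mono {P P' Q Q' : Pred X} (hP : P ≤ P') (hQ : Q ≤ Q') : app P Q ≤ app P' Q' :=
  fun _ ⟨σ, τ, Γ, Δ, f, g, hf, hg, e⟩ => ⟨σ, τ, Γ, Δ, f, g, hP _ hf, hQ _ hg, e⟩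

theorem lif_mono {P P' Q Q' R R' : Pred X} (hP : P ≤ P') (hQ : Q ≤ Q') (hR : R ≤ R') :
    lif P Q R ≤ lif P' Q' R' :=
  fun _ ⟨Γ, Δ, f, g, k, hf, hg, hk, e⟩ => ⟨Γ, Δ, f, g, k, hP _ hf, hQ _ hg, hR _ hk, e⟩

theorem lam_mono {σ : Ty} {P Q : ∀ Y : 𝓢.bang.Coalgebra, (Y ⟶ X) → Val Y → Pred Y}
    (h : ∀ Y h w, P Y h w ≤ Q Y h w) : lam σ P ≤ lam σ Q :=
  fun _ ⟨τ, Γ, f, H, e⟩ => ⟨τ, Γ, f, fun Y k Δ g ha hn => h Y k _ _ (H Y k Δ g ha hn), e⟩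

theorem mu_mono {σ : Ty} {P Q : ∀ Y : 𝓢.bang.Coalgebra, (Y ⟶ X) → Val Y → Pred Y}
    (h : ∀ Y h w, P Y h w ≤ Q Y h w) : mu σ P ≤ mu σ Q :=
  fun _ ⟨g, H, e⟩ => ⟨g, fun Y k w => h Y k _ _ (H Y k w), e⟩

theorem single_pull_le (h : Y ⟶ X) (w : Val X) : (single w).pull h ≤ single (w.pull h) :=
  fun _ ⟨_, hz, e⟩ => e.trans (hz.pull h)

theorem zero_pull_le (h : Y ⟶ X) : (zero X).pull h ≤ zero Y := by
  refine le_trans (single_pull_le h _) ?_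
  rw [Val.pull, pull_closed, reassoc_of% hom_wk]
  exact le_refl _

theorem const_pull_le (h : Y ⟶ X) (k : 𝓢.num.N ⟶ 𝓢.num.N) :
    (const X k).pull h ≤ const Y k := by
  refine le_trans (single_pull_le h _) ?_
  rw [Val.pull, pull_closed, reassoc_of% hom_wk]
  exact le_refl _

theorem app_pull_le (h : Y ⟶ X) (P Q : Pred X) : (app P Q).pull h ≤ app (P.pull h) (Q.pull h) := by
  rintro u ⟨w, ⟨σ, τ, Γ, Δ, f, g, hf, hg, e⟩, e'⟩
  refine ⟨σ, τ, Γ, Δ, _, _, rel_pull h hf, rel_pull h hg, ?_⟩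
  have := e'.trans (e.pull h)
  rw [Val.pull, ← Category.assoc, pull_both] at this
  exact this

theorem lif_pull_le (h : Y ⟶ X) (P Q R : Pred X) :
    (lif P Q R).pull h ≤ lif (P.pull h) (Q.pull h) (R.pull h) := by
  rintro u ⟨w, ⟨Γ, Δ, f, g, k, hf, hg, hk, e⟩, e'⟩
  refine ⟨Γ, Δ, _, _, _, rel_pull h hf, rel_pull h hg, rel_pull h hk, ?_⟩
  have := e'.trans (e.pull h)
  rw [Val.pull, ← Category.assoc, pull_both, prod.comp_lift] at this
  exact this

/-- The Kripke quantification makes this a mere reindexing: a test over `Z ⟶ Y` is a test over the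
composite `Z ⟶ X`. -/
theorem lam_pull_le (h : Y ⟶ X) {σ : Ty}
    (P : ∀ Y : 𝓢.bang.Coalgebra, (Y ⟶ X) → Val Y → Pred Y) :
    (lam σ P).pull h ≤ lam σ fun Z k w => P Z (k ≫ h) w := by
  rintro u ⟨w, ⟨τ, Γ, f, H, e⟩, e'⟩
  refine ⟨τ, Γ, h.f ▷ _ ≫ f, fun Z k Δ g ha hn => ?_, e'.trans (e.pull h)⟩
  simpa using H Z (k ≫ h) Δ g ha hn

theorem mu_pull_le (h : Y ⟶ X) {σ : Ty}
    (P : ∀ Y : 𝓢.bang.Coalgebra, (Y ⟶ X) → Val Y → Pred Y) :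
    (mu σ P).pull h ≤ mu σ fun Z k w => P Z (k ≫ h) w := by
  rintro u ⟨w, ⟨g, H, e⟩, e'⟩
  refine ⟨h.f ≫ g, fun Z k w => ?_, ?_⟩
  · simpa using H Z (k ≫ h) w
  · have := e'.trans (e.pull h)
    rw [Val.pull, pull_closed, ← h.h_assoc] at this
    simpa using this

end Pred

/-- Extension of an environment for dangling indices. -/
def consEnv {n : ℕ} (P : Pred X) (b : Fin n → Pred X) : Fin (n + 1) → Pred X :=
  Fin.cases P b

/-- The values of a term in an environment. -/
def Sem : {n : ℕ} → Tm n → (X : 𝓢.bang.Coalgebra) → (Var → Pred X) → (Fin n → Pred X) → Pred X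
  | _, .fvar x, _, ρ, _ => ρ x
  | _, .bvar i, _, _, b => b i
  | _, .zero, X, _, _ => .zero X
  | _, .succ, X, _, _ => .const X 𝓢.num.succ
  | _, .pred, X, _, _ => .const X 𝓢.num.pred
  | _, .app M N, X, ρ, b => .app (Sem M X ρ b) (Sem N X ρ b)
  | _, .lif M L R, X, ρ, b => .lif (Sem M X ρ b) (Sem L X ρ b) (Sem R X ρ b)
  | _, .lam σ M, _, ρ, b => .lam σ fun Y h w =>
      Sem M Y (fun x => (ρ x).pull h) (consEnv (.single w) fun i => (b i).pull h)
  | _, .mu σ M, _, ρ, b => .mu σ fun Y h w =>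
      Sem M Y (fun x => (ρ x).pull h) (consEnv (.single w) fun i => (b i).pull h)

/-- Stability of values under restriction. An inclusion is enough, and it is natural: values over
`Y` need not be restrictions of values over `X`. -/
theorem sem_pull {n : ℕ} (M : Tm n) (h : Y ⟶ X) (ρ : Var → Pred X) (b : Fin n → Pred X) :
    (Sem M X ρ b).pull h ≤ Sem M Y (fun x => (ρ x).pull h) fun i => (b i).pull h := by
  induction M with
  | fvar x => exact Pred.le_refl _
  | bvar i => exact Pred.le_refl _
  | zero => exact Pred.zero_pull_le h
  | succ => exact Pred.const_pull_le h _
  | pred => exact Pred.const_pull_le h _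
  | app M N ihM ihN =>
    exact Pred.le_trans (Pred.app_pull_le h _ _) (Pred.app_mono (ihM _) (ihN _))
  | lif M L R ihM ihL ihR =>
    exact Pred.le_trans (Pred.lif_pull_le h _ _ _) (Pred.lif_mono (ihM _) (ihL _) (ihR _))
  | lam σ M ih =>
    simp only [Sem, Pred.pull_pull]
    exact Pred.lam_pull_le h _
  | mu σ M ih =>
    simp only [Sem, Pred.pull_pull]
    exact Pred.mu_pull_le h _

theorem consEnv_liftRen {n m : ℕ} (P : Pred X) (b : Fin m → Pred X) (r : Fin n → Fin m) :
    consEnv P b ∘ Tm.liftRen r = consEnv P (b ∘ r) := by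
  funext i
  cases i using Fin.cases <;> rfl

theorem sem_ren {n m : ℕ} (M : Tm n) (r : Fin n → Fin m) (ρ : Var → Pred X)
    (b : Fin m → Pred X) : Sem (M.ren r) X ρ b = Sem M X ρ (b ∘ r) := by
  induction M generalizing m X with
  | lam σ M ih | mu σ M ih =>
    simp only [Sem, Tm.ren, ih, consEnv_liftRen]
    rfl
  | _ => simp_all [Sem, Tm.ren]

/-- The substitution lemma. -/
theorem sem_bind {n m : ℕ} (M : Tm n) {φ : Var → Tm m} {s : Fin n → Tm m}
    {ρ ρ' : Var → Pred X} {b : Fin m → Pred X} {b' : Fin n → Pred X}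
    (hρ : ∀ x, ρ' x ≤ Sem (φ x) X ρ b) (hb : ∀ i, b' i ≤ Sem (s i) X ρ b) :
    Sem M X ρ' b' ≤ Sem (M.bind φ s) X ρ b := by
  induction M generalizing m X with
  | fvar x => exact hρ x
  | bvar i => exact hb i
  | app M N ihM ihN => exact Pred.app_mono (ihM hρ hb) (ihN hρ hb)
  | lif M L R ihM ihL ihR => exact Pred.lif_mono (ihM hρ hb) (ihL hρ hb) (ihR hρ hb)
  | lam σ M ih =>
    refine Pred.lam_mono fun Y h w => ih (fun x => ?_) fun i => ?_
    · rw [sem_ren]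
      exact Pred.le_trans (Pred.pull_mono h (hρ x)) (sem_pull _ h ρ b)
    · cases i using Fin.cases with
      | zero => exact Pred.le_refl _
      | succ i =>
        simp only [Tm.up, Fin.cases_succ, sem_ren]
        exact Pred.le_trans (Pred.pull_mono h (hb i)) (sem_pull _ h ρ b)
  | mu σ M ih =>
    refine Pred.mu_mono fun Y h w => ih (fun x => ?_) fun i => ?_
    · rw [sem_ren]
      exact Pred.le_trans (Pred.pull_mono h (hρ x)) (sem_pull _ h ρ b)
    · cases i using Fin.cases with
      | zero => exact Pred.le_refl _
      | succ i =>
        simp only [Tm.up, Fin.cases_succ, sem_ren]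
        exact Pred.le_trans (Pred.pull_mono h (hb i)) (sem_pull _ h ρ b)
  | _ => exact Pred.le_refl _

/-- The inclusion goes from an environment entry to a substituted term, which is the direction of
contraction of a redex. -/
theorem sem_inst {n : ℕ} (M : Tm (n + 1)) (N : Tm n) {ρ : Var → Pred X} {b : Fin n → Pred X}
    {P : Pred X} (hP : P ≤ Sem N X ρ b) : Sem M X ρ (consEnv P b) ≤ Sem (M.inst N) X ρ b :=
  sem_bind M (fun _ => Pred.le_refl _) fun i => by
    cases i using Fin.cases
    · exact hP
    · exact Pred.le_refl _

end SllCategory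

end
end Sll

namespace Sll

noncomputable section

/-! ### Determinism of the semantics -/

namespace SllCategory

open LinearCategory

variable {C : Type u} [Category.{v} C] [MonoidalCategory C] [SymmetricCategory C]
  [MonoidalClosed C] [HasFiniteProducts C] {𝓢 : SllCategory C}

variable {X Y Z : 𝓢.bang.Coalgebra}

/-- The value of a single linear variable. -/
def slot (X : 𝓢.bang.Coalgebra) (x : Var) : X.A ⊗ 𝓢.basis [x] ⟶ 𝓢.var x :=
  wk X ▷ _ ≫ (λ_ _).hom ≫ (ρ_ (𝓢.var x)).hom

/-- Pairing with a fresh linear variable is, up to isomorphism, tensoring with the identity of that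
variable; the copy of `X` given to the slot is discarded by the counit law. Applying a function to
the slot thus merely uncurries it. -/
theorem both_slot {A : C} {Γ : Basis} (f : X.A ⊗ 𝓢.basis Γ ⟶ A) (x : Var) :
    both X Γ [x] f (slot X x) =
      X.A ◁ (𝓢.snocIso Γ x).hom ≫ (α_ X.A (𝓢.basis Γ) (𝓢.var x)).inv ≫ f ▷ 𝓢.var x := by
  have key : split X Γ [x] ≫ (X.A ⊗ 𝓢.basis Γ) ◁ slot X x =
      X.A ◁ (𝓢.snocIso Γ x).hom ≫ (α_ X.A (𝓢.basis Γ) (𝓢.var x)).inv := by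
    have n : tensorμ X.A X.A (𝓢.basis Γ) (𝓢.var x ⊗ 𝟙_ C) ≫
        (X.A ⊗ 𝓢.basis Γ) ◁ (wk X ▷ (𝓢.var x ⊗ 𝟙_ C)) =
        (X.A ◁ wk X) ▷ (𝓢.basis Γ ⊗ 𝓢.var x ⊗ 𝟙_ C) ≫
          tensorμ X.A (𝟙_ C) (𝓢.basis Γ) (𝓢.var x ⊗ 𝟙_ C) := by
      simpa using (tensorμ_natural (𝟙 X.A) (wk X) (𝟙 (𝓢.basis Γ)) (𝟙 (𝓢.var x ⊗ 𝟙_ C))).symm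
    change ((dup X ⊗ₘ (𝓢.appendIso Γ [x]).hom) ≫ tensorμ X.A X.A (𝓢.basis Γ) (𝓢.var x ⊗ 𝟙_ C)) ≫
      (X.A ⊗ 𝓢.basis Γ) ◁ (wk X ▷ (𝓢.var x ⊗ 𝟙_ C) ≫ (λ_ _).hom ≫ (ρ_ (𝓢.var x)).hom) =
      X.A ◁ ((𝓢.appendIso Γ [x]).hom ≫ 𝓢.basis Γ ◁ (ρ_ (𝓢.var x)).hom) ≫ _
    rw [whiskerLeft_comp, Category.assoc, reassoc_of% n, tensorHom_comp_whiskerRight_assoc,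
      dup_wk_right]
    simp only [tensorμ, braiding_tensorUnit_left, MonoidalCategory.tensorHom_def']
    monoidal
  have := key =≫ f ▷ 𝓢.var x
  rw [Category.assoc, Category.assoc, whisker_exchange, ← MonoidalCategory.tensorHom_def] at this
  exact this

theorem both_slot_cancel {B : C} {Γ : Basis} {x : Var} {f g : X.A ⊗ 𝓢.basis Γ ⟶ hom (𝓢.var x) B}
    (h : both X Γ [x] f (slot X x) ≫ eval (𝓢.var x) B =
      both X Γ [x] g (slot X x) ≫ eval (𝓢.var x) B) : f = g := by
  simp only [both_slot, Category.assoc, ← whiskerLeftIso_hom] at h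
  rw [cancel_epi, cancel_epi] at h
  exact eval_cancel h

/-- A morphism which uses a coalgebra argument and a basis. -/
def applySnd (X Y : 𝓢.bang.Coalgebra) {B : C} {Γ : Basis}
    (f : X.A ⊗ 𝓢.basis Γ ⟶ hom Y.A B) : (tensorCoalg X Y).A ⊗ 𝓢.basis Γ ⟶ B :=
  (β_ X.A Y.A).hom ▷ 𝓢.basis Γ ≫ (α_ _ _ _).hom ≫ Y.A ◁ f ≫ (β_ _ _).hom ≫ eval Y.A B

theorem applySnd_cancel {B : C} {Γ : Basis} {f g : X.A ⊗ 𝓢.basis Γ ⟶ hom Y.A B}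
    (h : applySnd X Y f = applySnd X Y g) : f = g := by
  simp only [applySnd, ← whiskerRightIso_hom] at h
  rw [cancel_epi, cancel_epi, BraidedCategory.braiding_naturality_right_assoc,
    BraidedCategory.braiding_naturality_right_assoc, cancel_epi] at h
  exact eval_cancel h

theorem applySnd_permMor {B : C} {Γ Δ : Basis} (p : 𝓢.basis Γ ⟶ 𝓢.basis Δ)
    (f : X.A ⊗ 𝓢.basis Δ ⟶ hom Y.A B) :
    applySnd X Y (X.A ◁ p ≫ f) = (tensorCoalg X Y).A ◁ p ≫ applySnd X Y f := by
  simp only [applySnd]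
  rw [whisker_exchange_assoc]
  simp

/-- The coalgebra analogue of `both_slot`: over `X ⊗ Y`, applying a function restricted from `X` to
the second projection uncurries it, by `dup_fst_snd`. -/
theorem both_snd {B : C} {Γ : Basis} (f : X.A ⊗ 𝓢.basis Γ ⟶ hom Y.A B) :
    𝓢.PermEq (Γ ++ [])
      (both (tensorCoalg X Y) Γ [] ((fstHom X Y).f ▷ _ ≫ f) (closed (sndHom X Y).f) ≫
        eval Y.A B) Γ (applySnd X Y f) := by
  refine ((both_closed_right (X := tensorCoalg X Y) _ _).comp _).trans (.of_eq ?_)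
  have e : dup (tensorCoalg X Y) ≫ ((sndHom X Y).f ⊗ₘ (fstHom X Y).f) = (β_ X.A Y.A).hom := by
    rw [← dup_comm, Category.assoc, ← BraidedCategory.braiding_naturality, reassoc_of% dup_fst_snd]
  have e' : (dup (tensorCoalg X Y)) ▷ 𝓢.basis Γ ≫ (α_ _ _ _).hom ≫
      ((sndHom X Y).f ⊗ₘ (fstHom X Y).f ▷ 𝓢.basis Γ) =
      (β_ X.A Y.A).hom ▷ 𝓢.basis Γ ≫ (α_ _ _ _).hom := by
    rw [← e, comp_whiskerRight, Category.assoc, ← tensorHom_id, ← tensorHom_id _ (𝓢.basis Γ),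
      ← tensorHom_id _ (𝓢.basis Γ), associator_naturality]
  rw [applySnd, ← tensorHom_comp_whiskerLeft, Category.assoc, Category.assoc, Category.assoc,
    Category.assoc, reassoc_of% e']

theorem closed_cancel {A : C} {f g : X.A ⟶ A}
    (h : closed (𝓢 := 𝓢) f = closed g) : f = g := by
  simpa [closed] using h

namespace Pred

/-- All values of a predicate are equivalent. -/
def Det (P : Pred X) : Prop :=
  ∀ u w, u.ctx.Nodup → w.ctx.Nodup → P.rel u → P.rel w → u.Equiv w

theorem det_single (w : Val X) : (single w).Det :=
  fun _ _ _ _ h h' => h.trans h'.symm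

theorem Det.pull {P : Pred X} (hP : P.Det) (h : Y ⟶ X) : (P.pull h).Det :=
  fun _ _ hu hu' ⟨_, hw, e⟩ ⟨_, hw', e'⟩ =>
    (e.trans ((hP _ _ (e.nodup hu) (e'.nodup hu') hw hw').pull h)).trans e'.symm

theorem Det.app {P Q : Pred X} (hP : P.Det) (hQ : Q.Det) : (app P Q).Det := by
  rintro u u' hu hu' ⟨σ, τ, Γ, Δ, f, g, hf, hg, e⟩ ⟨σ', τ', Γ', Δ', f', g', hf', hg', e'⟩
  have hn := List.nodup_append'.1 (e.nodup hu)
  have hn' := List.nodup_append'.1 (e'.nodup hu')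
  have h₁ := hP _ _ hn.1 hn'.1 hf hf'
  have h₂ := hQ _ _ hn.2.1 hn'.2.1 hg hg'
  obtain ⟨et, -⟩ := id h₁
  obtain ⟨rfl, rfl⟩ : σ' = σ ∧ τ' = τ := by simpa using et
  exact (e.trans (.of_permEq ((both_permEq h₁.permEq h₂.permEq).comp _))).trans e'.symm

theorem Det.lif {P Q R : Pred X} (hP : P.Det) (hQ : Q.Det) (hR : R.Det) : (lif P Q R).Det := by
  rintro u u' hu hu' ⟨Γ, Δ, f, g, k, hf, hg, hk, e⟩ ⟨Γ', Δ', f', g', k', hf', hg', hk', e'⟩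
  have hn := List.nodup_append'.1 (e.nodup hu)
  have hn' := List.nodup_append'.1 (e'.nodup hu')
  have h₁ := (hP _ _ hn.1 hn'.1 hf hf').permEq
  obtain ⟨p, hp, rfl⟩ := (hQ _ _ hn.2.1 hn'.2.1 hg hg').permEq
  obtain ⟨q, hq, rfl⟩ := (hR _ _ hn.2.1 hn'.2.1 hk hk').permEq
  -- Both branches live over the same linear basis, so the permutations found for each must coincide
  -- before they can be paired.
  obtain rfl := hp.unique hq
  have h₂ : 𝓢.PermEq Δ (prod.lift (X.A ◁ p ≫ g') (X.A ◁ p ≫ k')) Δ' (prod.lift g' k') :=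
    ⟨p, hp, by rw [prod.comp_lift]⟩
  exact (e.trans (.of_permEq ((both_permEq h₁ h₂).comp _))).trans e'.symm

/-- A function is determined by its value at a generic argument, and determinism of the body settles
both that value and its type. -/
theorem Det.lam {σ : Ty} {P : ∀ Y : 𝓢.bang.Coalgebra, (Y ⟶ X) → Val Y → Pred Y}
    (hP : ∀ Y h w, (P Y h w).Det) : (lam σ P).Det := by
  rintro u u' hu hu' ⟨τ, Γ, f, H, e⟩ ⟨τ', Γ', f', H', e'⟩
  suffices h : Val.Equiv ⟨.lolli σ τ, Γ, f⟩ ⟨.lolli σ τ', Γ', f'⟩ from (e.trans h).trans e'.symm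
  have hn := e.nodup hu
  have hn' := e'.nodup hu'
  cases σ with
  | nat =>
    -- The generic ground argument is a projection, which is a coalgebra morphism as `IsArg`
    -- requires.
    have a : IsArg (tensorCoalg X 𝓢.num.coalg) .nat []
        (SllCategory.closed (sndHom X 𝓢.num.coalg).f) := ⟨_, .refl _⟩
    have h₁ := H _ (fstHom X 𝓢.num.coalg) [] _ a (by simpa using hn)
    have h₂ := H' _ (fstHom X 𝓢.num.coalg) [] _ a (by simpa using hn')
    have h := hP _ _ _ _ _ (by simpa using hn) (by simpa using hn') h₁ h₂
    obtain ⟨et, -⟩ := id h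
    obtain rfl : τ' = τ := et
    obtain ⟨p, hp, h⟩ := ((both_snd (Y := 𝓢.num.coalg) f).symm.trans h.permEq).trans
      (both_snd (Y := 𝓢.num.coalg) f')
    rw [← applySnd_permMor] at h
    exact .of_permEq ⟨p, hp, applySnd_cancel h⟩
  | lolli σ₁ σ₂ =>
    -- The generic higher-order argument is a variable fresh for both bases; each type has
    -- infinitely many.
    obtain ⟨m, hm⟩ : ∃ m, Var.ord (.lolli σ₁ σ₂) m ∉ Γ ++ Γ' := by
      by_contra! h
      exact Set.infinite_of_injective_forall_mem (f := Var.ord (.lolli σ₁ σ₂))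
        (fun _ _ h => by simpa using h) h (Γ ++ Γ').finite_toSet
    rw [List.mem_append, not_or] at hm
    have hd : (Γ ++ [Var.ord (.lolli σ₁ σ₂) m]).Nodup := by
      simpa [List.nodup_append', hn] using hm.1
    have hd' : (Γ' ++ [Var.ord (.lolli σ₁ σ₂) m]).Nodup := by
      simpa [List.nodup_append', hn'] using hm.2
    have h₁ := H X (𝟙 X) [.ord (.lolli σ₁ σ₂) m] (slot X _) trivial hd
    have h₂ := H' X (𝟙 X) [.ord (.lolli σ₁ σ₂) m] (slot X _) trivial hd'
    have h := hP _ _ _ _ _ hd hd' h₁ h₂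
    obtain ⟨et, -⟩ := id h
    obtain rfl : τ' = τ := et
    obtain ⟨r, hr, h⟩ := h.permEq
    -- A permutation of the bases without the fresh variable extends to one fixing it, and by
    -- uniqueness this extension is `r`.
    obtain ⟨p, hp⟩ := PermMor.exists_of_perm (𝓢 := 𝓢) ((List.perm_append_right_iff _).1 hr.perm) hn
    obtain ⟨r', hr', er⟩ := hp.append_right [.ord (.lolli σ₁ σ₂) m]
    obtain rfl := hr.unique hr'
    have := both_permMor (p := p) (q := 𝟙 _) (r := r) (by simpa using er) f'
      (slot X (.ord (.lolli σ₁ σ₂) m))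
    simp only [Comonad.Coalgebra.id_f, id_whiskerRight, Category.id_comp] at h
    rw [← reassoc_of% this] at h
    simp only [whiskerLeft_id, Category.id_comp] at h
    exact .of_permEq ⟨p, hp, both_slot_cancel h⟩

/-- The functional `g` is recovered from its value at the generic stable argument, the projection `X
⊗ !σ ⟶ !σ`; the fixed point is a function of `g`. -/
theorem Det.mu {σ : Ty} {P : ∀ Y : 𝓢.bang.Coalgebra, (Y ⟶ X) → Val Y → Pred Y}
    (hP : ∀ Y h w, (P Y h w).Det) : (mu σ P).Det := by
  rintro u u' hu hu' ⟨g, H, e⟩ ⟨g', H', e'⟩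
  have h := (hP _ _ _ _ _ List.nodup_nil List.nodup_nil
    (H _ (fstHom X (𝓢.cofree (𝓢.ty σ))) (sndHom X (𝓢.cofree (𝓢.ty σ))))
    (H' _ (fstHom X (𝓢.cofree (𝓢.ty σ))) (sndHom X (𝓢.cofree (𝓢.ty σ))))).permEq.eq
  have h := closed_cancel h
  rw [← tensorHom_comp_whiskerRight, ← tensorHom_comp_whiskerRight, Category.assoc,
    Category.assoc, reassoc_of% dup_fst_snd, reassoc_of% dup_fst_snd] at h
  rw [eval_cancel h] at e
  exact e.trans e'.symm

end Pred

/-- The semantics of a term is determined up to a permutation of the linear variables. -/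
theorem sem_det {n : ℕ} (M : Tm n) {ρ : Var → Pred X} {b : Fin n → Pred X}
    (hρ : ∀ x, (ρ x).Det) (hb : ∀ i, (b i).Det) : (Sem M X ρ b).Det := by
  induction M generalizing X with
  | fvar x => exact hρ x
  | bvar i => exact hb i
  | app M N ihM ihN => exact (ihM hρ hb).app (ihN hρ hb)
  | lif M L R ihM ihL ihR => exact (ihM hρ hb).lif (ihL hρ hb) (ihR hρ hb)
  | lam σ M ih =>
    refine Pred.Det.lam fun Y h w => ih (fun x => (hρ x).pull h) fun i => ?_
    cases i using Fin.cases with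
    | zero => exact Pred.det_single w
    | succ i => exact (hb i).pull h
  | mu σ M ih =>
    refine Pred.Det.mu fun Y h w => ih (fun x => (hρ x).pull h) fun i => ?_
    cases i using Fin.cases with
    | zero => exact Pred.det_single w
    | succ i => exact (hb i).pull h
  | _ => exact Pred.det_single _

end SllCategory

end
end Sll

namespace Sll

noncomputable section

/-! ### Parallel reduction preserves the semantics -/

namespace SllCategory

open LinearCategory

variable {C : Type u} [Category.{v} C] [MonoidalCategory C] [SymmetricCategory C]
  [MonoidalClosed C] [HasFiniteProducts C] {𝓢 : SllCategory C}

variable {X Y Z : 𝓢.bang.Coalgebra}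

/-- The value of a numeral. -/
abbrev numVal (X : 𝓢.bang.Coalgebra) (k : ℕ) : Val X :=
  ⟨.nat, [], closed (wk X ≫ Sll.numeral 𝓢.num.zero 𝓢.num.succ k)⟩

theorem const_app (k : X.A ⟶ 𝓢.num.N) (l : 𝓢.num.N ⟶ 𝓢.num.N) :
    both X [] [] (closed (wk X ≫ curr ((λ_ 𝓢.num.N).hom ≫ l))) (closed k) ≫
      eval 𝓢.num.N 𝓢.num.N = closed (k ≫ l) := by
  rw [both_closed, closed_comp, ← whiskerRight_comp_tensorHom,
    MonoidalCategory.tensorHom_def', Category.assoc, Category.assoc, Category.assoc,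
    curr_whiskerRight_eval, reassoc_of% dup_wk_left, leftUnitor_naturality_assoc,
    Iso.inv_hom_id_assoc]

theorem const_app_equiv {l : 𝓢.num.N ⟶ 𝓢.num.N} {P : Pred X} {k : X.A ⟶ 𝓢.num.N} {u : Val X}
    (hP : ∀ w, P.rel w → w.Equiv ⟨.nat, [], closed k⟩)
    (hu : (Pred.app (.const X l) P).rel u) : u.Equiv ⟨.nat, [], closed (k ≫ l)⟩ := by
  obtain ⟨σ, τ, Γ, Δ, f, g, hf, hg, e⟩ := hu
  obtain ⟨et, -⟩ := id hf
  obtain ⟨rfl, rfl⟩ : Ty.nat = σ ∧ Ty.nat = τ := by simpa using et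
  have h := (both_permEq (Val.Equiv.permEq hf) (hP _ hg).permEq).comp (eval 𝓢.num.N 𝓢.num.N)
  rw [const_app] at h
  exact e.trans (.of_permEq h)

/-- Any value of a numeral is the expected morphism, without linear variables. It is therefore a
coalgebra morphism, which is what lets a numeral be passed to a ground abstraction. -/
theorem sem_numeral {n : ℕ} (k : ℕ) {ρ : Var → Pred X} {b : Fin n → Pred X} {u : Val X}
    (hu : (Sem (.numeral k) X ρ b).rel u) : u.Equiv (numVal X k) := by
  induction k generalizing u with
  | zero => exact hu
  | succ k ih =>
    have := const_app_equiv (fun w hw => ih hw) hu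
    rwa [Category.assoc] at this

/-- Transfers the laws of `cond` to branches with free variables: the law is used at the object `X ⊗
⟦Δ⟧`, and the copy of `X` given to the condition is discarded. -/
theorem cond_eq (c : 𝟙_ C ⟶ 𝓢.num.N) {Δ : Basis} (g k l : X.A ⊗ 𝓢.basis Δ ⟶ 𝓢.num.N)
    (h : (λ_ _).inv ≫ (c ⊗ₘ prod.lift g k) ≫ 𝓢.cond = l) :
    both X [] Δ (closed (wk X ≫ c)) (prod.lift g k) ≫ 𝓢.cond = l := by
  have := both_comp_left (closed (𝓢 := 𝓢) (wk X)) (prod.lift g k) c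
  rw [closed_comp] at this
  have e := (Iso.eq_comp_inv _).2 (both_unit_left (𝓢 := 𝓢) (prod.lift g k))
  rw [this, ← h, Category.assoc, e, Category.assoc, leftUnitor_inv_naturality_assoc,
    MonoidalCategory.tensorHom_def', Category.assoc]
  rfl

/-- This is `fix_eq` pulled back along the coalgebra morphism from `X` induced by `g`. Being a
comonoid morphism, it moves the duplication to `X`. -/
theorem fix_unfold {σ : Ty} (g : X.A ⟶ hom (𝓢.bang.obj (𝓢.ty σ)) (𝓢.ty σ)) :
    dup X ≫ (g ⊗ₘ (lift (X.a ≫ 𝓢.bang.map g ≫ 𝓢.fix (𝓢.ty σ))).f) ≫ eval _ _ =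
      X.a ≫ 𝓢.bang.map g ≫ 𝓢.fix (𝓢.ty σ) := by
  have n := 𝓢.bang.ε.naturality g
  have n' := 𝓢.bang.δ.naturality g
  simp only [Functor.id_map, Functor.comp_map] at n n'
  have e₁ : X.a ≫ 𝓢.bang.map g ≫ 𝓢.bang.ε.app _ = g := by rw [n, reassoc_of% X.counit]
  have e₂ : X.a ≫ 𝓢.bang.map g ≫ 𝓢.bang.δ.app _ ≫ 𝓢.bang.map (𝓢.fix (𝓢.ty σ)) =
      (lift (X.a ≫ 𝓢.bang.map g ≫ 𝓢.fix (𝓢.ty σ))).f := by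
    rw [reassoc_of% n', reassoc_of% X.coassoc]
    simp
  conv_rhs => rw [← 𝓢.fix_eq]
  rw [reassoc_of% 𝓢.d_natural g, reassoc_of% coalgebra_comul X,
    tensorHom_comp_tensorHom_assoc, tensorHom_comp_tensorHom_assoc, Category.assoc, Category.assoc,
    e₁, e₂]

/-- Parallel reduction preserves the values of a term. -/
theorem sem_par {n : ℕ} {M M' : Tm n} (h : Par M M') {ρ : Var → Pred X} {b : Fin n → Pred X}
    {u : Val X} (hn : u.ctx.Nodup) (hu : (Sem M X ρ b).rel u) : (Sem M' X ρ b).rel u := by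
  induction h generalizing X u with
  | app _ _ ihM ihN =>
    obtain ⟨σ, τ, Γ, Δ, f, g, hf, hg, e⟩ := hu
    have hn := List.nodup_append'.1 (e.nodup hn)
    exact ⟨σ, τ, Γ, Δ, f, g, ihM hn.1 hf, ihN hn.2.1 hg, e⟩
  | lif _ _ _ ihM ihL ihR =>
    obtain ⟨Γ, Δ, f, g, k, hf, hg, hk, e⟩ := hu
    have hn := List.nodup_append'.1 (e.nodup hn)
    exact ⟨Γ, Δ, f, g, k, ihM hn.1 hf, ihL hn.2.1 hg, ihR hn.2.1 hk, e⟩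
  | lam σ _ ih =>
    obtain ⟨τ, Γ, f, H, e⟩ := hu
    exact ⟨τ, Γ, f, fun Y h Δ g ha hd => ih hd (H Y h Δ g ha hd), e⟩
  | mu σ _ ih =>
    obtain ⟨g, H, e⟩ := hu
    exact ⟨g, fun Y h w => ih List.nodup_nil (H Y h w), e⟩
  | beta σ₁ σ₂ _ _ ihM ihN =>
    obtain ⟨σ, τ, Γ, Δ, f, g, ⟨τ', Γ', f', H, e'⟩, hg, e⟩ := hu
    obtain ⟨et, -⟩ := id e'
    obtain ⟨rfl, rfl⟩ : Ty.lolli σ₁ σ₂ = σ ∧ τ' = τ := by simpa using et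
    have hd := List.nodup_append'.1 (e.nodup hn)
    have e'' := e.trans (.of_permEq ((both_permEq e'.permEq (.refl g)).comp _))
    -- The abstraction is tested at the identity world with the actual argument; at higher type
    -- every morphism is admissible.
    have := H X (𝟙 X) Δ g trivial (e''.nodup hn)
    simp only [Comonad.Coalgebra.id_f, id_whiskerRight, Category.id_comp, Pred.pull_id] at this
    exact (Sem _ X ρ b).closed e'' (sem_inst _ _ (Pred.single_le (ihN hd.2.1 hg)) _
      (ihM (e''.nodup hn) this))
  | iota k hN _ ih =>
    obtain ⟨σ, τ, Γ, Δ, f, g, ⟨τ', Γ', f', H, e'⟩, hg, e⟩ := hu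
    obtain ⟨et, -⟩ := id e'
    obtain ⟨rfl, rfl⟩ : Ty.nat = σ ∧ τ' = τ := by simpa using et
    have e'' := e.trans (.of_permEq ((both_permEq e'.permEq (.refl g)).comp _))
    -- The restriction of the ground rule to numerals is used here: the argument must be a coalgebra
    -- morphism.
    have ha : IsArg X .nat Δ g := by
      refine ⟨wkHom X ≫ 𝓢.num.numeralHom k, ?_⟩
      rw [Comonad.Coalgebra.comp_f, ExpNumerals.numeralHom_f]
      subst hN
      exact (sem_numeral k hg).permEq
    have := H X (𝟙 X) Δ g ha (e''.nodup hn)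
    simp only [Comonad.Coalgebra.id_f, id_whiskerRight, Category.id_comp, Pred.pull_id] at this
    exact (Sem _ X ρ b).closed e'' (sem_inst _ _ (Pred.single_le hg) _ (ih (e''.nodup hn) this))
  | @unfold _ σ B B' _ ih =>
    obtain ⟨g, H, e⟩ := hu
    have hm : (Sem (.mu σ B') X ρ b).rel
        ⟨σ, [], closed (X.a ≫ 𝓢.bang.map g ≫ 𝓢.fix (𝓢.ty σ))⟩ :=
      ⟨g, fun Y h w => ih List.nodup_nil (H Y h w), .refl _⟩
    -- The stable argument is the promotion of the fixed point itself, so that `fix_unfold`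
    -- identifies the resulting value with the original one.
    have := H X (𝟙 X) (lift (X.a ≫ 𝓢.bang.map g ≫ 𝓢.fix (𝓢.ty σ)))
    simp only [Comonad.Coalgebra.id_f, Category.id_comp, Pred.pull_id] at this
    rw [lift_counit, fix_unfold] at this
    exact (Sem _ X ρ b).closed e
      (sem_inst _ _ (Pred.single_le hm) _ (ih List.nodup_nil this))
  | pred_succ k hN =>
    subst hN
    have := const_app_equiv (fun w hw => sem_numeral (k + 1) hw) hu
    rw [Category.assoc, 𝓢.num.pred_numeral] at this
    -- The value of the redex contains a value of the numeral `k` as innermost argument, and all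
    -- values of that numeral are equivalent.
    obtain ⟨_, _, _, _, _, _, _, ⟨σ, τ, Γ, Δ, f, g, hf, hg, -⟩, -⟩ := hu
    exact (Sem _ X ρ b).closed (this.trans (sem_numeral k hg).symm) hg
  | lif_zero hM _ ih =>
    subst hM
    obtain ⟨Γ, Δ, f, g, k, hf, hg, hk, e⟩ := hu
    have h := (both_permEq (sem_numeral 0 hf).permEq (.refl (prod.lift g k))).comp 𝓢.cond
    rw [cond_eq (numeral _ _ 0) g k g (𝓢.cond_zero g k)] at h
    exact ih hn ((Sem _ X ρ b).closed (e.trans (.of_permEq h)) hg)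
  | lif_succ m hM _ ih =>
    subst hM
    obtain ⟨Γ, Δ, f, g, k, hf, hg, hk, e⟩ := hu
    have h := (both_permEq (sem_numeral (m + 1) hf).permEq (.refl (prod.lift g k))).comp 𝓢.cond
    rw [cond_eq _ g k k (𝓢.cond_succ m g k)] at h
    exact ih hn ((Sem _ X ρ b).closed (e.trans (.of_permEq h)) hk)
  | _ => exact hu

end SllCategory

end
end Sll

namespace Sll

noncomputable section

/-! ### The interpretation of derivations computes the semantics -/

theorem Deriv.nodup {Γ : Basis} {M : Term} {σ : Ty} (d : Deriv Γ M σ) : Γ.Nodup := by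
  induction d with
  | z | s | p => exact List.nodup_nil
  | gv | hv | sv => exact List.nodup_singleton _
  | lif h _ _ _ ih₁ ih₂ => exact ih₁.append ih₂ h
  | ap h _ _ ih₁ ih₂ => exact ih₁.append ih₂ h
  | ex Γ x y Δ _ ih => exact (((List.Perm.swap y x Δ).append_left Γ).nodup_iff.2 ih)
  | gw n h _ ih | sw σ n h _ ih =>
    exact ih.append (List.nodup_singleton _) (by simpa using h)
  | gc n _ _ h _ ih | sc σ n _ _ h _ ih =>
    exact (List.nodup_append'.1 ih).1.append (List.nodup_singleton _) (by simpa using h)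
  | lam σ n _ ih | mu σ n _ _ _ ih => exact (List.nodup_append'.1 ih).1

namespace SllCategory

open LinearCategory

variable {C : Type u} [Category.{v} C] [MonoidalCategory C] [SymmetricCategory C]
  [MonoidalClosed C] [HasFiniteProducts C] {𝓢 : SllCategory C}

variable {X Y Z : 𝓢.bang.Coalgebra}

/-- The morphisms which may be assigned to a variable whose values satisfy `P`. -/
def Good (P : Pred X) : (x : Var) → (Δ : Basis) → (X.A ⊗ 𝓢.basis Δ ⟶ 𝓢.var x) → Prop
  | .ord .nat _, Δ, g => ∃ k : X ⟶ 𝓢.num.coalg, 𝓢.PermEq Δ g [] (closed k.f) ∧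
      P.rel ⟨.nat, [], closed k.f⟩
  | .ord (.lolli σ τ) _, Δ, g => P.rel ⟨.lolli σ τ, Δ, g⟩
  | .stb σ _, Δ, g => ∃ k : X ⟶ 𝓢.cofree (𝓢.ty σ), 𝓢.PermEq Δ g [] (closed k.f) ∧
      P.rel ⟨σ, [], closed (k.f ≫ 𝓢.bang.ε.app (𝓢.ty σ))⟩

theorem Good.of_permEq {P : Pred X} {x : Var} {Δ Δ' : Basis} {g : X.A ⊗ 𝓢.basis Δ ⟶ 𝓢.var x}
    {g' : X.A ⊗ 𝓢.basis Δ' ⟶ 𝓢.var x} (h : 𝓢.PermEq Δ g Δ' g') (hg : Good P x Δ' g') :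
    Good P x Δ g := by
  rcases x with ⟨_ | ⟨σ, τ⟩, n⟩ | ⟨σ, n⟩
  · obtain ⟨k, hk, hP⟩ := hg
    exact ⟨k, h.trans hk, hP⟩
  · exact P.closed (.of_permEq h) hg
  · obtain ⟨k, hk, hP⟩ := hg
    exact ⟨k, h.trans hk, hP⟩

theorem Good.pull {P : Pred X} {x : Var} {Δ : Basis} {g : X.A ⊗ 𝓢.basis Δ ⟶ 𝓢.var x}
    (hg : Good P x Δ g) (h : Y ⟶ X) : Good (P.pull h) x Δ (h.f ▷ _ ≫ g) := by
  rcases x with ⟨_ | ⟨σ, τ⟩, n⟩ | ⟨σ, n⟩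
  · obtain ⟨k, hk, hP⟩ := hg
    refine ⟨h ≫ k, ?_, ?_⟩
    · have := hk.pull h.f
      rwa [pull_closed] at this
    · have := Pred.rel_pull h hP
      rwa [Val.pull, pull_closed] at this
  · exact Pred.rel_pull h hg
  · obtain ⟨k, hk, hP⟩ := hg
    refine ⟨h ≫ k, ?_, ?_⟩
    · have := hk.pull h.f
      rwa [pull_closed] at this
    · have := Pred.rel_pull h hP
      rw [Val.pull, pull_closed] at this
      simpa using this

/-- `Env ρ Γ Δ h` says that `h` assigns to the variables of `Γ` morphisms conforming to the
environment `ρ`, which together use the linear variables `Δ`. -/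
def Env (ρ : Var → Pred X) : (Γ Δ : Basis) → (X.A ⊗ 𝓢.basis Δ ⟶ 𝓢.basis Γ) → Prop
  | [], Δ, h => 𝓢.PermEq Δ h [] (closed (wk X))
  | x :: Γ, Δ, h => ∃ Δ₁ Δ₂ g k, Good (ρ x) x Δ₁ g ∧ Env ρ Γ Δ₂ k ∧
      𝓢.PermEq Δ h (Δ₁ ++ Δ₂) (both X Δ₁ Δ₂ g k)

/-! ### Environments under the structural rules. -/

namespace Env

variable {ρ ρ' : Var → Pred X} {Γ Γ₁ Γ₂ Δ Δ' Δ₁ Δ₂ : Basis} {x y : Var}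

theorem of_permEq {h : X.A ⊗ 𝓢.basis Δ ⟶ 𝓢.basis Γ} {h' : X.A ⊗ 𝓢.basis Δ' ⟶ 𝓢.basis Γ}
    (e : 𝓢.PermEq Δ h Δ' h') (hh : Env ρ Γ Δ' h') : Env ρ Γ Δ h := by
  cases Γ with
  | nil => exact e.trans hh
  | cons x Γ =>
    obtain ⟨Δ₁, Δ₂, g, k, hg, hk, e'⟩ := hh
    exact ⟨Δ₁, Δ₂, g, k, hg, hk, e.trans e'⟩

theorem pull {h : X.A ⊗ 𝓢.basis Δ ⟶ 𝓢.basis Γ} (hh : Env ρ Γ Δ h) (l : Y ⟶ X) :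
    Env (fun x => (ρ x).pull l) Γ Δ (l.f ▷ _ ≫ h) := by
  induction Γ generalizing Δ with
  | nil =>
    have := PermEq.pull hh l.f
    rwa [pull_closed, hom_wk] at this
  | cons x Γ ih =>
    obtain ⟨Δ₁, Δ₂, g, k, hg, hk, e⟩ := hh
    refine ⟨Δ₁, Δ₂, _, _, hg.pull l, ih hk, ?_⟩
    have := e.pull l.f
    rwa [pull_both] at this

theorem congr (H : ∀ x ∈ Γ, ρ x = ρ' x) {h : X.A ⊗ 𝓢.basis Δ ⟶ 𝓢.basis Γ}
    (hh : Env ρ Γ Δ h) : Env ρ' Γ Δ h := by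
  induction Γ generalizing Δ with
  | nil => exact hh
  | cons x Γ ih =>
    obtain ⟨Δ₁, Δ₂, g, k, hg, hk, e⟩ := hh
    rw [H x List.mem_cons_self] at hg
    exact ⟨Δ₁, Δ₂, g, k, hg, ih (fun y hy => H y (List.mem_cons_of_mem x hy)) hk, e⟩

/-- The semantic counterpart of context splitting in application and conditional: the coalgebra is
shared and the linear variables are divided. -/
theorem of_append {h : X.A ⊗ 𝓢.basis Δ ⟶ 𝓢.basis (Γ₁ ++ Γ₂)} (hh : Env ρ (Γ₁ ++ Γ₂) Δ h) :
    ∃ Δ₁ Δ₂ h₁ h₂, Env ρ Γ₁ Δ₁ h₁ ∧ Env ρ Γ₂ Δ₂ h₂ ∧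
      𝓢.PermEq Δ (h ≫ (𝓢.appendIso Γ₁ Γ₂).hom) (Δ₁ ++ Δ₂) (both X Δ₁ Δ₂ h₁ h₂) := by
  induction Γ₁ generalizing Δ with
  | nil =>
    refine ⟨[], Δ, closed (wk X), h, PermEq.refl _, hh, .of_eq ?_⟩
    exact ((Iso.eq_comp_inv _).2 (both_unit_left h)).symm
  | cons x Γ₁ ih =>
    obtain ⟨Δ₁, Δ₂, g, k, hg, hk, e⟩ := hh
    obtain ⟨Θ₁, Θ₂, h₁, h₂, hh₁, hh₂, e'⟩ := ih hk
    refine ⟨Δ₁ ++ Θ₁, Θ₂, both X Δ₁ Θ₁ g h₁, h₂, ⟨_, _, _, _, hg, hh₁, .refl _⟩, hh₂, ?_⟩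
    have e₁ := e.comp (𝓢.appendIso (x :: Γ₁) Γ₂).hom
    rw [appendIso_cons_hom, ← Category.assoc (both _ _ _ _ _), ← both_comp_right] at e₁
    have e₂ := (both_permEq (.refl g) e').comp (α_ _ _ _).inv
    have e₃ := (both_assoc (X := X) g h₁ h₂).symm.comp (α_ _ _ _).inv
    rw [Category.assoc, Iso.hom_inv_id, Category.comp_id] at e₃
    exact (e₁.trans e₂).trans e₃

theorem append {h₁ : X.A ⊗ 𝓢.basis Δ₁ ⟶ 𝓢.basis Γ₁} {h₂ : X.A ⊗ 𝓢.basis Δ₂ ⟶ 𝓢.basis Γ₂}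
    (hh₁ : Env ρ Γ₁ Δ₁ h₁) (hh₂ : Env ρ Γ₂ Δ₂ h₂) :
    Env ρ (Γ₁ ++ Γ₂) (Δ₁ ++ Δ₂) (both X Δ₁ Δ₂ h₁ h₂ ≫ (𝓢.appendIso Γ₁ Γ₂).inv) := by
  induction Γ₁ generalizing Δ₁ with
  | nil =>
    have e := (both_permEq hh₁ (.refl h₂)).comp (λ_ (𝓢.basis Γ₂)).hom
    rw [both_unit_left] at e
    exact of_permEq e hh₂
  | cons x Γ₁ ih =>
    obtain ⟨Θ₁, Θ₂, g, k, hg, hk, e⟩ := hh₁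
    refine ⟨Θ₁, Θ₂ ++ Δ₂, g, _, hg, ih hk, ?_⟩
    rw [both_comp_right]
    have e₁ := (both_permEq e (.refl h₂)).comp
      ((α_ _ _ _).hom ≫ 𝓢.var x ◁ (𝓢.appendIso Γ₁ Γ₂).inv)
    have e₂ := (both_assoc (X := X) g k h₂).comp (𝓢.var x ◁ (𝓢.appendIso Γ₁ Γ₂).inv)
    rw [Category.assoc] at e₂
    exact e₁.trans e₂

theorem singleton_iff {h : X.A ⊗ 𝓢.basis Δ ⟶ 𝓢.basis [x]} :
    Env ρ [x] Δ h ↔ Good (ρ x) x Δ (h ≫ (ρ_ (𝓢.var x)).hom) := by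
  constructor
  · rintro ⟨Δ₁, Δ₂, g, k, hg, hk, e⟩
    have e' := (e.trans (both_permEq (.refl g) hk)).comp (ρ_ (𝓢.var x)).hom
    exact Good.of_permEq (e'.trans (both_unit_right g)) hg
  · intro hg
    refine ⟨_, [], _, closed (wk X), hg, PermEq.refl _, ?_⟩
    have e := (both_unit_right (h ≫ (ρ_ (𝓢.var x)).hom)).symm.comp (ρ_ (𝓢.var x)).inv
    simp only [Category.assoc, Iso.hom_inv_id, Category.comp_id] at e
    exact e

theorem of_snoc {h : X.A ⊗ 𝓢.basis Δ ⟶ 𝓢.basis (Γ ++ [x])} (hh : Env ρ (Γ ++ [x]) Δ h) :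
    ∃ Δ₁ Δ₂ k g, Env ρ Γ Δ₁ k ∧ Good (ρ x) x Δ₂ g ∧
      𝓢.PermEq Δ (h ≫ (𝓢.snocIso Γ x).hom) (Δ₁ ++ Δ₂) (both X Δ₁ Δ₂ k g) := by
  obtain ⟨Δ₁, Δ₂, h₁, h₂, hh₁, hh₂, e⟩ := hh.of_append
  refine ⟨Δ₁, Δ₂, h₁, _, hh₁, singleton_iff.1 hh₂, ?_⟩
  have := e.comp (𝓢.basis Γ ◁ (ρ_ (𝓢.var x)).hom)
  rw [both_comp_right]
  simpa [snocIso] using this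

theorem snoc {k : X.A ⊗ 𝓢.basis Δ₁ ⟶ 𝓢.basis Γ} {g : X.A ⊗ 𝓢.basis Δ₂ ⟶ 𝓢.var x}
    (hk : Env ρ Γ Δ₁ k) (hg : Good (ρ x) x Δ₂ g) :
    Env ρ (Γ ++ [x]) (Δ₁ ++ Δ₂) (both X Δ₁ Δ₂ k g ≫ (𝓢.snocIso Γ x).inv) := by
  have hg' : Env ρ [x] Δ₂ (g ≫ (ρ_ (𝓢.var x)).inv) := by
    rw [singleton_iff]
    simpa using hg
  have := hk.append hg'
  rw [both_comp_right] at this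
  simpa [snocIso] using this

theorem swap {h : X.A ⊗ 𝓢.basis Δ ⟶ 𝓢.basis (x :: y :: Γ)} (hΔ : Δ.Nodup)
    (hh : Env ρ (x :: y :: Γ) Δ h) :
    Env ρ (y :: x :: Γ) Δ (h ≫ swapL (𝓢.var x) (𝓢.var y) (𝓢.basis Γ)) := by
  obtain ⟨Δ₁, Δ', g, h', hg, ⟨Δ₂, Δ₃, k, l, hk, hl, e'⟩, e⟩ := hh
  refine ⟨Δ₂, _, k, _, hk, ⟨Δ₁, Δ₃, g, l, hg, hl, .refl _⟩, ?_⟩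
  have hn := e.perm.nodup_iff.1 hΔ
  -- The values of `x` and `y` use disjoint sets of linear variables since `Δ` has no repetitions;
  -- only then may they be exchanged.
  have hd : Δ₁.Disjoint Δ₂ := by
    have := (e'.perm.append_left Δ₁).nodup_iff.1 hn
    rw [← List.append_assoc] at this
    exact (List.nodup_append'.1 (List.nodup_append'.1 this).1).2.2
  have e₁ := (e.trans (both_permEq (.refl g) e')).trans (both_assoc (X := X) g k l).symm
  have e₂ := (both_permEq (both_comm (X := X) hd g k) (.refl l)).comp (α_ _ _ _).hom
  rw [both_comp_left] at e₂
  have e₃ := e₁.comp (swapL (𝓢.var x) (𝓢.var y) (𝓢.basis Γ))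
  rw [swapL, Category.assoc, Iso.hom_inv_id_assoc, ← Category.assoc (both _ _ _ _ _)] at e₃
  exact (e₃.trans e₂).trans (both_assoc k g l)

theorem exchange {h : X.A ⊗ 𝓢.basis Δ ⟶ 𝓢.basis (Γ₁ ++ x :: y :: Γ₂)} (hΔ : Δ.Nodup)
    (hh : Env ρ (Γ₁ ++ x :: y :: Γ₂) Δ h) :
    Env ρ (Γ₁ ++ y :: x :: Γ₂) Δ (h ≫ 𝓢.exchange Γ₁ x y Γ₂) := by
  obtain ⟨Δ₁, Δ₂, h₁, h₂, hh₁, hh₂, e⟩ := hh.of_append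
  have hn := List.nodup_append'.1 (e.perm.nodup_iff.1 hΔ)
  refine of_permEq ?_ (hh₁.append (hh₂.swap hn.2.1))
  have := e.comp (𝓢.basis Γ₁ ◁ swapL (𝓢.var x) (𝓢.var y) (𝓢.basis Γ₂) ≫
    (𝓢.appendIso Γ₁ (y :: x :: Γ₂)).inv)
  rw [both_comp_right, Category.assoc]
  rw [Category.assoc] at this
  exact this

theorem discard {h : X.A ⊗ 𝓢.basis Δ ⟶ 𝓢.basis (Γ ++ [x])} (hh : Env ρ (Γ ++ [x]) Δ h)
    {w : 𝓢.var x ⟶ 𝟙_ C} (hw : ∀ Θ g, Good (ρ x) x Θ g → 𝓢.PermEq Θ (g ≫ w) [] (closed (wk X))) :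
    Env ρ Γ Δ (h ≫ 𝓢.discard Γ x w) := by
  obtain ⟨Δ₁, Δ₂, k, g, hk, hg, e⟩ := hh.of_snoc
  refine of_permEq ?_ hk
  have e₁ := e.comp (𝓢.basis Γ ◁ w ≫ (ρ_ (𝓢.basis Γ)).hom)
  have e₂ := (both_permEq (.refl k) (hw _ _ hg)).comp (ρ_ (𝓢.basis Γ)).hom
  rw [both_comp_right, Category.assoc] at e₂
  rw [Category.assoc] at e₁
  exact (e₁.trans e₂).trans (both_unit_right k)

/-- Hypothesis `hc` holds for ground and stable variables because their assignments are coalgebra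
morphisms: copying the result amounts to copying `X`, and no linear variable is duplicated. -/
theorem contract {x₁ x₂ : Var} {h : X.A ⊗ 𝓢.basis Δ ⟶ 𝓢.basis (Γ ++ [x])}
    (hh : Env ρ (Γ ++ [x]) Δ h) (H : ∀ y ∈ Γ, ρ y = ρ' y)
    {c : 𝓢.var x ⟶ 𝓢.var x₁ ⊗ 𝓢.var x₂}
    (hc : ∀ Θ g, Good (ρ x) x Θ g → ∃ g₁ g₂, Good (ρ' x₁) x₁ [] (closed g₁) ∧
      Good (ρ' x₂) x₂ [] (closed g₂) ∧
      𝓢.PermEq Θ (g ≫ c) [] (closed (dup X ≫ (g₁ ⊗ₘ g₂)))) :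
    Env ρ' (Γ ++ [x₁, x₂]) Δ (h ≫ 𝓢.contract Γ x x₁ x₂ c) := by
  obtain ⟨Δ₁, Δ₂, k, g, hk, hg, e⟩ := hh.of_snoc
  obtain ⟨g₁, g₂, hg₁, hg₂, e'⟩ := hc _ _ hg
  have h₂ : Env ρ' [x₂] [] (closed g₂ ≫ (ρ_ (𝓢.var x₂)).inv) := by
    rw [singleton_iff]
    simpa using hg₂
  have h₁₂ : Env ρ' [x₁, x₂] [] (both X [] [] (closed g₁) (closed g₂ ≫ (ρ_ (𝓢.var x₂)).inv)) :=
    ⟨_, _, _, _, hg₁, h₂, .refl _⟩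
  refine of_permEq ?_ ((hk.congr H).append h₁₂)
  rw [both_comp_right, both_closed]
  have e₁ := e.comp (𝓢.basis Γ ◁ (c ≫ 𝓢.var x₁ ◁ (ρ_ (𝓢.var x₂)).inv) ≫
    (𝓢.appendIso Γ [x₁, x₂]).inv)
  have e₂ := (both_permEq (.refl k) (e'.comp (𝓢.var x₁ ◁ (ρ_ (𝓢.var x₂)).inv))).comp
    (𝓢.appendIso Γ [x₁, x₂]).inv
  rw [Category.assoc g, both_comp_right, Category.assoc] at e₂
  rw [Category.assoc] at e₁
  exact e₁.trans e₂

/-- Assignments for ground and stable variables are coalgebra morphisms. -/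
theorem promote {h : X.A ⊗ 𝓢.basis Δ ⟶ 𝓢.basis Γ} (hh : Env ρ Γ Δ h)
    (hΓ : ∀ x ∈ Γ, x.IsGround ∨ x.IsStable) :
    ∃ k : X.A ⟶ 𝓢.basis Γ, 𝓢.PermEq Δ h [] (closed k) ∧
      X.a ≫ 𝓢.bang.map k = k ≫ 𝓢.promote Γ hΓ := by
  induction Γ generalizing Δ with
  | nil => exact ⟨wk X, hh, (wkHom X).h⟩
  | cons x Γ ih =>
    obtain ⟨Δ₁, Δ₂, g, l, hg, hl, e⟩ := hh
    obtain ⟨k₂, e₂, hk₂⟩ := ih hl fun y hy => hΓ y (List.mem_cons_of_mem x hy)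
    obtain ⟨k₁, e₁, hk₁⟩ : ∃ k₁ : X.A ⟶ 𝓢.var x, 𝓢.PermEq Δ₁ g [] (closed k₁) ∧
        X.a ≫ 𝓢.bang.map k₁ = k₁ ≫ 𝓢.coalg x (hΓ x List.mem_cons_self) := by
      have hx := hΓ x List.mem_cons_self
      rcases x with ⟨_ | ⟨σ, τ⟩, n⟩ | ⟨σ, n⟩
      · obtain ⟨k, hk, -⟩ := hg
        exact ⟨k.f, hk, k.h⟩
      · exact (hx.elim id id : False).elim
      · obtain ⟨k, hk, -⟩ := hg
        exact ⟨k.f, hk, k.h⟩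
    refine ⟨dup X ≫ (k₁ ⊗ₘ k₂), ?_, ?_⟩
    · rw [← both_closed]
      exact e.trans (both_permEq e₁ e₂)
    · have := (dupHom X).h
      rw [Functor.map_comp, reassoc_of% this, ← Functor.LaxMonoidal.μ_natural,
        tensorHom_comp_tensorHom_assoc, hk₁, hk₂, ← tensorHom_comp_tensorHom,
        Category.assoc, Category.assoc]
      rfl

end Env

/-! ### Environments for merged and for bound variables. -/

theorem sem_merge (M : Term) (x x₁ x₂ : Var) {ρ ρ' : Var → Pred X} {b : Fin 0 → Pred X}
    (h : ∀ y, ρ' y ≤ ρ (if y = x₁ ∨ y = x₂ then x else y)) :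
    Sem M X ρ' b ≤ Sem (merge x x₁ x₂ M) X ρ b := by
  rw [merge, Tm.subst_eq_bind, Tm.subst_eq_bind, Tm.bind_bind]
  refine sem_bind M (fun y => Pred.le_trans (h y) ?_) fun i => i.elim0
  have hc {k : ℕ} : Tm.castLE k.zero_le (.fvar x) = .fvar x := rfl
  by_cases h₁ : y = x₁
  · simp only [h₁, hc, true_or, if_true, Tm.bind]
    -- The contraction rules allow `x` to be `x₂`; the second substitution then replaces `x` by
    -- itself.
    split_ifs <;> exact Pred.le_refl _
  · by_cases h₂ : y = x₂
    · simp only [h₂ ▸ h₁, h₂, hc, or_true, if_true, if_false, Tm.bind]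
      exact Pred.le_refl _
    · simp only [h₁, h₂, or_false, if_false, Tm.bind]
      exact Pred.le_refl _

theorem sem_close (M : Term) (x : Var) {ρ : Var → Pred X} {b : Fin 0 → Pred X} (P : Pred X) :
    Sem M X (fun y => if y = x then P else ρ y) b ≤ Sem (M.close x) X ρ (consEnv P b) := by
  rw [Tm.close_eq_bind]
  refine sem_bind M (fun y => ?_) fun i => i.elim0
  split_ifs <;> exact Pred.le_refl _

theorem Good.discard_nat {P : Pred X} {n : ℕ} {Δ : Basis} {g : X.A ⊗ 𝓢.basis Δ ⟶ 𝓢.num.N}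
    (hg : Good P (.ord .nat n) Δ g) :
    𝓢.PermEq Δ (g ≫ ComonObj.counit) [] (closed (wk X)) := by
  obtain ⟨k, hk, -⟩ := hg
  have := hk.comp (wk 𝓢.num.coalg)
  rwa [closed_comp, hom_wk, ExpNumerals.wk_coalg] at this

theorem Good.discard_stb {P : Pred X} {σ : Ty} {n : ℕ} {Δ : Basis}
    {g : X.A ⊗ 𝓢.basis Δ ⟶ 𝓢.bang.obj (𝓢.ty σ)} (hg : Good P (.stb σ n) Δ g) :
    𝓢.PermEq Δ (g ≫ ComonObj.counit) [] (closed (wk X)) := by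
  obtain ⟨k, hk, -⟩ := hg
  have := hk.comp (wk (𝓢.cofree (𝓢.ty σ)))
  rwa [closed_comp, hom_wk, wk_cofree] at this

/-- Renaming of two variables to the same variable in environments. -/
abbrev mergeEnv (ρ : Var → Pred X) (x x₁ x₂ : Var) : Var → Pred X :=
  fun y => ρ (if y = x₁ ∨ y = x₂ then x else y)

theorem Good.contract_nat {ρ : Var → Pred X} {n n₁ n₂ : ℕ} {Δ : Basis}
    {g : X.A ⊗ 𝓢.basis Δ ⟶ 𝓢.num.N} (hg : Good (ρ (.ord .nat n)) (.ord .nat n) Δ g) :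
    ∃ g₁ g₂ : X.A ⟶ 𝓢.num.N,
      Good (mergeEnv ρ (.ord .nat n) (.ord .nat n₁) (.ord .nat n₂) (.ord .nat n₁))
        (.ord .nat n₁) [] (closed g₁) ∧
      Good (mergeEnv ρ (.ord .nat n) (.ord .nat n₁) (.ord .nat n₂) (.ord .nat n₂))
        (.ord .nat n₂) [] (closed g₂) ∧
      𝓢.PermEq Δ (g ≫ ComonObj.comul) [] (closed (dup X ≫ (g₁ ⊗ₘ g₂))) := by
  obtain ⟨k, hk, hP⟩ := hg
  refine ⟨k.f, k.f, ⟨k, .refl _, by simpa [mergeEnv] using hP⟩,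
    ⟨k, .refl _, by simpa [mergeEnv] using hP⟩, ?_⟩
  have := hk.comp (dup 𝓢.num.coalg)
  rwa [closed_comp, hom_dup, ExpNumerals.dup_coalg] at this

theorem Good.contract_stb {ρ : Var → Pred X} {σ : Ty} {n n₁ n₂ : ℕ} {Δ : Basis}
    {g : X.A ⊗ 𝓢.basis Δ ⟶ 𝓢.bang.obj (𝓢.ty σ)}
    (hg : Good (ρ (.stb σ n)) (.stb σ n) Δ g) :
    ∃ g₁ g₂ : X.A ⟶ 𝓢.bang.obj (𝓢.ty σ),
      Good (mergeEnv ρ (.stb σ n) (.stb σ n₁) (.stb σ n₂) (.stb σ n₁))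
        (.stb σ n₁) [] (closed g₁) ∧
      Good (mergeEnv ρ (.stb σ n) (.stb σ n₁) (.stb σ n₂) (.stb σ n₂))
        (.stb σ n₂) [] (closed g₂) ∧
      𝓢.PermEq Δ (g ≫ ComonObj.comul) [] (closed (dup X ≫ (g₁ ⊗ₘ g₂))) := by
  obtain ⟨k, hk, hP⟩ := hg
  refine ⟨k.f, k.f, ⟨k, .refl _, by simpa [mergeEnv] using hP⟩,
    ⟨k, .refl _, by simpa [mergeEnv] using hP⟩, ?_⟩
  have := hk.comp (dup (𝓢.cofree (𝓢.ty σ)))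
  rwa [closed_comp, hom_dup, dup_cofree] at this

/-- Since `Γ, x₁, x₂` has no repetitions, redirecting `x₁` and `x₂` to `x` does not disturb the
variables of `Γ`. -/
theorem Env.contract_mergeEnv {ρ : Var → Pred X} {Γ Δ : Basis} {x x₁ x₂ : Var}
    {h : X.A ⊗ 𝓢.basis Δ ⟶ 𝓢.basis (Γ ++ [x])}
    (hh : Env ρ (Γ ++ [x]) Δ h) (hn : (Γ ++ [x₁, x₂]).Nodup)
    {c : 𝓢.var x ⟶ 𝓢.var x₁ ⊗ 𝓢.var x₂}
    (hc : ∀ Θ g, Good (ρ x) x Θ g → ∃ g₁ g₂, Good (mergeEnv ρ x x₁ x₂ x₁) x₁ [] (closed g₁) ∧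
      Good (mergeEnv ρ x x₁ x₂ x₂) x₂ [] (closed g₂) ∧
      𝓢.PermEq Θ (g ≫ c) [] (closed (dup X ≫ (g₁ ⊗ₘ g₂)))) :
    Env (mergeEnv ρ x x₁ x₂) (Γ ++ [x₁, x₂]) Δ (h ≫ 𝓢.contract Γ x x₁ x₂ c) := by
  refine hh.contract (fun y hy => ?_) hc
  have hd := (List.nodup_append'.1 hn).2.2 hy
  simp only [List.mem_cons, List.not_mem_nil, or_false] at hd
  exact congrArg ρ (if_neg hd).symm

theorem Env.update {ρ : Var → Pred X} {Γ Δ Θ : Basis} {x : Var}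
    {h : X.A ⊗ 𝓢.basis Δ ⟶ 𝓢.basis Γ} (hh : Env ρ Γ Δ h) (hx : x ∉ Γ) {P : Pred X}
    {g : X.A ⊗ 𝓢.basis Θ ⟶ 𝓢.var x} (hg : Good P x Θ g) :
    Env (fun y => if y = x then P else ρ y) (Γ ++ [x]) (Δ ++ Θ)
      (both X Δ Θ h g ≫ (𝓢.snocIso Γ x).inv) := by
  refine (hh.congr fun y hy => ?_).snoc (by simpa using hg)
  exact (if_neg (by rintro rfl; exact hx hy)).symm

theorem IsArg.good {σ : Ty} {n : ℕ} {Δ : Basis} {g : X.A ⊗ 𝓢.basis Δ ⟶ 𝓢.ty σ}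
    (hg : IsArg X σ Δ g) : Good (.single ⟨σ, Δ, g⟩) (.ord σ n) Δ g := by
  cases σ with
  | nat =>
    obtain ⟨k, hk⟩ := hg
    exact ⟨k, hk, .of_permEq hk.symm⟩
  | lolli σ τ => exact .refl _

/-- The interpretation of a derivation is a value of the term. -/
theorem sem_interp {Γ : Basis} {M : Term} {σ : Ty} (d : Deriv Γ M σ) {ρ : Var → Pred X}
    (b : Fin 0 → Pred X) {Δ : Basis} {h : X.A ⊗ 𝓢.basis Δ ⟶ 𝓢.basis Γ} (hΔ : Δ.Nodup)
    (hh : Env ρ Γ Δ h) : (Sem M X ρ b).rel ⟨σ, Δ, h ≫ 𝓢.interp d⟩ := by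
  induction d generalizing X Δ with
  | z =>
    have := PermEq.comp hh 𝓢.num.zero
    rw [closed_comp] at this
    exact .of_permEq this
  | s =>
    have := PermEq.comp hh (𝓢.interp .s)
    rw [closed_comp] at this
    exact .of_permEq this
  | p =>
    have := PermEq.comp hh (𝓢.interp .p)
    rw [closed_comp] at this
    exact .of_permEq this
  | lif _ dM dL dR ihM ihL ihR =>
    obtain ⟨Δ₁, Δ₂, h₁, h₂, hh₁, hh₂, e⟩ := hh.of_append
    have hn := List.nodup_append'.1 (e.perm.nodup_iff.1 hΔ)
    refine ⟨Δ₁, Δ₂, _, _, _, ihM b hn.1 hh₁, ihL b hn.2.1 hh₂, ihR b hn.2.1 hh₂, .of_permEq ?_⟩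
    have := e.comp ((𝓢.interp dM ⊗ₘ prod.lift (𝓢.interp dL) (𝓢.interp dR)) ≫ 𝓢.cond)
    rw [← prod.comp_lift, both_comp, Category.assoc]
    rw [Category.assoc] at this
    exact this
  | ap _ dM dN ihM ihN =>
    obtain ⟨Δ₁, Δ₂, h₁, h₂, hh₁, hh₂, e⟩ := hh.of_append
    have hn := List.nodup_append'.1 (e.perm.nodup_iff.1 hΔ)
    refine ⟨_, _, Δ₁, Δ₂, _, _, ihM b hn.1 hh₁, ihN b hn.2.1 hh₂, .of_permEq ?_⟩
    have := e.comp ((𝓢.interp dM ⊗ₘ 𝓢.interp dN) ≫ eval _ _)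
    rw [both_comp, Category.assoc]
    rw [Category.assoc] at this
    exact this
  | ex Γ x y Θ d ih =>
    have := ih b hΔ (hh.exchange hΔ)
    rw [Category.assoc] at this
    exact this
  | gv n =>
    obtain ⟨k, hk, hP⟩ := Env.singleton_iff.1 hh
    exact (ρ _).closed (.of_permEq hk) hP
  | hv σ τ n => exact Env.singleton_iff.1 hh
  | sv σ n =>
    obtain ⟨k, hk, hP⟩ := Env.singleton_iff.1 hh
    have := hk.comp (𝓢.bang.ε.app (𝓢.ty σ))
    rw [closed_comp, Category.assoc] at this
    exact (ρ _).closed (.of_permEq this) hP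
  | gw n hn d ih =>
    have := ih b hΔ (hh.discard fun Θ g hg => hg.discard_nat)
    rw [Category.assoc] at this
    exact this
  | sw σ n hn d ih =>
    have := ih b hΔ (hh.discard fun Θ g hg => hg.discard_stb)
    rw [Category.assoc] at this
    exact this
  | gc n n₁ n₂ hn d ih =>
    have := ih b hΔ (hh.contract_mergeEnv d.nodup fun Θ g hg => hg.contract_nat)
    rw [Category.assoc] at this
    exact sem_merge _ _ _ _ (fun _ => Pred.le_refl _) _ this
  | sc σ n n₁ n₂ hn d ih =>
    have := ih b hΔ (hh.contract_mergeEnv d.nodup fun Θ g hg => hg.contract_stb)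
    rw [Category.assoc] at this
    exact sem_merge _ _ _ _ (fun _ => Pred.le_refl _) _ this
  | @lam Γ σ n M τ d ih =>
    refine ⟨τ, Δ, h ≫ 𝓢.interp (.lam σ n d), fun Y k Θ g ha hn => ?_, .refl _⟩
    have hx : Var.ord σ n ∉ Γ := fun hx => (List.nodup_append'.1 d.nodup).2.2 hx (by simp)
    have := ih (fun i => (b i).pull k) hn ((hh.pull k).update hx (ha.good (n := n)))
    have := sem_close _ _ _ _ this
    rw [← Category.assoc, interp, both_comp_left, Category.assoc, curr_whiskerRight_eval,
      ← Category.assoc]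
    exact this
  | @mu Γ Γ' σ n M hΓ hΓ' d ih =>
    obtain ⟨k, ek, hk⟩ := hh.promote fun x hx => (List.mem_append.1 hx).imp (hΓ x) (hΓ' x)
    have hx : Var.stb σ n ∉ Γ ++ Γ' := fun hx => (List.nodup_append'.1 d.nodup).2.2 hx (by simp)
    -- By `Env.promote` the environment uses no linear variable and is a morphism `k` compatible
    -- with promotion. Hence `!k` slides past `promote`, and the functional is the curried body
    -- after `k`.
    refine ⟨k ≫ curr ((𝓢.snocIso _ (.stb σ n)).inv ≫ 𝓢.interp d), fun Y l w => ?_, .of_permEq ?_⟩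
    · have hk := (hh.of_permEq ek.symm).pull l
      rw [pull_closed] at hk
      have hw : Good (.single ⟨σ, [], closed (w.f ≫ 𝓢.bang.ε.app (𝓢.ty σ))⟩) (.stb σ n) []
        (closed w.f) := ⟨w, .refl _, .refl _⟩
      have := ih (fun i => (b i).pull l) List.nodup_nil (hk.update hx hw)
      have := sem_close _ _ _ _ this
      rw [both_closed, Category.assoc, closed_comp, Category.assoc] at this
      rw [← Category.assoc l.f, ← tensorHom_comp_whiskerRight, Category.assoc,
        curr_whiskerRight_eval]
      exact this
    · have := ek.comp (𝓢.promote _ (fun x hx => (List.mem_append.1 hx).imp (hΓ x) (hΓ' x)) ≫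
        𝓢.bang.map (curr ((𝓢.snocIso _ (.stb σ n)).inv ≫ 𝓢.interp d)) ≫ 𝓢.fix (𝓢.ty σ))
      rw [closed_comp, ← reassoc_of% hk] at this
      rw [Functor.map_comp, Category.assoc]
      exact this

/-- The interpretation of a basis is a retract of the generic environment, which consists of
distinct linear variables and the projections from a coalgebra. -/
theorem exists_env {Γ : Basis} (hΓ : Γ.Nodup) :
    ∃ (X : 𝓢.bang.Coalgebra) (ρ : Var → Pred X) (Δ : Basis) (h : X.A ⊗ 𝓢.basis Δ ⟶ 𝓢.basis Γ)
      (s : 𝓢.basis Γ ⟶ X.A ⊗ 𝓢.basis Δ),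
      (∀ x, (ρ x).Det) ∧ Δ ⊆ Γ ∧ Δ.Nodup ∧ Env ρ Γ Δ h ∧ s ≫ h = 𝟙 (𝓢.basis Γ) := by
  induction Γ with
  | nil =>
    refine ⟨𝓢.unitCoalg, fun _ => .zero _, [], closed (wk _), (ρ_ (𝟙_ C)).inv,
      fun _ => Pred.det_single _, List.Subset.refl _, List.nodup_nil, PermEq.refl _, ?_⟩
    rw [closed, Iso.inv_hom_id_assoc]
    exact 𝓢.e_unit
  | cons x Γ ih =>
    obtain ⟨hx, hΓ⟩ := List.nodup_cons.1 hΓ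
    obtain ⟨X, ρ, Δ, h, s, hρ, hΔ, hn, hh, hs⟩ := ih hΓ
    -- Ground and stable variables are treated alike: their coalgebra `K` is tensored onto `X` and
    -- the variable denotes the first projection.
    have key (K : 𝓢.bang.Coalgebra) (e : K.A = 𝓢.var x) (w : Val (tensorCoalg K X))
        (hw : Good (.single w) x [] (closed ((fstHom K X).f ≫ eqToHom e))) :
        ∃ (X : 𝓢.bang.Coalgebra) (ρ : Var → Pred X) (Δ : Basis)
        (h : X.A ⊗ 𝓢.basis Δ ⟶ 𝓢.basis (x :: Γ)) (s : 𝓢.basis (x :: Γ) ⟶ X.A ⊗ 𝓢.basis Δ),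
        (∀ x, (ρ x).Det) ∧ Δ ⊆ x :: Γ ∧ Δ.Nodup ∧ Env ρ (x :: Γ) Δ h ∧
        s ≫ h = 𝟙 (𝓢.basis (x :: Γ)) := by
      refine ⟨tensorCoalg K X, fun y => if y = x then .single w else (ρ y).pull (sndHom K X), Δ,
        both _ [] Δ (closed ((fstHom K X).f ≫ eqToHom e)) ((sndHom K X).f ▷ _ ≫ h),
        (eqToHom e.symm ⊗ₘ s) ≫ (α_ _ _ _).inv, fun y => ?_,
        List.subset_cons_of_subset _ hΔ, hn, ⟨[], Δ, _, _, by simpa using hw, ?_, .refl _⟩, ?_⟩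
      · dsimp only
        split_ifs
        · exact Pred.det_single _
        · exact (hρ y).pull _
      · refine (hh.pull (sndHom K X)).congr fun y hy => ?_
        exact (if_neg (by rintro rfl; exact hx hy)).symm
      · have e' : dup (tensorCoalg K X) ▷ 𝓢.basis Δ ≫ (α_ _ _ _).hom ≫
            ((fstHom K X).f ⊗ₘ (sndHom K X).f ▷ 𝓢.basis Δ) = (α_ _ _ _).hom := by
          rw [← tensorHom_id (sndHom K X).f, ← associator_naturality, tensorHom_id,
            ← comp_whiskerRight_assoc, dup_fst_snd, id_whiskerRight, Category.id_comp]
        rw [both_closed_left, ← tensorHom_comp_tensorHom, reassoc_of% e', Category.assoc,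
          Iso.inv_hom_id_assoc, tensorHom_comp_tensorHom, hs]
        simp
    rcases x with ⟨_ | ⟨σ, τ⟩, n⟩ | ⟨σ, n⟩
    · refine key 𝓢.num.coalg rfl ⟨.nat, [], closed (fstHom _ _).f⟩ ⟨fstHom _ _, ?_, .refl _⟩
      rw [eqToHom_refl, Category.comp_id]
      exact .refl _
    -- A higher-order variable carries no coalgebra structure, so it becomes a linear variable
    -- standing for itself. The inclusion `Δ ⊆ Γ` in the induction provides its freshness.
    · have hx' : Var.ord (.lolli σ τ) n ∉ Δ := fun h => hx (hΔ h)
      refine ⟨X, fun y => if y = .ord (.lolli σ τ) n then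
        .single ⟨.lolli σ τ, [.ord (.lolli σ τ) n], slot X _⟩ else ρ y,
        Δ ++ [.ord (.lolli σ τ) n], both X Δ _ h (slot X _) ≫ (β_ _ _).hom,
        (β_ _ _).hom ≫ s ▷ _ ≫ (α_ _ _ _).hom ≫ X.A ◁ (𝓢.snocIso Δ _).inv,
        fun y => ?_, ?_, hn.append (List.nodup_singleton _) (by simpa using hx'),
        ⟨[.ord (.lolli σ τ) n], Δ, slot X _, h, ?_, ?_,
          both_comm (by simpa using hx') h (slot X _)⟩, ?_⟩
      · dsimp only
        split_ifs
        · exact Pred.det_single _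
        · exact hρ y
      · simp only [List.append_subset, List.subset_cons_of_subset _ hΔ, true_and]
        simp
      · beta_reduce
        rw [if_pos rfl]
        exact .refl _
      · refine hh.congr fun y hy => ?_
        exact (if_neg (by rintro rfl; exact hx hy)).symm
      · rw [both_slot]
        simp only [Category.assoc, ← whiskerLeft_comp_assoc, Iso.inv_hom_id, whiskerLeft_id,
          Category.id_comp, Iso.hom_inv_id_assoc, ← comp_whiskerRight_assoc, hs, id_whiskerRight,
          SymmetricCategory.symmetry]
    · refine key (𝓢.cofree (𝓢.ty σ)) rfl ⟨σ, [], closed ((fstHom _ _).f ≫ 𝓢.bang.ε.app _)⟩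
        ⟨fstHom _ _, ?_, .refl _⟩
      rw [eqToHom_refl, Category.comp_id]
      exact .refl _

end SllCategory

end
end Sll

theorem mainTheorem1 {C : Type u} [Category.{v} C] [MonoidalCategory C] [SymmetricCategory C]
    [MonoidalClosed C] [HasFiniteProducts C] (𝓢 : Sll.SllCategory C)
    {Γ : Sll.Basis} {σ : Sll.Ty} {M N : Sll.Term}
    (dM : Sll.Deriv Γ M σ) (dN : Sll.Deriv Γ N σ) (h : Sll.Eqv M N) :
    𝓢.interp dM = 𝓢.interp dN := by
  obtain ⟨X, ρ, Δ, k, s, hρ, -, hn, hk, hs⟩ := Sll.SllCategory.exists_env (𝓢 := 𝓢) dM.nodup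
  obtain ⟨K, hM, hN⟩ := h.join
  have run {L L' : Sll.Term} (hr : Relation.ReflTransGen Sll.Par L L')
      {u : Sll.SllCategory.Val X} (hu : u.ctx.Nodup)
      (hL : (Sll.SllCategory.Sem L X ρ fun i => i.elim0).rel u) :
      (Sll.SllCategory.Sem L' X ρ fun i => i.elim0).rel u := by
    induction hr with
    | refl => exact hL
    | tail _ hp ih => exact Sll.SllCategory.sem_par hp hu ih
  -- Only the common reduct `K` is compared with itself; it need not have a derivation.
  have e := Sll.SllCategory.sem_det K hρ (fun i => i.elim0) _ _ hn hn
    (run hM hn (Sll.SllCategory.sem_interp dM _ hn hk))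
    (run hN hn (Sll.SllCategory.sem_interp dN _ hn hk))
  have := s ≫= e.permEq.eq
  rwa [reassoc_of% hs, reassoc_of% hs] at this
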